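/- **Setting.** Let $V$ be a set. A *universe of vertex separations* on $V$ is a set $\mathcal U$ of pairs $(A,B)$ of subsets of $V$ with $A\cup B=V$ (its *separations*), closed under $(A,B)\wedge(C,D)=(A\cap C,B\cup D)$, $(A,B)\vee(C,D)=(A\cup C,B\cap D)$ and $(A,B)^*=(B,A)$, and ordered by $(A,B)\le(C,D)$ iff $A\subseteq C$ and $D\subseteq B$. The *order* of $(A,B)$ is $|A\cap B|\in\mathbb N\cup\{\infty\}$. $\mathcal U$ is *limit-closed* if for every $k\in\mathbb N$ every non-empty chain of separations $(A_i,B_i)$ of order at most $k$ has a supremum in $\mathcal U$, which has order at most $k$ and is of the form $(\bigcup_i A_i\cup X,\bigcap_i B_i)$ for some $X\subseteq V$. Fix a limit-closed universe $\mathcal U$ on $V$ and $k\in\mathbb N$. **Profiles.** Let $S_m$ be the set of separations of $\mathcal U$ of order less than $m$. An *$m$-profile* is a set $Q\subseteq S_m$ that contains exactly one element of $\{s,s^*\}$ for each $s\in S_m$, such that $r,s\in Q$ and $r^*\le s$ imply $\{r,r^*\}=\{s,s^*\}$, and such that $(r\vee s)^*\notin Q$ for all $r,s\in Q$. **Cyclic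 orders.** In a cyclically ordered set, $]a,b[$ is the set of $c$ with $(a,c,b)$ in the order, and $[a,b]={]a,b[}\cup\{a,b\}$. A subset $J$ of a cyclically ordered set is an *interval* if for all $s,t\in J$ one of $[s,t]$, $[t,s]$ is contained in $J$. The *cycle completion* $C(I)$ of a cyclically ordered set $I$ with at least two elements is the (up to isomorphism unique) cyclically ordered set $C(I)\supseteq I$ inducing the order of $I$ such that every interval $J\ne\emptyset,I$ of $I$ is $[v,w]\cap I$ for a unique pair $v,w\in C(I)\setminus I$. A map $f$ between cyclically ordered sets is *monotone* if $f(y)\in{]f(x),f(z)[}$ implies $y\in{]x,z[}$. **Pseudoflowers.** A *$k$-pseudoflower* is a family $\Phi=(P_z)_{z\in C(I)}$ of subsets of $V$, where $I$ is a cyclically ordered set with $|I|\ge 2$, such that, with $X=V\setminus\bigcup_z P_z$, $V(v,w)=X\cup\bigcup_{z\in[v,w]}P_z$ and $S(v,w)=(V(v,w),V(w,v))$ for $v,w\in C(I)\setminus I$: 1. $|P_v|=(k-|X|)/2$ for all $v\in C(I)\setminus I$; 2. for all distinct $v,w\in C(I)\setminus I$, $S(v,w)$ is a separation in $\mathcal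 U$ of order at most $k$ and $V(v,w)\cap V(w,v)=P_v\cup P_w\cup X$; 3. $P_p\cup P_s\subseteq P_i$ for every $i\in I$ with predecessor $p$ and successor $s$ in $C(I)$; 4. for all $i,i'\in I$, if $|P_i|=(k-|X|)/2$ and $P_i=P_{i'}$, then $i=i'$. It *displays* the separations $S(v,w)$ with $v\neq w$ in $C(I)\setminus I$, and it *distinguishes* two $(k+1)$-profiles $Q,Q'$ if it displays some $s$ with $s\in Q$ and $s^*\in Q'$. It is a *$k$-flower* if all displayed $S(v,w)$ have order exactly $k$ and $V(v,w)\setminus V(w,v)$ and $V(w,v)\setminus V(v,w)$ are non-empty. It has four *petals* if $|I|=4$. A $k$-pseudoflower $\Phi'=(P'_z)_{z\in C(I')}$ *extends* $\Phi$, written $\Phi\le\Phi'$, if $X=X'$ and there is a surjective monotone map $F:C(I')\to C(I)$ with $F(I')=I$ and $V(v,w)=X\cup\bigcup_{z\in F^{-1}([v,w])}P'_z$ for all $v,w\in C(I)\setminus I$. A $k$-pseudoflower $\Psi$ is *$\le$-maximal* if $\Psi\le\Psi'$ implies $\Psi'\le\Psi$ for all $k$-pseudoflowers $\Psi'$. **Theorem.**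 Let $\Phi$ be a $k$-pseudoflower that extends a $k$-flower with four petals and that pairwise distinguishes three $(k+1)$-profiles, all of which contain the same separations of order less than $k$. Then there is a $\le$-maximal $k$-pseudoflower $\Psi$ with $\Phi\le\Psi$. -/

import Mathlib

universe u

/-! ### Cyclic orders

A cyclic order in the strict sense (cyclic, antisymmetric, linear, transitive set of triples) is the
relation `sbtw` of Mathlib's `CircularOrder`. -/

/-- The closed interval `[a, b] = ]a, b[ ∪ {a, b}` of a cyclic order. In contrast to `Set.cIcc`,
`[a, a]` is `{a}`. -/
def closedArc {C : Type u} [CircularOrder C] (a b : C) : Set C :=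
  Set.cIoo a b ∪ {a, b}

/-- `J` is an interval of the set `I` with the cyclic order induced on `I`. -/
def IsIntervalOf {C : Type u} [CircularOrder C] (I J : Set C) : Prop :=
  J ⊆ I ∧ ∀ s ∈ J, ∀ t ∈ J, closedArc s t ∩ I ⊆ J ∨ closedArc t s ∩ I ⊆ J

/-- `C` is a cycle completion of its subset `I` (with the induced cyclic order): every non-trivial
interval of `I` is `[v, w] ∩ I` for a unique pair `v, w` of elements of `C \ I`. -/
def IsCycleCompletion {C : Type u} [CircularOrder C] (I : Set C) : Prop :=
  ∀ J : Set C, IsIntervalOf I J → J.Nonempty → J ≠ I →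
    ∃! p : C × C, p.1 ∉ I ∧ p.2 ∉ I ∧ closedArc p.1 p.2 ∩ I = J

/-- `s` is the successor of `a` in the cyclic order `C`. -/
def IsCyclicSucc {C : Type u} [CircularOrder C] (a s : C) : Prop :=
  s ≠ a ∧ ∀ b, b ≠ a → b ≠ s → b ∉ closedArc a s

/-- `p` is the predecessor of `a` in the cyclic order `C`. -/
def IsCyclicPred {C : Type u} [CircularOrder C] (a p : C) : Prop :=
  p ≠ a ∧ ∀ b, b ≠ a → b ≠ p → b ∉ closedArc p a

/-- Monotone maps between cyclic orders: `f y ∈ ]f x, f z[` implies `y ∈ ]x, z[`. -/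
def CyclicMonotone {C D : Type u} [CircularOrder C] [CircularOrder D] (f : C → D) : Prop :=
  ∀ x y z, sbtw (f x) (f y) (f z) → sbtw x y z

/-! ### Universes of vertex separations -/

/-- A pair `(A, B)` of vertex sets. -/
@[ext]
structure VSep (V : Type u) where
  left : Set V
  right : Set V

namespace VSep

variable {V : Type u}

/-- The partial order of separations: `(A, B) ≤ (C, D)` if `A ⊆ C` and `D ⊆ B`. -/
def le (s t : VSep V) : Prop := s.left ⊆ t.left ∧ t.right ⊆ s.right

def inf (s t : VSep V) : VSep V := ⟨s.left ∩ t.left, s.right ∪ t.right⟩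

def sup (s t : VSep V) : VSep V := ⟨s.left ∪ t.left, s.right ∩ t.right⟩

/-- The inverse `(B, A)` of `(A, B)`. -/
def inv (s : VSep V) : VSep V := ⟨s.right, s.left⟩

/-- The order of `(A, B)` is the size of `A ∩ B`, or `∞` if that set is infinite. -/
noncomputable def order (s : VSep V) : ℕ∞ := (s.left ∩ s.right).encard

end VSep

/-- A universe of vertex separations on the ground set `V`. -/
structure SepUniverse (V : Type u) where
  seps : Set (VSep V)
  cover : ∀ s ∈ seps, s.left ∪ s.right = Set.univ
  inf_mem : ∀ s ∈ seps, ∀ t ∈ seps, s.inf t ∈ seps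
  sup_mem : ∀ s ∈ seps, ∀ t ∈ seps, s.sup t ∈ seps
  inv_mem : ∀ s ∈ seps, s.inv ∈ seps

/-- A universe of vertex separations is limit-closed if every (non-empty) chain of separations
`(Aᵢ, Bᵢ)` of order at most `k` has a supremum in the universe, which has order at most `k` and is of
the form `(⋃ Aᵢ ∪ X, ⋂ Bᵢ)` for some vertex set `X`. -/
def SepUniverse.LimitClosed {V : Type u} (U : SepUniverse V) : Prop :=
  ∀ (k : ℕ) (c : Set (VSep V)), c ⊆ U.seps → c.Nonempty → IsChain VSep.le c →
    (∀ s ∈ c, s.order ≤ k) →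
    ∃ t ∈ U.seps, (∀ s ∈ c, s.le t) ∧ (∀ r ∈ U.seps, (∀ s ∈ c, s.le r) → t.le r) ∧
      t.order ≤ k ∧ (∃ X : Set V, t.left = (⋃ s ∈ c, s.left) ∪ X) ∧ t.right = ⋂ s ∈ c, s.right

/-- The separation system `S_k` of all separations of order less than `k`. -/
def SepUniverse.sys {V : Type u} (U : SepUniverse V) (k : ℕ) : Set (VSep V) :=
  {s | s ∈ U.seps ∧ s.order < k}

/-- Consistent orientations of `S_k`. -/
structure SepUniverse.IsConsistentOrientation {V : Type u} (U : SepUniverse V) (k : ℕ)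
    (O : Set (VSep V)) : Prop where
  subset : O ⊆ U.sys k
  orient : ∀ s ∈ U.sys k, ∃! t, (t = s ∨ t = s.inv) ∧ t ∈ O
  consistent : ∀ r ∈ O, ∀ s ∈ O, r.inv.le s → ({r, r.inv} : Set (VSep V)) = {s, s.inv}

/-- `k`-profiles. -/
structure SepUniverse.IsProfile {V : Type u} (U : SepUniverse V) (k : ℕ)
    (Q : Set (VSep V)) : Prop extends U.IsConsistentOrientation k Q where
  profile : ∀ r ∈ Q, ∀ s ∈ Q, (r.sup s).inv ∉ Q

/-! ### Pseudoflowers -/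

/-- A cyclically ordered set `C` with a subset `I` of at least two elements such that `C` is the cycle
completion of `I`, together with a family `(P z)`, `z ∈ C`, of vertex sets. -/
structure CyclicFamily (V : Type u) where
  C : Type u
  circ : CircularOrder C
  I : Set C
  nontrivial : I.Nontrivial
  completion : IsCycleCompletion I
  P : C → Set V

attribute [instance] CyclicFamily.circ

namespace CyclicFamily

variable {V : Type u} (Φ : CyclicFamily V)

/-- The set `X` of all vertices that lie in no `P z`. -/
def X : Set V := (⋃ z, Φ.P z)ᶜ

/-- The set `V(v, w)`. -/
def intervalSet (v w : Φ.C) : Set V := (⋃ z ∈ closedArc v w, Φ.P z) ∪ Φ.X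

/-- The pair `S(v, w) = (V(v, w), V(w, v))`. -/
def S (v w : Φ.C) : VSep V := ⟨Φ.intervalSet v w, Φ.intervalSet w v⟩

end CyclicFamily

/-- `k`-pseudoflowers of the universe `U`. The equation `|A| = (k - |X|) / 2` is written as
`2 * |A| + |X| = k`, with sizes in `ℕ∞`. -/
structure Pseudoflower {V : Type u} (U : SepUniverse V) (k : ℕ) extends CyclicFamily V where
  card_cutpoint : ∀ v ∉ I, 2 * (P v).encard + toCyclicFamily.X.encard = k
  sep_mem : ∀ v ∉ I, ∀ w ∉ I, v ≠ w → toCyclicFamily.S v w ∈ U.seps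
  sep_order : ∀ v ∉ I, ∀ w ∉ I, v ≠ w → (toCyclicFamily.S v w).order ≤ k
  separator : ∀ v ∉ I, ∀ w ∉ I, v ≠ w →
    toCyclicFamily.intervalSet v w ∩ toCyclicFamily.intervalSet w v =
      P v ∪ P w ∪ toCyclicFamily.X
  neighbor_subset : ∀ i ∈ I, ∀ c, IsCyclicPred i c ∨ IsCyclicSucc i c → P c ⊆ P i
  star : ∀ i ∈ I, ∀ j ∈ I, 2 * (P i).encard + toCyclicFamily.X.encard = k → P i = P j → i = j

namespace Pseudoflower

variable {V : Type u} {U : SepUniverse V} {k : ℕ}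

/-- `k`-flowers: all interval separations have order exactly `k` and two non-empty strict sides. -/
def IsFlower (Φ : Pseudoflower U k) : Prop :=
  ∀ v ∉ Φ.I, ∀ w ∉ Φ.I, v ≠ w →
    (Φ.S v w).order = k ∧
    (Φ.intervalSet v w \ Φ.intervalSet w v).Nonempty ∧
    (Φ.intervalSet w v \ Φ.intervalSet v w).Nonempty

/-- `Φ.ExtendedBy Φ'` is the relation `Φ ≤ Φ'`, that is, `Φ'` extends `Φ`. -/
def ExtendedBy (Φ Φ' : Pseudoflower U k) : Prop :=
  Φ.X = Φ'.X ∧ ∃ F : Φ'.C → Φ.C, Function.Surjective F ∧ CyclicMonotone F ∧ F '' Φ'.I = Φ.I ∧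
    ∀ v ∉ Φ.I, ∀ w ∉ Φ.I,
      Φ.intervalSet v w = Φ.X ∪ ⋃ z ∈ F ⁻¹' closedArc v w, Φ'.P z

/-- Maximality in the pre-order `≤`. -/
def IsMaximal (Φ : Pseudoflower U k) : Prop :=
  ∀ Φ' : Pseudoflower U k, Φ.ExtendedBy Φ' → Φ'.ExtendedBy Φ

/-- `Φ` displays `s` if `s` is an interval separation of `Φ`. -/
def Displays (Φ : Pseudoflower U k) (s : VSep V) : Prop :=
  ∃ v ∉ Φ.I, ∃ w ∉ Φ.I, v ≠ w ∧ s = Φ.S v w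

/-- `Φ` distinguishes two profiles if they orient some separation displayed by `Φ` differently. -/
def Distinguishes (Φ : Pseudoflower U k) (Q Q' : Set (VSep V)) : Prop :=
  ∃ s, Φ.Displays s ∧ s ∈ Q ∧ s.inv ∈ Q'

end Pseudoflower

/-! The cyclic order is cut open at one of the four cut points inherited from the flower, the base
point, which becomes both ends of a line. A cut point is then encoded by a pair of vertex sets: what
is met before it and what is met after it. Vertices of the base point itself are assigned with the
help of a cut point `d` disjoint from it (`lineSep`). The pairs form a chain, and the vertex sets of
all arcs and cut points can be recovered from it (`arcIn`, `arcOut`, `pt`). Extending a pseudoflower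
thus means inserting pairs into the jumps of a chain. A pair may be used twice, with a petal no
larger than the cut point between the two copies; axiom 4 says that no vertex set may be doubled
twice.

Zorn's lemma for a chain `D` with its set `D₂` of doubled members is easy, since each condition
involves at most two members (`IsAdmissible.exists_maximal`). The work lies in showing that a
maximal chain is complete and has enough jumps to come from a pseudoflower
(`IsAdmissible.linModel`).

For completeness, each cut of the chain needs a limit with exactly `m = (k - |X|) / 2` vertices.
Limit-closedness supplies a limit whose arc to a fixed cut point has order at most `k`, so it has at
most `m` vertices (`LinSys.exists_candidate`, `CutSystem.encard_le_of_order_le`). If it had fewer,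
every arc ending in it would have order less than `k`, so the three profiles would orient all these
arcs alike. Joining overlapping arcs, one sees that at most one further binary choice is left to a
profile, so two of the three profiles are not distinguished, a contradiction
(`CutSystem.le_encard_of_profiles`). Hence limits may be added and already belong to a maximal
chain.

A vertex in no cut point splits the chain, and the limits from both sides bound a jump containing
it. If some interval of the chain had neither a jump nor a doubled member, then a subinterval would
have only finitely many vertices outside `X`, hence only finitely many members, and a finite chain
has jumps (`IsAdmissible.exists_jump_or_double`).

Finally, an extension of the resulting pseudoflower yields an admissible pair above the maximal one,
hence the same pair. Its line therefore embeds back into the doubled chain, which is the reverse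
extension (`IsAdmissible.isMaximal`). -/

/-! ### Circular orders seen from a base point -/

section BaseOrder

variable {C : Type u} [CircularOrder C]

theorem sbtw_total_of_ne {a b c : C} (hab : a ≠ b) (hbc : b ≠ c) (hca : c ≠ a) :
    sbtw a b c ∨ sbtw a c b := by
  by_contra! h
  have h1 : btw c b a := btw_iff_not_sbtw.2 h.1
  have h2 : btw b c a := btw_iff_not_sbtw.2 h.2
  rcases h1.antisymm h2.cyclic_right with h | h | h
  · exact hbc h.symm
  · exact hab h.symm
  · exact hca h.symm

theorem ne_left_of_sbtw {a b c : C} (h : sbtw a b c) : a ≠ b := by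
  rintro rfl; exact sbtw_irrefl_left h

theorem ne_right_of_sbtw {a b c : C} (h : sbtw a b c) : b ≠ c := by
  rintro rfl; exact sbtw_irrefl_right h

theorem ne_ends_of_sbtw {a b c : C} (h : sbtw a b c) : a ≠ c := by
  rintro rfl; exact sbtw_irrefl_left_right h

/-- The linear order with least element `b` obtained by cutting a circular order at `b`. -/
noncomputable abbrev baseOrder (b : C) : LinearOrder C where
  le x y := x = b ∨ x = y ∨ sbtw b x y
  le_refl x := Or.inr (Or.inl rfl)
  le_trans x y z := by
    rintro (rfl | rfl | h) (h' | h' | h')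
    · exact Or.inl rfl
    · exact Or.inl rfl
    · exact Or.inl rfl
    · exact Or.inl h'
    · exact Or.inr (Or.inl h')
    · exact Or.inr (Or.inr h')
    · exact absurd (h' ▸ h) sbtw_irrefl_left_right
    · exact Or.inr (Or.inr (h' ▸ h))
    · exact Or.inr (Or.inr (h.trans_right h'))
  le_antisymm x y := by
    rintro (rfl | rfl | h) (h' | h' | h')
    · exact h'.symm
    · exact h'.symm
    · exact absurd h' sbtw_irrefl_left_right
    · rfl
    · rfl
    · rfl
    · exact absurd (h' ▸ h) sbtw_irrefl_left_right
    · exact h'.symm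
    · exact absurd (h.trans_right h') sbtw_irrefl_right
  le_total x y := by
    by_cases hx : x = b
    · exact Or.inl (Or.inl hx)
    by_cases hy : y = b
    · exact Or.inr (Or.inl hy)
    by_cases hxy : x = y
    · exact Or.inl (Or.inr (Or.inl hxy))
    rcases sbtw_total_of_ne (Ne.symm hx) hxy hy with h | h
    · exact Or.inl (Or.inr (Or.inr h))
    · exact Or.inr (Or.inr (Or.inr h))
  toDecidableLE := Classical.decRel _

theorem baseOrder_lt_iff {b x y : C} :
    (baseOrder b).lt x y ↔ x ≠ y ∧ (x = b ∨ sbtw b x y) := by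
  let := baseOrder b
  show x < y ↔ _
  rw [lt_iff_le_and_ne]
  constructor
  · rintro ⟨rfl | rfl | h, hne⟩
    · exact ⟨hne, Or.inl rfl⟩
    · exact absurd rfl hne
    · exact ⟨hne, Or.inr h⟩
  · rintro ⟨hne, rfl | h⟩
    · exact ⟨Or.inl rfl, hne⟩
    · exact ⟨Or.inr (Or.inr h), hne⟩

theorem baseOrder_lt_iff_sbtw {b x y : C} (hx : x ≠ b) :
    (baseOrder b).lt x y ↔ sbtw b x y := by
  rw [baseOrder_lt_iff]
  exact ⟨fun h => h.2.resolve_left hx, fun h => ⟨ne_right_of_sbtw h, Or.inr h⟩⟩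

theorem baseOrder_bot_lt {b y : C} (hy : y ≠ b) : (baseOrder b).lt b y :=
  baseOrder_lt_iff.2 ⟨hy.symm, Or.inl rfl⟩

theorem baseOrder_bot_le {b : C} (y : C) : (baseOrder b).le b y := Or.inl rfl

/-- A chain from the base point is cyclically ordered. -/
theorem sbtw_of_baseOrder {b x y z : C} (hxy : (baseOrder b).lt x y) (hyz : (baseOrder b).lt y z) :
    sbtw x y z := by
  have hy : y ≠ b := by
    rintro rfl
    let := baseOrder y
    exact absurd (show y ≤ x from baseOrder_bot_le x) (not_le.2 hxy)
  rw [baseOrder_lt_iff_sbtw hy] at hyz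
  rcases (baseOrder_lt_iff.1 hxy).2 with rfl | h
  · exact hyz
  · exact (hyz.cyclic_left.trans_right h.cyclic_right).cyclic_right

/-- The circular order in terms of the linear order from a base point. -/
theorem sbtw_iff_baseOrder (b : C) {x y z : C} :
    sbtw x y z ↔ ((baseOrder b).lt x y ∧ (baseOrder b).lt y z) ∨
      ((baseOrder b).lt y z ∧ (baseOrder b).lt z x) ∨
      ((baseOrder b).lt z x ∧ (baseOrder b).lt x y) := by
  let := baseOrder b
  constructor
  · intro h
    have hxy := ne_left_of_sbtw h
    have hyz := ne_right_of_sbtw h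
    have hxz := ne_ends_of_sbtw h
    show (x < y ∧ y < z) ∨ (y < z ∧ z < x) ∨ (z < x ∧ x < y)
    rcases lt_or_gt_of_ne hxy with h1 | h1 <;> rcases lt_or_gt_of_ne hyz with h2 | h2 <;>
      rcases lt_or_gt_of_ne hxz with h3 | h3
    · exact Or.inl ⟨h1, h2⟩
    · exact Or.inl ⟨h1, h2⟩
    · exact absurd (sbtw_of_baseOrder h3 h2) (fun h' => h.not_sbtw h'.cyclic_left)
    · exact Or.inr (Or.inr ⟨h3, h1⟩)
    · exact absurd (sbtw_of_baseOrder h1 h3).cyclic_left.cyclic_left h.not_sbtw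
    · exact Or.inr (Or.inl ⟨h2, h3⟩)
    · exact absurd (sbtw_of_baseOrder h2 h1) h.not_sbtw
    · exact absurd (sbtw_of_baseOrder h2 h1) h.not_sbtw
  · rintro (⟨h1, h2⟩ | ⟨h1, h2⟩ | ⟨h1, h2⟩)
    · exact sbtw_of_baseOrder h1 h2
    · exact (sbtw_of_baseOrder h1 h2).cyclic_right
    · exact (sbtw_of_baseOrder h1 h2).cyclic_left

theorem mem_closedArc {a b c : C} : c ∈ closedArc a b ↔ sbtw a c b ∨ c = a ∨ c = b := by
  simp only [closedArc, Set.mem_union, Set.mem_cIoo, Set.mem_insert_iff, Set.mem_singleton_iff]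

theorem closedArc_self (a : C) : closedArc a a = {a} := by
  ext c
  rw [mem_closedArc]
  simp [sbtw_irrefl_left_right]

end BaseOrder

/-! ### Cut systems -/

/-- The laws of the sets `V(v, w)` of a pseudoflower, for the cut points alone. -/
structure CutSystem {V G : Type u} [CircularOrder G] (W : G → G → Set V) (P : G → Set V)
    (X : Set V) : Prop where
  union : ∀ ⦃a b⦄, a ≠ b → W a b ∪ W b a = Set.univ
  inter : ∀ ⦃a b⦄, a ≠ b → W a b ∩ W b a = P a ∪ P b ∪ X
  trans : ∀ ⦃a b c⦄, sbtw a b c → W a c = W a b ∪ W b c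
  disj : ∀ a, Disjoint (P a) X

namespace CutSystem

variable {V G : Type u} [CircularOrder G] {W : G → G → Set V} {P : G → Set V} {X : Set V}

theorem ends_subset (h : CutSystem W P X) {a b : G} (hab : a ≠ b) : P a ∪ P b ∪ X ⊆ W a b :=
  (h.inter hab) ▸ Set.inter_subset_left

theorem right_subset (h : CutSystem W P X) {a b : G} (hab : a ≠ b) : P b ⊆ W a b :=
  fun _ hx => h.ends_subset hab (Or.inl (Or.inr hx))

theorem subset_of_sbtw_left (h : CutSystem W P X) {a b c : G} (hs : sbtw a b c) :
    W a b ⊆ W a c := h.trans hs ▸ Set.subset_union_left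

theorem subset_of_sbtw_right (h : CutSystem W P X) {a b c : G} (hs : sbtw a b c) :
    W b c ⊆ W a c := h.trans hs ▸ Set.subset_union_right

theorem subset_of_mem (h : CutSystem W P X) {a b c : G} (hs : sbtw a b c) : P b ⊆ W a c :=
  (h.right_subset (ne_left_of_sbtw hs)).trans (h.subset_of_sbtw_left hs)

/-- The cut points that use a fixed vertex form an interval. -/
theorem interval (h : CutSystem W P X) {a b c d : G} (hs : sbtw a b c) (hs' : sbtw c d a) {x : V}
    (ha : x ∈ P a) (hc : x ∈ P c) : x ∈ P b ∨ x ∈ P d := by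
  have e : ∀ x y z : G, sbtw x y z ↔ _ := fun x y z => sbtw_iff_baseOrder a
  have h1 : sbtw b c d := by
    let := baseOrder a
    have hb := baseOrder_bot_le (b := a) b
    grind
  have h2 : sbtw d a b := by
    let := baseOrder a
    have hb := baseOrder_bot_le (b := a) b
    grind
  -- Both arcs between `b` and `d` contain `x`, one through `c` and one through `a`, so `x` lies in
  -- their separator.
  have hx : x ∈ P b ∪ P d ∪ X := h.inter (ne_ends_of_sbtw h1) ▸
    ⟨h.subset_of_mem h1 hc, h.subset_of_mem h2 ha⟩
  exact hx.resolve_right fun hX => Set.disjoint_left.1 (h.disj a) ha hX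

/-- A common vertex of `a` and `c` would have to pass through `b` or `d`. Disjointness from one cut
point on either side therefore suffices; this is how a limit is seen to be disjoint from a fixed cut
point. -/
theorem disjoint_of_sbtw (h : CutSystem W P X) {a b c d : G} (hs : sbtw a b c) (hs' : sbtw c d a)
    (hab : Disjoint (P a) (P b)) (had : Disjoint (P a) (P d)) : Disjoint (P a) (P c) := by
  rw [Set.disjoint_left]
  intro x ha hc
  rcases h.interval hs hs' ha hc with hx | hx
  · exact Set.disjoint_left.1 hab ha hx
  · exact Set.disjoint_left.1 had ha hx

/-- Two overlapping arcs whose inner end points use disjoint vertex sets. -/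
theorem join (h : CutSystem W P X) {a b b' d : G} (h1 : sbtw a b' d) (h2 : sbtw a b d)
    (h3 : b' = b ∨ sbtw a b' b) (hd : Disjoint (P b) (P b')) :
    W a b ∪ W b' d = W a d ∧ W b a ∩ W d b' = W d a := by
  have e1 := h.trans h2
  have e2 := h.trans h2.cyclic_left
  have e3 := h.trans h1.cyclic_right
  have hda : d ≠ a := (ne_ends_of_sbtw h2).symm
  have hab' : a ≠ b' := ne_left_of_sbtw h1
  have hbd : b ≠ d := ne_right_of_sbtw h2
  have key : W b' d = W b d ∨ (W b' d = W b' b ∪ W b d ∧ W b' b ⊆ W a b) := by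
    rcases h3 with rfl | h3
    · exact Or.inl rfl
    · refine Or.inr ⟨h.trans ?_, h.subset_of_sbtw_right h3⟩
      exact (h2.cyclic_left.trans_right h3.cyclic_right).cyclic_right
  have hba : W b d ⊆ W b' a := by
    rcases h3 with rfl | h3
    · exact h.subset_of_sbtw_left h2.cyclic_left
    · exact (h.subset_of_sbtw_left h2.cyclic_left).trans (h.subset_of_sbtw_right h3.cyclic_left)
  have hdb : W a b' ⊆ W d b := by
    rcases h3 with rfl | h3
    · exact h.subset_of_sbtw_right h1.cyclic_right
    · exact (h.subset_of_sbtw_left h3).trans (h.subset_of_sbtw_right h2.cyclic_right)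
  constructor
  · rw [e1]
    rcases key with key | ⟨key, hs⟩
    · rw [key]
    · rw [key, ← Set.union_assoc, Set.union_eq_self_of_subset_right hs]
  · rw [e2, e3]
    refine subset_antisymm ?_ fun x hx => ⟨Or.inr hx, Or.inl hx⟩
    rintro x ⟨hx | hx, hx' | hx'⟩
    · exact hx'
    -- The critical case: `x` lies in two separators, with inner ends `b'` and `b`. As these are
    -- disjoint, only `X` and the outer ends remain.
    · have m1 : x ∈ P a ∪ P b' ∪ X := h.inter hab' ▸ ⟨hx', hba hx⟩
      have m2 : x ∈ P b ∪ P d ∪ X := h.inter hbd ▸ ⟨hx, hdb hx'⟩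
      apply h.ends_subset hda
      rcases m1 with (m1 | m1) | m1
      · exact Or.inl (Or.inr m1)
      · rcases m2 with (m2 | m2) | m2
        · exact absurd m1 (Set.disjoint_left.1 hd m2)
        · exact Or.inl (Or.inl m2)
        · exact Or.inr m2
      · exact Or.inr m1
    · exact hx
    · exact hx

end CutSystem

/-! ### Profiles and cut systems -/

namespace SepUniverse.IsProfile

variable {V : Type u} {U : SepUniverse V} {n : ℕ} {Q : Set (VSep V)}

theorem mem_or_inv_mem (hQ : U.IsProfile n Q) {s : VSep V} (hs : s ∈ U.sys n) :
    s ∈ Q ∨ s.inv ∈ Q := by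
  obtain ⟨t, ⟨rfl | rfl, h⟩, -⟩ := hQ.orient s hs
  · exact Or.inl h
  · exact Or.inr h

theorem eq_univ_of_mem_of_inv_mem (hQ : U.IsProfile n Q) {s : VSep V} (hs : s ∈ Q)
    (hs' : s.inv ∈ Q) : s.left = Set.univ ∧ s.right = Set.univ := by
  obtain ⟨t, -, ht⟩ := hQ.orient s (hQ.subset hs)
  have h : s = s.inv := (ht s ⟨Or.inl rfl, hs⟩).trans (ht _ ⟨Or.inr rfl, hs'⟩).symm
  have h1 : s.left = s.right := congrArg VSep.left h
  have h2 := U.cover s (hQ.subset hs).1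
  rw [← h1, Set.union_self] at h2
  exact ⟨h2, h1 ▸ h2⟩

theorem sup_mem (hQ : U.IsProfile n Q) {r s : VSep V} (hr : r ∈ Q) (hs : s ∈ Q)
    (ho : (r.sup s).order < n) : r.sup s ∈ Q :=
  (hQ.mem_or_inv_mem ⟨U.sup_mem r (hQ.subset hr).1 s (hQ.subset hs).1, ho⟩).resolve_right
    (hQ.profile r hr s hs)

/-- Consistency excludes `s.inv` unless the two separations coincide up to inversion. The hypothesis
on `t.left` removes the degenerate coincidence `t = s.inv`. -/
theorem mem_of_le (hQ : U.IsProfile n Q) {s t : VSep V} (hs : s ∈ U.sys n) (ht : t ∈ Q)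
    (hst : s.le t) (hne : t.left ≠ Set.univ) : s ∈ Q := by
  refine (hQ.mem_or_inv_mem hs).resolve_right fun hs' => ?_
  have h := hQ.consistent _ hs' t ht hst
  have h1 : t = s.inv ∨ t = s := by
    have : t ∈ ({s.inv, s.inv.inv} : Set (VSep V)) := h ▸ Set.mem_insert _ _
    simpa [VSep.inv] using this
  rcases h1 with rfl | rfl
  · apply hne
    have h2 : s.left ∪ s.right = Set.univ := U.cover s hs.1
    rw [← h2]
    exact (Set.union_eq_self_of_subset_left hst.1).symm
  · exact hne (hQ.eq_univ_of_mem_of_inv_mem ht hs').1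

/-- Two profiles that contain a common separation with left side `univ` do not differ. -/
theorem not_inv_mem_of_univ {Q' : Set (VSep V)} (hQ : U.IsProfile n Q) (hQ' : U.IsProfile n Q')
    {t s : VSep V} (htl : t.left = Set.univ) (htr : t.right ≠ Set.univ) (ht : t ∈ Q) (ht' : t ∈ Q')
    (hs : s ∈ Q) : s.inv ∉ Q' := by
  -- The supremum of `r` and `t` again has left side `univ`, and consistency with `t` forces it to
  -- be `t`; so `t` has the least right side in the profile.
  have key : ∀ {R : Set (VSep V)}, U.IsProfile n R → t ∈ R → ∀ {r}, r ∈ R →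
      t.right ⊆ r.right := by
    intro R hR htR r hr
    have ho : (r.sup t).order < n := by
      refine lt_of_le_of_lt (Set.encard_le_encard ?_) (hR.subset htR).2
      rintro x ⟨-, hx⟩
      exact ⟨htl ▸ Set.mem_univ x, hx.2⟩
    have hm := hR.sup_mem hr htR ho
    have h := hR.consistent _ hm t htR
      ⟨htl.symm ▸ Set.subset_univ _, fun x _ => Or.inr (htl.symm ▸ Set.mem_univ x)⟩
    have h1 : t = r.sup t ∨ t = (r.sup t).inv := by
      have : t ∈ ({r.sup t, (r.sup t).inv} : Set (VSep V)) := h ▸ Set.mem_insert _ _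
      simpa using this
    rcases h1 with h1 | h1
    · intro x hx
      rw [h1] at hx
      exact hx.1
    · exfalso
      apply htr
      have : t.right = r.left ∪ t.left := congrArg VSep.right h1
      rw [this, htl, Set.union_univ]
  intro hs'
  have h1 := key hQ' ht' hs'
  have h := hQ.consistent _ hs t ht ⟨htl ▸ Set.subset_univ _, h1⟩
  have h2 : s = t ∨ s = t.inv := by
    have : s ∈ ({t, t.inv} : Set (VSep V)) := h ▸ Set.mem_insert _ _
    simpa using this
  rcases h2 with rfl | rfl
  · exact htr (hQ'.eq_univ_of_mem_of_inv_mem ht' hs').2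
  · exact htr (hQ.eq_univ_of_mem_of_inv_mem ht hs).2

end SepUniverse.IsProfile

/-- Three profiles agree on one of any two alternatives. -/
theorem exists_ne_iff (p : Fin 3 → Prop) : ∃ i j, i ≠ j ∧ (p i ↔ p j) := by
  by_cases h0 : p 0 ↔ p 1
  · exact ⟨0, 1, by decide, h0⟩
  by_cases h1 : p 0 ↔ p 2
  · exact ⟨0, 2, by decide, h1⟩
  · exact ⟨1, 2, by decide, by tauto⟩

namespace CutSystem

variable {V G : Type u} [CircularOrder G] {W : G → G → Set V} {P : G → Set V} {X : Set V}

theorem encard_le (h : CutSystem W P X) {a b : G} (hab : a ≠ b) :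
    (⟨W a b, W b a⟩ : VSep V).order ≤ (P a).encard + (P b).encard + X.encard := by
  show (W a b ∩ W b a).encard ≤ _
  rw [h.inter hab]
  exact (Set.encard_union_le _ _).trans (add_le_add_left (Set.encard_union_le _ _) _)

/-- A cut point of a cut system that distinguishes three profiles with the same separations of order
less than `k` is not smaller than the others. -/
theorem le_encard_of_profiles (h : CutSystem W P X) {U : SepUniverse V} {k m : ℕ}
    (hsep : ∀ a b, a ≠ b → (⟨W a b, W b a⟩ : VSep V) ∈ U.seps) (c : G)
    (hX : X.encard + 2 * m = k) (hP : ∀ a, a ≠ c → (P a).encard = m)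
    (Q : Fin 3 → Set (VSep V)) (hQ : ∀ i, U.IsProfile (k + 1) (Q i))
    (hlow : ∀ i j, Q i ∩ U.sys k = Q j ∩ U.sys k)
    (hdist : ∀ i j, i ≠ j → ∃ a b, a ≠ c ∧ b ≠ c ∧ a ≠ b ∧
      (⟨W a b, W b a⟩ : VSep V) ∈ Q i ∧ (⟨W b a, W a b⟩ : VSep V) ∈ Q j)
    {a₁ a₂ a₃ a₄ : G} (h12 : sbtw c a₁ a₂) (h23 : sbtw c a₂ a₃) (h34 : sbtw c a₃ a₄)
    (d12 : Disjoint (P a₁) (P a₂)) (d23 : Disjoint (P a₂) (P a₃)) (d34 : Disjoint (P a₃) (P a₄))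
    (d13 : Disjoint (P a₁) (P a₃)) (d24 : Disjoint (P a₂) (P a₄)) (d14 : Disjoint (P a₁) (P a₄))
    (n23 : W a₂ a₃ ≠ Set.univ) (n32 : W a₃ a₂ ≠ Set.univ) (n42 : W a₄ a₂ ≠ Set.univ)
    (n31 : W a₃ a₁ ≠ Set.univ) : (m : ℕ∞) ≤ (P c).encard := by
  -- With fewer than `m` vertices in `c`, each arc ending at `c` has order less than `k`, where the
  -- profiles agree. The aim is to find two profiles that agree on all the other arcs as well.
  -- Below, an arc is called small for a profile if it is the left side of a member.
  by_contra! hc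
  -- sizes
  have hXf : X.encard ≠ ⊤ := by
    intro h'
    rw [h', top_add] at hX
    exact ENat.natCast_ne_top k hX.symm
  obtain ⟨x, hx⟩ := ENat.ne_top_iff_exists.1 hXf
  obtain ⟨p, hp⟩ := ENat.ne_top_iff_exists.1 (hc.trans (ENat.natCast_lt_top m)).ne
  rw [← hx] at hX
  rw [← hp] at hc
  have hX' : x + 2 * m = k := by exact_mod_cast hX
  have hpm : p < m := by exact_mod_cast hc
  have hle : ∀ a, (P a).encard ≤ m := by
    intro a
    rcases eq_or_ne a c with rfl | ha
    · rw [← hp]; exact hc.le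
    · exact (hP a ha).le
  have hord : ∀ {a b}, a ≠ b → (⟨W a b, W b a⟩ : VSep V).order < (k + 1 : ℕ) := by
    intro a b hab
    refine (h.encard_le hab).trans_lt ?_
    calc (P a).encard + (P b).encard + X.encard ≤ m + m + x := by
          rw [← hx]; gcongr <;> exact hle _
      _ < (k + 1 : ℕ) := by
          rw [← hX']; norm_cast; omega
  have hordc : ∀ {a}, a ≠ c → (⟨W a c, W c a⟩ : VSep V).order < k := by
    intro a hab
    refine (h.encard_le hab).trans_lt ?_
    rw [hP a hab, ← hp, ← hx, ← hX']
    norm_cast; omega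
  have ne12 := ne_right_of_sbtw h12
  have ne23 := ne_right_of_sbtw h23
  have ne34 := ne_right_of_sbtw h34
  have nec1 := ne_left_of_sbtw h12
  have nec2 := ne_left_of_sbtw h23
  have nec3 := ne_left_of_sbtw h34
  have nec4 := ne_ends_of_sbtw h34
  -- Three disjoint sets of size `m` together with `X` have `3m + |X| > k` vertices, because `m >
  -- 0`.
  have hbig : ∀ Z : Set V, Z.encard < (k + 1 : ℕ) → Z ≠ Set.univ := by
    rintro Z hZ rfl
    have h1 : (P a₁ ∪ P a₂ ∪ P a₃ ∪ X).encard ≤ (Set.univ : Set V).encard :=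
      Set.encard_le_encard (Set.subset_univ _)
    rw [Set.encard_union_eq, Set.encard_union_eq, Set.encard_union_eq d12, hP _ nec1.symm,
      hP _ nec2.symm, hP _ nec3.symm, ← hx] at h1
    · have h2 := h1.trans_lt hZ
      norm_cast at h2
      omega
    · exact Set.disjoint_union_left.2 ⟨d13, d23⟩
    · exact Set.disjoint_union_left.2 ⟨Set.disjoint_union_left.2 ⟨h.disj _, h.disj _⟩, h.disj _⟩
  -- orientations
  have hsys : ∀ {a b}, a ≠ b → (⟨W a b, W b a⟩ : VSep V) ∈ U.sys (k + 1) :=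
    fun hab => ⟨hsep _ _ hab, hord hab⟩
  have hor : ∀ i {a b}, a ≠ b → (⟨W a b, W b a⟩ : VSep V) ∈ Q i ∨
      (⟨W b a, W a b⟩ : VSep V) ∈ Q i :=
    fun i a b hab => (hQ i).mem_or_inv_mem (hsys hab)
  have hnot : ∀ i {a b}, a ≠ b → (⟨W a b, W b a⟩ : VSep V) ∈ Q i →
      (⟨W b a, W a b⟩ : VSep V) ∉ Q i := by
    intro i a b hab h1 h2
    obtain ⟨e1, e2⟩ := (hQ i).eq_univ_of_mem_of_inv_mem h1 h2
    refine hbig (W a b ∩ W b a) (hord hab) ?_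
    simp only at e1 e2
    rw [e1, e2, Set.univ_inter]
  have hmono : ∀ i {a b a' b'}, a ≠ b → W a b ⊆ W a' b' → W b' a' ⊆ W b a →
      W a' b' ≠ Set.univ → (⟨W a' b', W b' a'⟩ : VSep V) ∈ Q i →
      (⟨W a b, W b a⟩ : VSep V) ∈ Q i :=
    fun i a b a' b' hab h1 h2 h3 h4 => (hQ i).mem_of_le (hsys hab) h4 ⟨h1, h2⟩ h3
  have hjoin : ∀ i {a b b' d}, sbtw a b' d → sbtw a b d → (b' = b ∨ sbtw a b' b) →
      Disjoint (P b) (P b') → (⟨W a b, W b a⟩ : VSep V) ∈ Q i →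
      (⟨W b' d, W d b'⟩ : VSep V) ∈ Q i → (⟨W a d, W d a⟩ : VSep V) ∈ Q i := by
    intro i a b b' d s1 s2 s3 hd m1 m2
    have e := h.join s1 s2 s3 hd
    have e' : (⟨W a b, W b a⟩ : VSep V).sup ⟨W b' d, W d b'⟩ = ⟨W a d, W d a⟩ :=
      VSep.ext e.1 e.2
    have := (hQ i).sup_mem m1 m2 (by rw [e']; exact hord (ne_ends_of_sbtw s1))
    rwa [e'] at this
  have hall : ∀ {s : VSep V} i, s.order < k → s ∈ Q i → ∀ j, s ∈ Q j := by
    intro s i hs hi j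
    have : s ∈ Q i ∩ U.sys k := ⟨hi, ((hQ i).subset hi).1, hs⟩
    rw [hlow i j] at this
    exact this.1
  have hordc' : ∀ {a}, a ≠ c → (⟨W c a, W a c⟩ : VSep V).order < k := by
    intro a ha
    have := hordc ha
    unfold VSep.order at this ⊢
    rwa [Set.inter_comm]
  -- Either `[a, c]` is small for all profiles or `[c, a]` is. In the line from `c`, the cut points
  -- of the second kind come first.
  have hAB : ∀ {a}, a ≠ c → (∀ i, (⟨W a c, W c a⟩ : VSep V) ∈ Q i) ∨
      (∀ i, (⟨W c a, W a c⟩ : VSep V) ∈ Q i) := by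
    intro a ha
    rcases hor 0 ha with h0 | h0
    · exact Or.inl (hall 0 (hordc ha) h0)
    · exact Or.inr (hall 0 (hordc' ha) h0)
  -- A common member with left side `univ` would prevent the profiles from differing anywhere.
  have hreg : ∀ {t : VSep V}, t.order < k → (∀ i, t ∈ Q i) → t.left ≠ Set.univ := by
    intro t ht hm hl
    obtain ⟨a, b, -, -, hab, m1, m2⟩ := hdist 0 1 (by decide)
    refine (hQ 0).not_inv_mem_of_univ (hQ 1) hl ?_ (hm 0) (hm 1) m1 m2
    intro hr
    refine hbig (t.left ∩ t.right) (ht.trans (by norm_cast; omega)) ?_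
    rw [hl, hr, Set.univ_inter]
  -- the linear order from `c`
  let := baseOrder c
  have hclt : ∀ {a}, a ≠ c → c < a := fun ha => baseOrder_bot_lt ha
  have s3 : ∀ {x y z : G}, x < y → y < z → sbtw x y z := fun h1 h2 => sbtw_of_baseOrder h1 h2
  have l12 : a₁ < a₂ := (baseOrder_lt_iff_sbtw nec1.symm).2 h12
  have l23 : a₂ < a₃ := (baseOrder_lt_iff_sbtw nec2.symm).2 h23
  have l34 : a₃ < a₄ := (baseOrder_lt_iff_sbtw nec3.symm).2 h34
  have l1 : c < a₁ := hclt nec1.symm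
  have hMA : ∀ {a b}, c < a → a < b → (∀ i, (⟨W a c, W c a⟩ : VSep V) ∈ Q i) →
      ∀ i, (⟨W b c, W c b⟩ : VSep V) ∈ Q i := fun h1 h2 hm i =>
    hmono i (h1.trans h2).ne' (h.subset_of_sbtw_right (s3 h1 h2).cyclic_left)
      (h.subset_of_sbtw_left (s3 h1 h2)) (hreg (hordc h1.ne') hm) (hm i)
  have hMB : ∀ {a b}, c < a → a < b → (∀ i, (⟨W c b, W b c⟩ : VSep V) ∈ Q i) →
      ∀ i, (⟨W c a, W a c⟩ : VSep V) ∈ Q i := fun h1 h2 hm i =>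
    hmono i h1.ne (h.subset_of_sbtw_left (s3 h1 h2))
      (h.subset_of_sbtw_right (s3 h1 h2).cyclic_left) (hreg (hordc' (h1.trans h2).ne') hm) (hm i)
  -- a distinguishing pair lies between the two sides
  suffices hsame : ∃ i j, i ≠ j ∧ ∀ a b, c < a → a < b →
      (∀ i, (⟨W c a, W a c⟩ : VSep V) ∈ Q i) → (∀ i, (⟨W b c, W c b⟩ : VSep V) ∈ Q i) →
      ((⟨W a b, W b a⟩ : VSep V) ∈ Q i ↔ (⟨W a b, W b a⟩ : VSep V) ∈ Q j) by
    obtain ⟨i, j, hij, hsame⟩ := hsame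
    have hagree : ∀ a b, c < a → a < b →
        ((⟨W a b, W b a⟩ : VSep V) ∈ Q i ↔ (⟨W a b, W b a⟩ : VSep V) ∈ Q j) := by
      intro a b ha hab
      have hb := ha.trans hab
      rcases hAB ha.ne' with hA | hB
      · have : ∀ i, (⟨W a b, W b a⟩ : VSep V) ∈ Q i := fun i =>
          hmono i hab.ne (h.subset_of_sbtw_left (s3 ha hab).cyclic_left)
            (h.subset_of_sbtw_right (s3 ha hab).cyclic_right) (hreg (hordc ha.ne') hA) (hA i)
        simp [this]
      rcases hAB hb.ne' with hA' | hB'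
      · exact hsame a b ha hab hB hA'
      · have : ∀ i, (⟨W a b, W b a⟩ : VSep V) ∈ Q i := fun i =>
          hmono i hab.ne (h.subset_of_sbtw_right (s3 ha hab))
            (h.subset_of_sbtw_left (s3 ha hab).cyclic_right)
            (hreg (hordc' hb.ne') hB') (hB' i)
        simp [this]
    obtain ⟨a, b, hac, hbc, hab, m1, m2⟩ := hdist i j hij
    rcases lt_or_gt_of_ne hab with hlt | hlt
    · exact hnot j hab ((hagree a b (hclt hac) hlt).1 m1) m2
    · exact hnot i hab m1 ((hagree b a (hclt hbc) hlt).2 m2)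
  have l2 := l1.trans l12
  have l3 := l2.trans l23
  have l4 := l3.trans l34
  -- the vertex set of `c` is disjoint from those of `a₂` and `a₃`
  have dc2 : Disjoint (P a₂) (P c) :=
    h.disjoint_of_sbtw (s3 l2 l23).cyclic_left (s3 l1 l12) d23 d12.symm
  have dc3 : Disjoint (P a₃) (P c) :=
    h.disjoint_of_sbtw (s3 l3 l34).cyclic_left (s3 l2 l23) d34 d23.symm
  have db2 : ∀ {b}, a₃ ≤ b → Disjoint (P b) (P a₂) := by
    intro b hb
    rcases hb.eq_or_lt with rfl | hb
    · exact d23.symm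
    · exact (h.disjoint_of_sbtw (s3 l23 hb) (s3 l12 (l23.trans hb)).cyclic_right d23
        d12.symm).symm
  have da3 : ∀ {a}, a ≤ a₂ → Disjoint (P a₃) (P a) := by
    intro a ha
    rcases ha.eq_or_lt with rfl | ha
    · exact d23.symm
    · exact h.disjoint_of_sbtw (s3 (ha.trans l23) l34).cyclic_left (s3 ha l23) d34 d23.symm
  -- transfer along arcs through `c`
  have hR2 : ∀ i {a b}, c < a → a < b → b < a₃ → (∀ i, (⟨W b c, W c b⟩ : VSep V) ∈ Q i) →
      (⟨W a₃ a, W a a₃⟩ : VSep V) ∈ Q i → (⟨W b a, W a b⟩ : VSep V) ∈ Q i :=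
    fun i a b ha hab hb hA hm => hjoin i (s3 hab hb).cyclic_left (s3 ha hab).cyclic_right
      (Or.inr (s3 (ha.trans hab) hb).cyclic_left) dc3.symm (hA i) hm
  have hR2' : ∀ i {a b}, a₂ < a → a < b → (∀ i, (⟨W c a, W a c⟩ : VSep V) ∈ Q i) →
      (⟨W b a₂, W a₂ b⟩ : VSep V) ∈ Q i → (⟨W b a, W a b⟩ : VSep V) ∈ Q i :=
    fun i a b ha hab hB hm => hjoin i (s3 (l2.trans ha) hab).cyclic_right
      (s3 ha hab).cyclic_right (Or.inr (s3 l2 (ha.trans hab)).cyclic_right) dc2 hm (hB i)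
  -- If `[a₂, c]` is small, then `a` comes before `a₂`, and the arc `[b, a]` through `c` turns out
  -- to be small for every profile.
  rcases hAB l2.ne' with hA2 | hB2
  · refine ⟨0, 1, by decide, ?_⟩
    have hA3 := hMA l2 l23 hA2
    have main : ∀ i a b, c < a → a < b → (∀ i, (⟨W c a, W a c⟩ : VSep V) ∈ Q i) →
        (∀ i, (⟨W b c, W c b⟩ : VSep V) ∈ Q i) → (⟨W b a, W a b⟩ : VSep V) ∈ Q i := by
      intro i a b ha hab hB hA
      have ha2 : a < a₂ := by
        by_contra! h'
        rcases h'.eq_or_lt with rfl | h'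
        · exact hnot i ha.ne' (hA2 i) (hB i)
        · exact hnot i ha.ne' (hMA l2 h' hA2 i) (hB i)
      -- Otherwise `[a, b]` would be small; its join with `[a₂, c]` is `[a, c]`, which is not small.
      have far : ∀ {b}, a₃ ≤ b → (⟨W b a, W a b⟩ : VSep V) ∈ Q i := by
        intro b hb
        have hab := ha2.trans (l23.trans_le hb)
        refine (hor i hab.ne).resolve_left fun h' => ?_
        exact hnot i ha.ne' (hjoin i (s3 ha ha2).cyclic_left (s3 ha hab).cyclic_left
          (Or.inr (s3 ha2 (l23.trans_le hb))) (db2 hb) h' (hA2 i)) (hB i)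
      rcases le_or_gt a₃ b with hb | hb
      · exact far hb
      · exact hR2 i ha hab hb hA (far le_rfl)
    intro a b ha hab hB hA
    exact iff_of_false (hnot 0 hab.ne' (main 0 a b ha hab hB hA))
      (hnot 1 hab.ne' (main 1 a b ha hab hB hA))
  rcases hAB l3.ne' with hA3 | hB3
  swap
  · refine ⟨0, 1, by decide, ?_⟩
    have main : ∀ i a b, c < a → a < b → (∀ i, (⟨W c a, W a c⟩ : VSep V) ∈ Q i) →
        (∀ i, (⟨W b c, W c b⟩ : VSep V) ∈ Q i) → (⟨W b a, W a b⟩ : VSep V) ∈ Q i := by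
      intro i a b ha hab hB hA
      have hb3 : a₃ < b := by
        by_contra! h'
        rcases h'.eq_or_lt with rfl | h'
        · exact hnot i l3.ne' (hA i) (hB3 i)
        · exact hnot i (ha.trans hab).ne' (hA i) (hMB (ha.trans hab) h' hB3 i)
      have far : ∀ {a}, c < a → a ≤ a₂ → (⟨W b a, W a b⟩ : VSep V) ∈ Q i := by
        intro a hca ha
        have hab := ha.trans_lt (l23.trans hb3)
        refine (hor i hab.ne).resolve_left fun h' => ?_
        exact hnot i (l3.trans hb3).ne' (hA i) (hjoin i (s3 hca hab) (s3 l3 hb3)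
          (Or.inr (s3 hca (ha.trans_lt l23))) (da3 ha) (hB3 i) h')
      rcases le_or_gt a a₂ with ha' | ha'
      · exact far ha ha'
      · exact hR2' i ha' hab hB (far l2 le_rfl)
    intro a b ha hab hB hA
    exact iff_of_false (hnot 0 hab.ne' (main 0 a b ha hab hB hA))
      (hnot 1 hab.ne' (main 1 a b ha hab hB hA))
  -- Now `[c, a₂]` and `[a₃, c]` are small. The orientation of the single arc `[a₂, a₃]` decides all
  -- others; here a third profile is needed, so that two of them agree on it.
  obtain ⟨i, j, hij, hiff⟩ := exists_ne_iff fun i => (⟨W a₂ a₃, W a₃ a₂⟩ : VSep V) ∈ Q i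
  refine ⟨i, j, hij, ?_⟩
  have outL : ∀ {a a' b}, a ≤ a' → a' < b → W b a ⊆ W b a' ∧ W a' b ⊆ W a b := by
    intro a a' b h1 h2
    rcases h1.eq_or_lt with rfl | h1
    · exact ⟨subset_rfl, subset_rfl⟩
    · exact ⟨h.subset_of_sbtw_left (s3 h1 h2).cyclic_right, h.subset_of_sbtw_right (s3 h1 h2)⟩
  have outR : ∀ {a b' b}, a < b' → b' ≤ b → W b a ⊆ W b' a ∧ W a b' ⊆ W a b := by
    intro a b' b h1 h2
    rcases h2.eq_or_lt with rfl | h2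
    · exact ⟨subset_rfl, subset_rfl⟩
    · exact ⟨h.subset_of_sbtw_right (s3 h1 h2).cyclic_left, h.subset_of_sbtw_left (s3 h1 h2)⟩
  -- If `[a₃, a₂]` is small, so is each `[b, a]`: monotonicity handles ends outside `]a₂, a₃[`, and
  -- joins with small arcs at `c` handle the others.
  have cross : ∀ i, (⟨W a₃ a₂, W a₂ a₃⟩ : VSep V) ∈ Q i → ∀ a b, c < a → a < b →
      (∀ i, (⟨W c a, W a c⟩ : VSep V) ∈ Q i) → (∀ i, (⟨W b c, W c b⟩ : VSep V) ∈ Q i) →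
      (⟨W b a, W a b⟩ : VSep V) ∈ Q i := by
    intro i hm a b ha hab hB hA
    have far : ∀ {a b}, a ≤ a₂ → a₃ ≤ b → (⟨W b a, W a b⟩ : VSep V) ∈ Q i := by
      intro a b ha hb
      have hab := ha.trans_lt (l23.trans_le hb)
      exact hmono i hab.ne' ((outL ha (l23.trans_le hb)).1.trans (outR l23 hb).1)
        ((outR l23 hb).2.trans (outL ha (l23.trans_le hb)).2) n32 hm
    have near : ∀ {a b}, c < a → a ≤ a₂ → a < b →
        (∀ i, (⟨W b c, W c b⟩ : VSep V) ∈ Q i) → (⟨W b a, W a b⟩ : VSep V) ∈ Q i := by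
      intro a b ha ha' hab hA
      rcases le_or_gt a₃ b with hb | hb
      · exact far ha' hb
      · exact hR2 i ha hab hb hA (far ha' le_rfl)
    rcases le_or_gt a a₂ with ha' | ha'
    · exact near ha ha' hab hA
    · exact hR2' i ha' hab hB (near l2 le_rfl (ha'.trans hab) hA)
  -- If `[a₂, a₃]` is small, then among the arcs in question exactly those inside it are small.
  have nest : ∀ i, (⟨W a₂ a₃, W a₃ a₂⟩ : VSep V) ∈ Q i → ∀ a b, c < a → a < b →
      (∀ i, (⟨W c a, W a c⟩ : VSep V) ∈ Q i) → (∀ i, (⟨W b c, W c b⟩ : VSep V) ∈ Q i) →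
      ((⟨W a b, W b a⟩ : VSep V) ∈ Q i ↔ a₂ ≤ a ∧ b ≤ a₃) := by
    intro i hm a b ha hab hB hA
    -- Otherwise the join of `[a₂, a₄]` and `[a₃, c]` would make `[a₂, c]` small. The outer points
    -- `a₁` and `a₄` provide the overlaps with disjoint ends.
    have f1 : (⟨W a₄ a₂, W a₂ a₄⟩ : VSep V) ∈ Q i :=
      (hor i (l23.trans l34).ne').resolve_right fun h' =>
        hnot i l2.ne' (hjoin i (s3 l2 l23).cyclic_left (s3 l2 (l23.trans l34)).cyclic_left
          (Or.inr (s3 l23 l34)) d34.symm h' (hA3 i)) (hB2 i)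
    have f3 : ∀ {b}, a₃ < b → (∀ i, (⟨W b c, W c b⟩ : VSep V) ∈ Q i) →
        (⟨W b a₂, W a₂ b⟩ : VSep V) ∈ Q i := by
      intro b hb hA
      have f2 : (⟨W b a₁, W a₁ b⟩ : VSep V) ∈ Q i :=
        (hor i (l12.trans (l23.trans hb)).ne').resolve_right fun h' =>
          hnot i (l3.trans hb).ne' (hA i) (hjoin i (s3 l1 (l12.trans (l23.trans hb)))
            (s3 l2 (l23.trans hb)) (Or.inr (s3 l1 l12)) d12.symm (hB2 i) h')
      rcases le_or_gt a₄ b with hb4 | hb4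
      · have := outR (l23.trans l34) hb4
        exact hmono i (l23.trans hb).ne' this.1 this.2 n42 f1
      · exact hjoin i (s3 (l23.trans hb) hb4).cyclic_left (s3 l12 (l23.trans hb)).cyclic_right
          (Or.inr (s3 (l12.trans (l23.trans hb)) hb4).cyclic_left) d14 f2 f1
    have g1 : (⟨W a₃ a₁, W a₁ a₃⟩ : VSep V) ∈ Q i :=
      (hor i (l12.trans l23).ne').resolve_right fun h' =>
        hnot i l3.ne' (hA3 i) (hjoin i (s3 l1 (l12.trans l23)) (s3 l2 l23)
          (Or.inr (s3 l1 l12)) d12.symm (hB2 i) h')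
    have g : ∀ {a}, c < a → a < a₂ → (∀ i, (⟨W c a, W a c⟩ : VSep V) ∈ Q i) →
        (⟨W a₃ a, W a a₃⟩ : VSep V) ∈ Q i := by
      intro a ha ha2 hB
      have g2 : (⟨W a₄ a, W a a₄⟩ : VSep V) ∈ Q i :=
        (hor i (ha2.trans (l23.trans l34)).ne').resolve_right fun h' =>
          hnot i ha.ne' (hjoin i (s3 ha (ha2.trans l23)).cyclic_left
            (s3 ha (ha2.trans (l23.trans l34))).cyclic_left (Or.inr (s3 (ha2.trans l23) l34))
            d34.symm h' (hA3 i)) (hB i)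
      rcases le_or_gt a a₁ with ha1 | ha1
      · have := outL ha1 (l12.trans l23)
        exact hmono i (ha2.trans l23).ne' this.1 this.2 n31 g1
      · exact hjoin i (s3 (ha2.trans l23) l34).cyclic_left (s3 ha1 (ha2.trans l23)).cyclic_right
          (Or.inr (s3 (l12.trans l23) l34).cyclic_left) d14 g1 g2
    constructor
    · intro hm'
      by_contra hcon
      refine hnot i hab.ne hm' ?_
      rcases lt_or_ge a a₂ with ha2 | ha2
      · rcases lt_or_ge a₃ b with hb | hb
        · have := outL ha2.le (l23.trans hb)
          refine hmono i hab.ne' this.1 this.2 (fun hu => n32 ?_) (f3 hb hA)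
          exact Set.univ_subset_iff.1 (hu ▸ (outR l23 hb.le).1)
        · rcases hb.eq_or_lt with rfl | hb
          · exact g ha ha2 hB
          · exact hR2 i ha hab hb hA (g ha ha2 hB)
      · have hb : a₃ < b := not_le.1 fun hb => hcon ⟨ha2, hb⟩
        rcases ha2.eq_or_lt with rfl | ha2
        · exact f3 hb hA
        · exact hR2' i ha2 hab hB (f3 hb hA)
    · rintro ⟨ha2, hb3⟩
      exact hmono i hab.ne ((outL ha2 hab).2.trans (outR (ha2.trans_lt hab) hb3).2)
        ((outR (ha2.trans_lt hab) hb3).1.trans (outL ha2 hab).1) n23 hm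
  intro a b ha hab hB hA
  by_cases hi : (⟨W a₂ a₃, W a₃ a₂⟩ : VSep V) ∈ Q i
  · rw [nest i hi a b ha hab hB hA, nest j (hiff.1 hi) a b ha hab hB hA]
  · have hi' := (hor i l23.ne).resolve_left hi
    have hj' := (hor j l23.ne).resolve_left (fun h' => hi (hiff.2 h'))
    exact iff_of_false (hnot i hab.ne' (cross i hi' a b ha hab hB hA))
      (hnot j hab.ne' (cross j hj' a b ha hab hB hA))

end CutSystem

/-! ### Chains of separations -/

namespace VSep

variable {V : Type u}

instance : PartialOrder (VSep V) where
  le := VSep.le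
  le_refl _ := ⟨subset_rfl, subset_rfl⟩
  le_trans _ _ _ h h' := ⟨h.1.trans h'.1, h'.2.trans h.2⟩
  le_antisymm _ _ h h' := VSep.ext (h.1.antisymm h'.1) (h'.2.antisymm h.2)

@[simp] theorem inv_inv (s : VSep V) : s.inv.inv = s := rfl

theorem mem_left_of_le {s t : VSep V} (h : s ≤ t) {x : V} (hx : x ∈ s.left) : x ∈ t.left := h.1 hx

theorem mem_right_of_le {s t : VSep V} (h : s ≤ t) {x : V} (hx : x ∈ t.right) : x ∈ s.right :=
  h.2 hx

theorem inv_le_inv {s t : VSep V} (h : s ≤ t) : t.inv ≤ s.inv := ⟨h.2, h.1⟩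

theorem inv_lt_inv {s t : VSep V} (h : s < t) : t.inv < s.inv :=
  lt_of_le_of_ne (inv_le_inv h.le) fun e => h.ne (congrArg inv e).symm

/-- The set `V(v, w)` of an arc that avoids the base point, for cut points `v < w` that are given by
separations. The vertices of the base point that lie in `v` or `w` belong to both `v` and `w` only on
one side of the base point. -/
def arcIn (P₀ : Set V) (s t : VSep V) : Set V := (t.left ∩ s.right) ∪ (P₀ ∩ (t.left ∪ s.right))

/-- The set `V(w, v)` of an arc through the base point, for cut points `v < w`. -/
def arcOut (P₀ : Set V) (s t : VSep V) : Set V := s.left ∪ t.right ∪ P₀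

/-- The vertices of a cut point. -/
def pt (X P₀ : Set V) (s : VSep V) : Set V := arcIn P₀ s s \ X

/-- The separation of the base point at the lower end. -/
def botSep (X : Set V) : VSep V := ⟨X, Set.univ⟩

/-- The separation of the base point at the upper end. -/
def topSep (X : Set V) : VSep V := ⟨Set.univ, X⟩

/-- The set `V(v, w)` of an arc. -/
noncomputable def arc (P₀ : Set V) (s t : VSep V) : Set V :=
  open Classical in if s ≤ t then arcIn P₀ s t else arcOut P₀ t s

theorem arc_of_le (P₀ : Set V) {s t : VSep V} (h : s ≤ t) : arc P₀ s t = arcIn P₀ s t := if_pos h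

theorem arc_of_lt (P₀ : Set V) {s t : VSep V} (h : s < t) : arc P₀ t s = arcOut P₀ s t :=
  if_neg h.not_ge

theorem arcIn_inv (P₀ : Set V) (s t : VSep V) : arcIn P₀ t.inv s.inv = arcIn P₀ s t := by
  simp only [arcIn, inv, Set.inter_comm, Set.union_comm]

theorem arcOut_inv (P₀ : Set V) (s t : VSep V) : arcOut P₀ t.inv s.inv = arcOut P₀ s t := by
  simp only [arcOut, inv, Set.union_comm]

theorem pt_inv (X P₀ : Set V) (s : VSep V) : pt X P₀ s.inv = pt X P₀ s := by
  simp only [pt, arcIn_inv]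

theorem arcIn_mono (P₀ : Set V) {s s' t t' : VSep V} (h : s' ≤ s) (h' : t ≤ t') :
    arcIn P₀ s t ⊆ arcIn P₀ s' t' := by
  rintro x (⟨h1, h2⟩ | ⟨h1, h2 | h2⟩)
  · exact Or.inl ⟨h'.1 h1, h.2 h2⟩
  · exact Or.inr ⟨h1, Or.inl (h'.1 h2)⟩
  · exact Or.inr ⟨h1, Or.inr (h.2 h2)⟩

/-- The separation of an arc that avoids the base point. -/
def arcSep (P₀ : Set V) (s t : VSep V) : VSep V := ⟨arcIn P₀ s t, arcOut P₀ s t⟩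

theorem arcSep_inv (P₀ : Set V) (s t : VSep V) : arcSep P₀ t.inv s.inv = arcSep P₀ s t := by
  simp only [arcSep, arcIn_inv, arcOut_inv]

end VSep

/-! ### Chains of pairs and their arcs -/

open VSep

/-- A chain of separations between `(X, univ)` and `(univ, X)` that encodes the cut points of a
pseudoflower as seen from a base point with vertex set `P₀`. -/
structure IsCutChain {V : Type u} (X P₀ : Set V) (D : Set (VSep V)) : Prop where
  disj : Disjoint P₀ X
  chain : ∀ s ∈ D, ∀ t ∈ D, s ≤ t ∨ t ≤ s
  bot_mem : botSep X ∈ D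
  top_mem : topSep X ∈ D
  left : ∀ s ∈ D, X ⊆ s.left
  right : ∀ s ∈ D, X ⊆ s.right
  cover : ∀ s ∈ D, s.left ∪ s.right ∪ P₀ = Set.univ

/-- The linear order of a chain. -/
noncomputable abbrev chainOrder {V : Type u} {D : Set (VSep V)}
    (h : ∀ s ∈ D, ∀ t ∈ D, s ≤ t ∨ t ≤ s) : LinearOrder D :=
  { (inferInstance : PartialOrder D) with
    le_total := fun s t => h s s.2 t t.2
    toDecidableLE := Classical.decRel _ }

namespace IsCutChain

variable {V : Type u} {X P₀ : Set V} {D : Set (VSep V)}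

theorem bot_le (h : IsCutChain X P₀ D) {s : VSep V} (hs : s ∈ D) : botSep X ≤ s :=
  ⟨h.left s hs, Set.subset_univ _⟩

theorem le_top (h : IsCutChain X P₀ D) {s : VSep V} (hs : s ∈ D) : s ≤ topSep X :=
  ⟨Set.subset_univ _, h.right s hs⟩

theorem lt_or_le (h : IsCutChain X P₀ D) {s t : VSep V} (hs : s ∈ D) (ht : t ∈ D) :
    s < t ∨ t ≤ s := by
  rcases h.chain s hs t ht with h' | h'
  · rcases h'.eq_or_lt with rfl | h'
    · exact Or.inr le_rfl
    · exact Or.inl h'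
  · exact Or.inr h'

theorem inter (h : IsCutChain X P₀ D) {s t : VSep V} (hs : s ∈ D) (ht : t ∈ D) (hst : s ≤ t) :
    arcIn P₀ s t ∩ arcOut P₀ s t = pt X P₀ s ∪ pt X P₀ t ∪ X := by
  ext x
  have h1 := mem_left_of_le (x := x) hst
  have h2 := mem_right_of_le (x := x) hst
  have h3 : x ∈ X → _ := fun hx => h.left s hs hx
  have h4 : x ∈ X → _ := fun hx => h.right s hs hx
  have h5 : x ∈ X → _ := fun hx => h.left t ht hx
  have h6 : x ∈ X → _ := fun hx => h.right t ht hx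
  simp only [pt, arcIn, arcOut, Set.mem_inter_iff, Set.mem_union, Set.mem_sdiff]
  grind

theorem union (h : IsCutChain X P₀ D) {s t : VSep V} (hs : s ∈ D) (ht : t ∈ D) (hst : s ≤ t) :
    arcIn P₀ s t ∪ arcOut P₀ s t = Set.univ := by
  refine Set.eq_univ_of_forall fun x => ?_
  have h1 := mem_left_of_le (x := x) hst
  have h2 := mem_right_of_le (x := x) hst
  have h3 : x ∈ s.left ∪ s.right ∪ P₀ := h.cover s hs ▸ Set.mem_univ x
  have h4 : x ∈ t.left ∪ t.right ∪ P₀ := h.cover t ht ▸ Set.mem_univ x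
  simp only [arcIn, arcOut, Set.mem_inter_iff, Set.mem_union] at *
  grind

theorem arcIn_union (h : IsCutChain X P₀ D) {s t r : VSep V} (ht : t ∈ D) (hst : s ≤ t)
    (htr : t ≤ r) : arcIn P₀ s r = arcIn P₀ s t ∪ arcIn P₀ t r := by
  ext x
  have h1 := mem_left_of_le (x := x) hst
  have h2 := mem_right_of_le (x := x) hst
  have h3 := mem_left_of_le (x := x) htr
  have h5 := mem_right_of_le (x := x) htr
  have h4 : x ∈ t.left ∪ t.right ∪ P₀ := h.cover t ht ▸ Set.mem_univ x
  simp only [arcIn, Set.mem_inter_iff, Set.mem_union] at *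
  grind

theorem arcOut_union_left (h : IsCutChain X P₀ D) {s t r : VSep V} (hs : s ∈ D) (hst : s ≤ t)
    (htr : t ≤ r) : arcOut P₀ t r = arcOut P₀ s r ∪ arcIn P₀ s t := by
  ext x
  have h1 := mem_left_of_le (x := x) hst
  have h2 := mem_right_of_le (x := x) hst
  have h3 := mem_left_of_le (x := x) htr
  have h5 := mem_right_of_le (x := x) htr
  have h4 : x ∈ s.left ∪ s.right ∪ P₀ := h.cover s hs ▸ Set.mem_univ x
  simp only [arcIn, arcOut, Set.mem_inter_iff, Set.mem_union] at *
  grind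

theorem arcOut_union_right (h : IsCutChain X P₀ D) {s t r : VSep V} (hr : r ∈ D) (hst : s ≤ t)
    (htr : t ≤ r) : arcOut P₀ s t = arcIn P₀ t r ∪ arcOut P₀ s r := by
  ext x
  have h1 := mem_left_of_le (x := x) hst
  have h2 := mem_right_of_le (x := x) hst
  have h3 := mem_left_of_le (x := x) htr
  have h5 := mem_right_of_le (x := x) htr
  have h4 : x ∈ r.left ∪ r.right ∪ P₀ := h.cover r hr ▸ Set.mem_univ x
  simp only [arcIn, arcOut, Set.mem_inter_iff, Set.mem_union] at *
  grind

theorem disjoint_pt (X P₀ : Set V) (s : VSep V) : Disjoint (pt X P₀ s) X :=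
  Set.disjoint_sdiff_left

theorem pt_bot (h : IsCutChain X P₀ D) : pt X P₀ (botSep X) = P₀ := by
  ext x
  have : x ∈ P₀ → x ∉ X := fun hx => Set.disjoint_left.1 h.disj hx
  simp only [pt, arcIn, botSep, Set.mem_inter_iff, Set.mem_union, Set.mem_sdiff, Set.mem_univ]
  grind

theorem pt_top (h : IsCutChain X P₀ D) : pt X P₀ (topSep X) = P₀ := by
  ext x
  have : x ∈ P₀ → x ∉ X := fun hx => Set.disjoint_left.1 h.disj hx
  simp only [pt, arcIn, topSep, Set.mem_inter_iff, Set.mem_union, Set.mem_sdiff, Set.mem_univ]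
  grind

theorem arcIn_self (h : IsCutChain X P₀ D) {s : VSep V} (hs : s ∈ D) :
    arcIn P₀ s s = pt X P₀ s ∪ X := by
  ext x
  have h3 : x ∈ X → _ := fun hx => h.left s hs hx
  have h4 : x ∈ X → _ := fun hx => h.right s hs hx
  simp only [pt, arcIn, Set.mem_inter_iff, Set.mem_union, Set.mem_sdiff]
  grind

theorem arcOut_self (h : IsCutChain X P₀ D) {s : VSep V} (hs : s ∈ D) :
    arcOut P₀ s s = Set.univ := h.cover s hs

/-- Top and bottom are the same base point, so an arc up to the top is complementary to an arc from
the bottom. This permits dropping the top from the circular order. -/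
theorem arcSep_top (h : IsCutChain X P₀ D) {s : VSep V} (hs : s ∈ D) :
    arcSep P₀ s (topSep X) = (arcSep P₀ (botSep X) s).inv := by
  refine VSep.ext ?_ ?_ <;> ext x <;> have h3 : x ∈ X → _ := fun hx => h.left s hs hx <;>
  have h4 : x ∈ X → _ := fun hx => h.right s hs hx <;>
  simp only [arcSep, inv, botSep, topSep, arcIn, arcOut, Set.mem_inter_iff, Set.mem_union,
    Set.mem_univ] <;> grind

/-- Traversing the cycle backwards swaps the two sides of each pair. Through this symmetry, limits
from above reduce to limits from below. -/
theorem inv (h : IsCutChain X P₀ D) : IsCutChain X P₀ (VSep.inv ⁻¹' D) where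
  disj := h.disj
  chain s hs t ht := (h.chain _ hs _ ht).symm.imp (fun h' => ⟨h'.2, h'.1⟩)
    (fun h' => ⟨h'.2, h'.1⟩)
  bot_mem := h.top_mem
  top_mem := h.bot_mem
  left s hs := h.right _ hs
  right s hs := h.left _ hs
  cover s hs := by rw [← h.cover _ hs, Set.union_comm s.left]; rfl

theorem insert (h : IsCutChain X P₀ D) {c : VSep V} (hl : X ⊆ c.left) (hr : X ⊆ c.right)
    (hc : c.left ∪ c.right ∪ P₀ = Set.univ) (hcmp : ∀ s ∈ D, s ≤ c ∨ c ≤ s) :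
    IsCutChain X P₀ (insert c D) where
  disj := h.disj
  chain s hs t ht := by
    rcases hs with rfl | hs <;> rcases ht with rfl | ht
    · exact Or.inl le_rfl
    · exact (hcmp t ht).symm
    · exact hcmp s hs
    · exact h.chain s hs t ht
  bot_mem := Or.inr h.bot_mem
  top_mem := Or.inr h.top_mem
  left := by rintro s (rfl | hs); exacts [hl, h.left s hs]
  right := by rintro s (rfl | hs); exacts [hr, h.right s hs]
  cover := by rintro s (rfl | hs); exacts [hc, h.cover s hs]

/-- The circular order of the cut points of a chain. -/
noncomputable abbrev circ (h : IsCutChain X P₀ D) : CircularOrder ↥(D \ {topSep X}) :=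
  let _ := chainOrder (D := D \ {topSep X}) fun s hs t ht => h.chain s hs.1 t ht.1
  LinearOrder.toCircularOrder _

theorem sbtw_iff (h : IsCutChain X P₀ D) {a b c : ↥(D \ {topSep X})} :
    h.circ.sbtw a b c ↔ ((a : VSep V) < b ∧ (b : VSep V) < c) ∨ ((b : VSep V) < c ∧ (c : VSep V) < a)
      ∨ ((c : VSep V) < a ∧ (a : VSep V) < b) := Iff.rfl

/-- In the circular order the base point is a cut point like any other, so joins and the profile
argument apply without distinguishing arcs that pass through it. -/
theorem cutSystem (h : IsCutChain X P₀ D) :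
    @CutSystem V _ h.circ (fun a b => arc P₀ (a : VSep V) b) (fun a => pt X P₀ a) X := by
  let := h.circ
  refine ⟨?_, ?_, ?_, fun a => disjoint_pt X P₀ a⟩
  · intro a b hab
    have hne : (a : VSep V) ≠ b := fun e => hab (Subtype.ext e)
    rcases h.chain a a.2.1 b b.2.1 with hle | hle
    · simp only [arc_of_le P₀ hle, arc_of_lt P₀ (hle.lt_of_ne hne)]
      exact h.union a.2.1 b.2.1 hle
    · simp only [arc_of_le P₀ hle, arc_of_lt P₀ (hle.lt_of_ne hne.symm)]
      rw [Set.union_comm]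
      exact h.union b.2.1 a.2.1 hle
  · intro a b hab
    have hne : (a : VSep V) ≠ b := fun e => hab (Subtype.ext e)
    rcases h.chain a a.2.1 b b.2.1 with hle | hle
    · simp only [arc_of_le P₀ hle, arc_of_lt P₀ (hle.lt_of_ne hne)]
      exact h.inter a.2.1 b.2.1 hle
    · simp only [arc_of_le P₀ hle, arc_of_lt P₀ (hle.lt_of_ne hne.symm)]
      rw [Set.inter_comm, h.inter b.2.1 a.2.1 hle, Set.union_comm (pt X P₀ _)]
  · intro a b c habc
    rcases h.sbtw_iff.1 habc with ⟨h1, h2⟩ | ⟨h1, h2⟩ | ⟨h1, h2⟩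
    · simp only [arc_of_le P₀ h1.le, arc_of_le P₀ h2.le, arc_of_le P₀ (h1.trans h2).le]
      exact h.arcIn_union b.2.1 h1.le h2.le
    · simp only [arc_of_lt P₀ (h1.trans h2), arc_of_le P₀ h1.le, arc_of_lt P₀ h2]
      rw [h.arcOut_union_left b.2.1 h1.le h2.le]
    · simp only [arc_of_lt P₀ (h1.trans h2), arc_of_le P₀ h2.le, arc_of_lt P₀ h1]
      exact h.arcOut_union_right b.2.1 h1.le h2.le

end IsCutChain

/-- A chain of separations that encodes cut points whose arcs separate in the universe `U`. -/
structure LinSys {V : Type u} (U : SepUniverse V) (k : ℕ) (X P₀ : Set V) (D : Set (VSep V)) : Prop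
    extends IsCutChain X P₀ D where
  card : ∀ s ∈ D, 2 * (pt X P₀ s).encard + X.encard = k
  sep : ∀ s ∈ D, ∀ t ∈ D, s < t → ¬(s = botSep X ∧ t = topSep X) → arcSep P₀ s t ∈ U.seps

theorem LinSys.inv {V : Type u} {U : SepUniverse V} {k : ℕ} {X P₀ : Set V} {D : Set (VSep V)}
    (h : LinSys U k X P₀ D) : LinSys U k X P₀ (VSep.inv ⁻¹' D) where
  toIsCutChain := h.toIsCutChain.inv
  card s hs := by rw [← pt_inv]; exact h.card _ hs
  sep s hs t ht hst hn := by
    rw [← arcSep_inv]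
    refine h.sep _ ht _ hs (inv_lt_inv hst) ?_
    rintro ⟨h1, h2⟩
    exact hn ⟨congrArg VSep.inv h2, congrArg VSep.inv h1⟩

/-! ### Limits of cut points -/

namespace CutSystem

variable {V G : Type u} [CircularOrder G] {W : G → G → Set V} {P : G → Set V} {X : Set V}

/-- If `c` is separated from one cut point in `U`, then it is separated from all cut points. -/
theorem sep_of_sep_one (h : CutSystem W P X) {U : SepUniverse V} {c u₀ u₁ u₂ : G}
    (hs : ∀ a b, a ≠ c → b ≠ c → a ≠ b → (⟨W a b, W b a⟩ : VSep V) ∈ U.seps)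
    (h0 : (⟨W u₀ c, W c u₀⟩ : VSep V) ∈ U.seps) (h1 : sbtw c u₁ u₀) (h2 : sbtw u₀ u₂ c)
    (d1 : Disjoint (P u₀) (P u₁)) (d2 : Disjoint (P u₀) (P u₂)) (a b : G) (hab : a ≠ b) :
    (⟨W a b, W b a⟩ : VSep V) ∈ U.seps := by
  have hu : u₀ ≠ c := ne_ends_of_sbtw h2
  have key : ∀ w, w ≠ c → (⟨W w c, W c w⟩ : VSep V) ∈ U.seps := by
    intro w hw
    rcases eq_or_ne w u₀ with rfl | hwu
    · exact h0
    -- The arc between `c` and `w` through `u₀` is the join of the arc between `c` and `u₀` with an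
    -- arc that does not end in `c`; `u₁` or `u₂` makes the two overlap in an arc with disjoint
    -- ends.
    rcases sbtw_total_of_ne hu.symm hwu.symm hw with h3 | h3
    · have s1 : sbtw c u₁ w := h1.trans_right h3
      have e := h.join s1 h3 (Or.inr h1) d1
      have := U.sup_mem _ (U.inv_mem _ h0) _ (hs u₁ w (ne_left_of_sbtw h1).symm hw
        (ne_right_of_sbtw s1))
      have e' : (⟨W u₀ c, W c u₀⟩ : VSep V).inv.sup ⟨W u₁ w, W w u₁⟩ = ⟨W c w, W w c⟩ :=
        VSep.ext e.1 e.2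
      rw [e'] at this
      exact U.inv_mem _ this
    · have s0 : sbtw w u₀ c := h3.cyclic_left
      have s1 : sbtw w u₂ c := s0.trans_left h2
      have e := h.join s0 s1 (Or.inr (h2.trans_right (sbtw_cyclic_left s0)).cyclic_right) d2.symm
      have := U.sup_mem _ (hs w u₂ hw (ne_right_of_sbtw h2) (ne_left_of_sbtw s1)) _ h0
      have e' : (⟨W w u₂, W u₂ w⟩ : VSep V).sup ⟨W u₀ c, W c u₀⟩ = ⟨W w c, W c w⟩ :=
        VSep.ext e.1 e.2
      rwa [e'] at this
  rcases eq_or_ne a c with rfl | ha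
  · exact U.inv_mem _ (key b hab.symm)
  rcases eq_or_ne b c with rfl | hb
  · exact key a ha
  · exact hs a b ha hb hab

/-- As `u₀` and `c` are disjoint, the order of their arc is exactly `m + |P c| + |X|`, to be
compared with `k = 2m + |X|`. -/
theorem encard_le_of_order_le (h : CutSystem W P X) {c u₀ : G} {k m : ℕ} (hu : u₀ ≠ c)
    (hX : X.encard + 2 * m = k) (hP : (P u₀).encard = m) (hd : Disjoint (P u₀) (P c))
    (ho : (⟨W u₀ c, W c u₀⟩ : VSep V).order ≤ k) : (P c).encard ≤ m := by
  have e : (⟨W u₀ c, W c u₀⟩ : VSep V).order = m + (P c).encard + X.encard := by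
    show (W u₀ c ∩ W c u₀).encard = _
    rw [h.inter hu, Set.encard_union_eq, Set.encard_union_eq hd, hP]
    exact Set.disjoint_union_left.2 ⟨h.disj _, h.disj _⟩
  rw [e, ← hX] at ho
  have hXf : X.encard ≠ ⊤ := by
    intro h'
    rw [h', top_add] at hX
    exact ENat.natCast_ne_top k hX.symm
  obtain ⟨x, hx⟩ := ENat.ne_top_iff_exists.1 hXf
  have hpf : (P c).encard ≠ ⊤ := by
    intro h'
    rw [h', ← hx, add_top, top_add, top_le_iff] at ho
    exact absurd ho (by norm_cast)
  obtain ⟨p, hp⟩ := ENat.ne_top_iff_exists.1 hpf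
  rw [← hx, ← hp] at ho
  rw [← hp]
  norm_cast at ho ⊢
  omega

/-- The profile argument looks at the four points in the order in which they follow `c`. Depending
on the gap that contains `c`, this is one of four rotations. -/
theorem le_encard_of_four (h : CutSystem W P X) {U : SepUniverse V} {k m : ℕ}
    (hsep : ∀ a b, a ≠ b → (⟨W a b, W b a⟩ : VSep V) ∈ U.seps) (c : G)
    (hX : X.encard + 2 * m = k) (hP : ∀ a, a ≠ c → (P a).encard = m)
    (Q : Fin 3 → Set (VSep V)) (hQ : ∀ i, U.IsProfile (k + 1) (Q i))
    (hlow : ∀ i j, Q i ∩ U.sys k = Q j ∩ U.sys k)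
    (hdist : ∀ i j, i ≠ j → ∃ a b, a ≠ c ∧ b ≠ c ∧ a ≠ b ∧
      (⟨W a b, W b a⟩ : VSep V) ∈ Q i ∧ (⟨W b a, W a b⟩ : VSep V) ∈ Q j)
    {p₀ p₁ p₂ p₃ : G} (s1 : sbtw p₀ p₁ p₂) (s2 : sbtw p₀ p₂ p₃)
    (hd : ∀ a ∈ ({p₀, p₁, p₂, p₃} : Set G), ∀ b ∈ ({p₀, p₁, p₂, p₃} : Set G), a ≠ b →
      Disjoint (P a) (P b) ∧ W a b ≠ Set.univ)
    (hc : c ∉ ({p₀, p₁, p₂, p₃} : Set G)) : (m : ℕ∞) ≤ (P c).encard := by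
  simp only [Set.mem_insert_iff, Set.mem_singleton_iff, not_or] at hc
  obtain ⟨c0, c1, c2, c3⟩ := hc
  have n01 := ne_left_of_sbtw s1
  have n12 := ne_right_of_sbtw s1
  have n02 := ne_ends_of_sbtw s1
  have n23 := ne_right_of_sbtw s2
  have n03 := ne_ends_of_sbtw s2
  have s3 : sbtw p₀ p₁ p₃ := s1.trans_right s2
  have n13 := ne_right_of_sbtw s3
  have m0 : p₀ ∈ ({p₀, p₁, p₂, p₃} : Set G) := by simp
  have m1 : p₁ ∈ ({p₀, p₁, p₂, p₃} : Set G) := by simp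
  have m2 : p₂ ∈ ({p₀, p₁, p₂, p₃} : Set G) := by simp
  have m3 : p₃ ∈ ({p₀, p₁, p₂, p₃} : Set G) := by simp
  have main : ∀ {a₁ a₂ a₃ a₄ : G}, a₁ ∈ ({p₀, p₁, p₂, p₃} : Set G) →
      a₂ ∈ ({p₀, p₁, p₂, p₃} : Set G) → a₃ ∈ ({p₀, p₁, p₂, p₃} : Set G) →
      a₄ ∈ ({p₀, p₁, p₂, p₃} : Set G) → sbtw c a₁ a₂ → sbtw c a₂ a₃ → sbtw c a₃ a₄ →
      (m : ℕ∞) ≤ (P c).encard := by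
    intro a₁ a₂ a₃ a₄ m1 m2 m3 m4 h12 h23 h34
    have n12 := ne_right_of_sbtw h12
    have n23 := ne_right_of_sbtw h23
    have n34 := ne_right_of_sbtw h34
    have n13 := ne_right_of_sbtw (h12.trans_right h23)
    have n24 := ne_right_of_sbtw (h23.trans_right h34)
    have n14 := ne_right_of_sbtw ((h12.trans_right h23).trans_right h34)
    exact h.le_encard_of_profiles hsep c hX hP Q hQ hlow hdist h12 h23 h34
      (hd _ m1 _ m2 n12).1 (hd _ m2 _ m3 n23).1 (hd _ m3 _ m4 n34).1 (hd _ m1 _ m3 n13).1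
      (hd _ m2 _ m4 n24).1 (hd _ m1 _ m4 n14).1 (hd _ m2 _ m3 n23).2 (hd _ m3 _ m2 n23.symm).2
      (hd _ m4 _ m2 n24.symm).2 (hd _ m3 _ m1 n13.symm).2
  have e : ∀ x y z : G, sbtw x y z ↔ _ := fun x y z => sbtw_iff_baseOrder p₀
  let := baseOrder p₀
  have l0 : p₀ < c := baseOrder_bot_lt c0
  have l1 : p₀ < p₁ := baseOrder_bot_lt n01.symm
  have l2 : p₁ < p₂ := (baseOrder_lt_iff_sbtw n01.symm).2 s1
  have l3 : p₂ < p₃ := (baseOrder_lt_iff_sbtw n02.symm).2 s2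
  have t3 : ∀ {x y z : G}, x < y → y < z → sbtw x y z := fun h1 h2 => sbtw_of_baseOrder h1 h2
  rcases lt_or_gt_of_ne c1 with h1 | h1
  · exact main m1 m2 m3 m0 (t3 h1 l2) (t3 (h1.trans l2) l3)
      (t3 l0 (h1.trans (l2.trans l3))).cyclic_left
  rcases lt_or_gt_of_ne c2 with h2 | h2
  · exact main m2 m3 m0 m1 (t3 h2 l3) (t3 l0 (h2.trans l3)).cyclic_left
      (t3 l1 h1).cyclic_right
  rcases lt_or_gt_of_ne c3 with h3 | h3
  · exact main m3 m0 m1 m2 (t3 l0 h3).cyclic_left (t3 l1 h1).cyclic_right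
      (t3 l2 h2).cyclic_right
  · exact main m0 m1 m2 m3 (t3 l1 h1).cyclic_right (t3 l2 h2).cyclic_right
      (t3 l3 h3).cyclic_right

end CutSystem

/-! ### Spread cut points and distinguished profiles on a chain -/

open VSep

/-- Four cut points, one of them the base point, with disjoint vertex sets and proper arcs. -/
structure Spread {V : Type u} (X P₀ : Set V) (v₂ v₃ v₄ : VSep V) : Prop where
  lt23 : v₂ < v₃
  lt34 : v₃ < v₄
  d02 : Disjoint P₀ (pt X P₀ v₂)
  d03 : Disjoint P₀ (pt X P₀ v₃)
  d04 : Disjoint P₀ (pt X P₀ v₄)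
  d23 : Disjoint (pt X P₀ v₂) (pt X P₀ v₃)
  d24 : Disjoint (pt X P₀ v₂) (pt X P₀ v₄)
  d34 : Disjoint (pt X P₀ v₃) (pt X P₀ v₄)
  l2 : v₂.left ∪ P₀ ≠ Set.univ
  r2 : v₂.right ∪ P₀ ≠ Set.univ
  l3 : v₃.left ∪ P₀ ≠ Set.univ
  r3 : v₃.right ∪ P₀ ≠ Set.univ
  l4 : v₄.left ∪ P₀ ≠ Set.univ
  r4 : v₄.right ∪ P₀ ≠ Set.univ
  i23 : arcIn P₀ v₂ v₃ ≠ Set.univ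
  o23 : arcOut P₀ v₂ v₃ ≠ Set.univ
  i24 : arcIn P₀ v₂ v₄ ≠ Set.univ
  o24 : arcOut P₀ v₂ v₄ ≠ Set.univ
  i34 : arcIn P₀ v₃ v₄ ≠ Set.univ
  o34 : arcOut P₀ v₃ v₄ ≠ Set.univ

theorem Spread.inv {V : Type u} {X P₀ : Set V} {v₂ v₃ v₄ : VSep V} (h : Spread X P₀ v₂ v₃ v₄) :
    Spread X P₀ v₄.inv v₃.inv v₂.inv where
  lt23 := inv_lt_inv h.lt34
  lt34 := inv_lt_inv h.lt23
  d02 := (pt_inv X P₀ v₄).symm ▸ h.d04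
  d03 := (pt_inv X P₀ v₃).symm ▸ h.d03
  d04 := (pt_inv X P₀ v₂).symm ▸ h.d02
  d23 := by rw [pt_inv, pt_inv]; exact h.d34.symm
  d24 := by rw [pt_inv, pt_inv]; exact h.d24.symm
  d34 := by rw [pt_inv, pt_inv]; exact h.d23.symm
  l2 := h.r4
  r2 := h.l4
  l3 := h.r3
  r3 := h.l3
  l4 := h.r2
  r4 := h.l2
  i23 := by rw [arcIn_inv]; exact h.i34
  o23 := by rw [arcOut_inv]; exact h.o34
  i24 := by rw [arcIn_inv]; exact h.i24
  o24 := by rw [arcOut_inv]; exact h.o24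
  i34 := by rw [arcIn_inv]; exact h.i23
  o34 := by rw [arcOut_inv]; exact h.o23

/-- A vertex of the base point lies in neither side at a cut point that does not use it. -/
theorem notMem_of_disjoint_pt {V : Type u} {X P₀ : Set V} {v : VSep V} (hX : Disjoint P₀ X)
    (h : Disjoint P₀ (pt X P₀ v)) {x : V} (hx : x ∈ P₀) : x ∉ v.left ∧ x ∉ v.right := by
  have h1 : x ∉ X := Set.disjoint_left.1 hX hx
  have h2 := Set.disjoint_left.1 h hx
  simp only [pt, arcIn, Set.mem_sdiff, Set.mem_union, Set.mem_inter_iff] at h2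
  tauto

/-- The arcs between the cut points in `D` pairwise distinguish three `(k + 1)`-profiles with the
same separations of order less than `k`. -/
def DistinguishesProfiles {V : Type u} (U : SepUniverse V) (k : ℕ) (P₀ : Set V)
    (D : Set (VSep V)) : Prop :=
  ∃ Q : Fin 3 → Set (VSep V), (∀ i, U.IsProfile (k + 1) (Q i)) ∧
    (∀ i j, Q i ∩ U.sys k = Q j ∩ U.sys k) ∧
    ∀ i j, i ≠ j → ∃ s ∈ D, ∃ t ∈ D, s ≤ t ∧
      ((arcSep P₀ s t ∈ Q i ∧ (arcSep P₀ s t).inv ∈ Q j) ∨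
        ((arcSep P₀ s t).inv ∈ Q i ∧ arcSep P₀ s t ∈ Q j))

theorem DistinguishesProfiles.inv {V : Type u} {U : SepUniverse V} {k : ℕ} {P₀ : Set V}
    {D : Set (VSep V)} (h : DistinguishesProfiles U k P₀ D) :
    DistinguishesProfiles U k P₀ (VSep.inv ⁻¹' D) := by
  obtain ⟨Q, h1, h2, h3⟩ := h
  refine ⟨Q, h1, h2, fun i j hij => ?_⟩
  obtain ⟨s, hs, t, ht, hst, h⟩ := h3 i j hij
  refine ⟨t.inv, ht, s.inv, hs, inv_le_inv hst, ?_⟩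
  rwa [arcSep_inv]

theorem DistinguishesProfiles.mono {V : Type u} {U : SepUniverse V} {k : ℕ} {P₀ : Set V}
    {D D' : Set (VSep V)} (h : DistinguishesProfiles U k P₀ D) (hD : D ⊆ D') :
    DistinguishesProfiles U k P₀ D' := by
  obtain ⟨Q, h1, h2, h3⟩ := h
  refine ⟨Q, h1, h2, fun i j hij => ?_⟩
  obtain ⟨s, hs, t, ht, h⟩ := h3 i j hij
  exact ⟨s, hD hs, t, hD ht, h⟩

theorem arcOut_mono {V : Type u} (P₀ : Set V) {s s' t t' : VSep V} (h : s ≤ s') (h' : t' ≤ t) :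
    arcOut P₀ s t ⊆ arcOut P₀ s' t' :=
  Set.union_subset_union_left _ (Set.union_subset_union h.1 h'.2)

theorem IsCutChain.arcIn_bot {V : Type u} {X P₀ : Set V} (s : VSep V) :
    arcIn P₀ (botSep X) s = s.left ∪ P₀ := by
  ext x
  simp only [arcIn, botSep, Set.mem_inter_iff, Set.mem_union, Set.mem_univ]
  tauto

theorem IsCutChain.arcOut_bot {V : Type u} {X P₀ : Set V} {s : VSep V} (hs : X ⊆ s.right) :
    arcOut P₀ (botSep X) s = s.right ∪ P₀ := by
  simp only [arcOut, botSep]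
  rw [Set.union_eq_self_of_subset_left hs]

/-! ### Limits obtained from limit-closedness -/

namespace LinSys

variable {V : Type u} {U : SepUniverse V} {k : ℕ} {X P₀ : Set V} {D : Set (VSep V)}

/-- The equation in `ℕ∞` with finite right-hand side forces finite sizes, so that `(k - |X|) / 2` is
a natural number `m`. -/
theorem exists_card (h : LinSys U k X P₀ D) :
    ∃ m : ℕ, X.encard + 2 * m = k ∧ ∀ s : VSep V,
      2 * (pt X P₀ s).encard + X.encard = k ↔ (pt X P₀ s).encard = m := by
  have h0 := h.card _ h.bot_mem
  have hXf : X.encard ≠ ⊤ := by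
    intro h'
    rw [h', add_top] at h0
    exact ENat.natCast_ne_top k h0.symm
  obtain ⟨x, hx⟩ := ENat.ne_top_iff_exists.1 hXf
  have hne : ∀ p : ℕ∞, 2 * p + x = k → ∃ q : ℕ, p = q := by
    intro p hp
    have : p ≠ ⊤ := by
      rintro rfl
      rw [ENat.mul_top (by norm_num), top_add] at hp
      exact ENat.natCast_ne_top k hp.symm
    obtain ⟨q, hq⟩ := ENat.ne_top_iff_exists.1 this
    exact ⟨q, hq.symm⟩
  rw [← hx] at h0 ⊢
  obtain ⟨m, hm⟩ := hne _ h0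
  rw [hm] at h0
  norm_cast at h0
  refine ⟨m, by norm_cast; omega, fun s => ⟨fun hs => ?_, fun hs => ?_⟩⟩
  · obtain ⟨q, hq⟩ := hne _ hs
    rw [hq] at hs ⊢
    norm_cast at hs ⊢
    omega
  · rw [hs]
    exact_mod_cast h0

theorem order_le (h : LinSys U k X P₀ D) {s t : VSep V} (hs : s ∈ D) (ht : t ∈ D) (hst : s ≤ t) :
    (arcSep P₀ s t).order ≤ k := by
  obtain ⟨m, hm, hc⟩ := h.exists_card
  show (arcIn P₀ s t ∩ arcOut P₀ s t).encard ≤ k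
  rw [h.inter hs ht hst, ← hm]
  refine (Set.encard_union_le _ _).trans ?_
  rw [add_comm]
  gcongr
  refine (Set.encard_union_le _ _).trans ?_
  rw [(hc s).1 (h.card s hs), (hc t).1 (h.card t ht), two_mul]

theorem order_inv (s : VSep V) : s.inv.order = s.order := by
  simp only [VSep.order, VSep.inv, Set.inter_comm]

/-- The limit of a cut of a chain of cut points, as seen from one of the cut points. -/
theorem exists_candidate (h : LinSys U k X P₀ D) (hU : U.LimitClosed) {v₂ v₃ v₄ : VSep V}
    (hv : Spread X P₀ v₂ v₃ v₄) (h2 : v₂ ∈ D) (h3 : v₃ ∈ D) (h4 : v₄ ∈ D) {L R : Set (VSep V)}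
    (hLR : ∀ s ∈ D, s ∈ L ∨ s ∈ R) (hL : L ⊆ D) (hR : R ⊆ D) (hlt : ∀ l ∈ L, ∀ r ∈ R, l < r)
    (hbot : botSep X ∈ L) (htop : topSep X ∈ R) :
    ∃ c : VSep V, (∀ l ∈ L, l ≤ c) ∧ (∀ r ∈ R, c ≤ r) ∧ c.right = ⋂ l ∈ L, l.right ∧
      ((v₃ ∈ R ∧ (arcSep P₀ c v₄).inv ∈ U.seps ∧ (arcSep P₀ c v₄).inv.order ≤ k) ∨
        (v₃ ∈ L ∧ arcSep P₀ v₂ c ∈ U.seps ∧ (arcSep P₀ v₂ c).order ≤ k)) := by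
  have hlow : ∀ {s t}, s ∈ D → t ∈ L → s ≤ t → s ∈ L := fun hs ht hst =>
    (hLR _ hs).resolve_right fun hr => (hlt _ ht _ hr).not_ge hst
  -- A limit above `v₃` is viewed from `v₂`, one below `v₃` from `v₄`. In this way the viewpoint and
  -- the limit have `v₃` on one side between them and the base point on the other.
  rcases hLR v₃ h3 with h3L | h3R
  · have h2L : v₂ ∈ L := hlow h2 h3L hv.lt23.le
    have hmem : ∀ r ∈ D, v₂ < r → arcSep P₀ v₂ r ∈ U.seps := by
      intro r hr hlt'
      refine h.sep _ h2 _ hr hlt' ?_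
      rintro ⟨rfl, -⟩
      exact hv.r2 (Set.univ_union _)
    -- Only `l` above `v₃` are used, so that each arc `[v₂, l]` is proper; they are cofinal in `L`.
    obtain ⟨t, ht, hub, hlub, hord, ⟨X', hX'⟩, hright⟩ :=
      hU k ((fun l => arcSep P₀ v₂ l) '' {l ∈ L | v₃ ≤ l})
        (by
          rintro _ ⟨l, ⟨hl, hl3⟩, rfl⟩
          exact hmem l (hL hl) (hv.lt23.trans_le hl3))
        ⟨_, v₃, ⟨h3L, le_rfl⟩, rfl⟩
        (by
          rintro _ ⟨l, ⟨hl, hl3⟩, rfl⟩ _ ⟨l', ⟨hl', hl3'⟩, rfl⟩ -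
          rcases h.chain l (hL hl) l' (hL hl') with hll | hll
          · exact Or.inl ⟨arcIn_mono P₀ le_rfl hll, arcOut_mono P₀ le_rfl hll⟩
          · exact Or.inr ⟨arcIn_mono P₀ le_rfl hll, arcOut_mono P₀ le_rfl hll⟩)
        (by
          rintro _ ⟨l, ⟨hl, hl3⟩, rfl⟩
          exact h.order_le h2 (hL hl) (hv.lt23.le.trans hl3))
    have hN : ∀ x ∈ P₀, x ∉ v₂.right := fun x hx => (notMem_of_disjoint_pt h.disj hv.d02 hx).2
    have htR : ∀ r ∈ R, t.left ⊆ arcIn P₀ v₂ r := by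
      intro r hr
      have h2r := hlt _ h2L r hr
      refine (hlub (arcSep P₀ v₂ r) (hmem r (hR hr) h2r) ?_).1
      rintro _ ⟨l, ⟨hl, hl3⟩, rfl⟩
      exact ⟨arcIn_mono P₀ le_rfl (hlt l hl r hr).le, arcOut_mono P₀ le_rfl (hlt l hl r hr).le⟩
    have hcR : ∀ r ∈ R, t.left ⊆ r.left := by
      intro r hr x hx
      rcases htR r hr hx with h' | ⟨h', h'' | h''⟩
      · exact h'.1
      · exact h''
      · exact absurd h'' (hN x h')
    have hLt : ∀ l ∈ L, v₃ ≤ l → arcIn P₀ v₂ l ⊆ t.left := fun l hl hl3 =>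
      (hub _ ⟨l, ⟨hl, hl3⟩, rfl⟩).1
    have hup : ∀ l ∈ L, ∃ l' ∈ L, v₃ ≤ l' ∧ l ≤ l' := by
      intro l hl
      rcases h.chain l (hL hl) v₃ h3 with h' | h'
      · exact ⟨v₃, h3L, le_rfl, h'⟩
      · exact ⟨l, hl, h', le_rfl⟩
    -- The vertices that the supremum adds to the union go into the left side of the new pair; its
    -- arc from `v₂` is then the supremum itself.
    have e : arcSep P₀ v₂ ⟨(⋃ l ∈ L, l.left) ∪ t.left, ⋂ l ∈ L, l.right⟩ = t := by
      refine VSep.ext ?_ ?_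
      · show arcIn P₀ v₂ _ = _
        refine subset_antisymm ?_ ?_
        · rintro x hx
          have hx' : (x ∈ v₂.right ∨ x ∈ P₀) ∧ x ∈ (⋃ l ∈ L, l.left) ∪ t.left := by
            rcases hx with ⟨h1, h2⟩ | ⟨h1, h2 | h2⟩
            · exact ⟨Or.inl h2, h1⟩
            · exact ⟨Or.inr h1, h2⟩
            · exact absurd h2 (hN x h1)
          obtain ⟨hx1, hx2 | hx2⟩ := hx'
          · simp only [Set.mem_iUnion] at hx2
            obtain ⟨l, hl, hxl⟩ := hx2
            obtain ⟨l', hl', h3l', hll'⟩ := hup l hl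
            refine hLt l' hl' h3l' ?_
            have := hll'.1 hxl
            rcases hx1 with hx1 | hx1
            · exact Or.inl ⟨this, hx1⟩
            · exact Or.inr ⟨hx1, Or.inl this⟩
          · exact hx2
        · intro x hx
          rcases htR _ htop hx with h' | ⟨h', -⟩
          · exact Or.inl ⟨Or.inr hx, h'.2⟩
          · exact Or.inr ⟨h', Or.inl (Or.inr hx)⟩
      · rw [hright]
        ext x
        simp only [arcSep, arcOut, Set.mem_union, Set.mem_iInter, Set.mem_image,
          forall_exists_index, and_imp]
        constructor
        · rintro hx _ l ⟨hl, -⟩ rfl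
          rcases hx with (hx | hx) | hx
          · exact Or.inl (Or.inl hx)
          · exact Or.inl (Or.inr (hx l hl))
          · exact Or.inr hx
        · intro hx
          by_cases hx1 : x ∈ v₂.left
          · exact Or.inl (Or.inl hx1)
          by_cases hx2 : x ∈ P₀
          · exact Or.inr hx2
          refine Or.inl (Or.inr fun l hl => ?_)
          obtain ⟨l', hl', h3l', hll'⟩ := hup l hl
          rcases hx _ l' ⟨hl', h3l'⟩ rfl with (h' | h') | h'
          · exact absurd h' hx1
          · exact hll'.2 h'
          · exact absurd h' hx2
    refine ⟨⟨(⋃ l ∈ L, l.left) ∪ t.left, ⋂ l ∈ L, l.right⟩, ?_, ?_, rfl,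
      Or.inr ⟨h3L, by rw [e]; exact ht, by rw [e]; exact hord⟩⟩
    · exact fun l hl => ⟨(Set.subset_biUnion_of_mem (u := fun l : VSep V => l.left) hl).trans
        Set.subset_union_left, Set.biInter_subset_of_mem hl⟩
    · exact fun r hr => ⟨Set.union_subset (Set.iUnion₂_subset fun l hl => (hlt l hl r hr).le.1)
        (hcR r hr), Set.subset_iInter₂ fun l hl => (hlt l hl r hr).le.2⟩
  · have hmem : ∀ r ∈ D, r < v₄ → (arcSep P₀ r v₄).inv ∈ U.seps := by
      intro r hr hlt'
      refine U.inv_mem _ (h.sep _ hr _ h4 hlt' ?_)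
      rintro ⟨-, rfl⟩
      exact hv.l4 (Set.univ_union _)
    have hL4 : ∀ l ∈ L, l < v₄ := fun l hl => (hlt l hl _ h3R).trans hv.lt34
    -- The arcs from `v₄` through the base point to `l` grow with `l`, hence the inverses.
    obtain ⟨t, ht, hub, hlub, hord, ⟨X', hX'⟩, hright⟩ :=
      hU k ((fun l => (arcSep P₀ l v₄).inv) '' L)
        (by
          rintro _ ⟨l, hl, rfl⟩
          exact hmem l (hL hl) (hL4 l hl))
        ⟨_, _, hbot, rfl⟩
        (by
          rintro _ ⟨l, hl, rfl⟩ _ ⟨l', hl', rfl⟩ -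
          rcases h.chain l (hL hl) l' (hL hl') with hll | hll
          · exact Or.inl ⟨arcOut_mono P₀ hll le_rfl, arcIn_mono P₀ hll le_rfl⟩
          · exact Or.inr ⟨arcOut_mono P₀ hll le_rfl, arcIn_mono P₀ hll le_rfl⟩)
        (by
          rintro _ ⟨l, hl, rfl⟩
          rw [order_inv]
          exact h.order_le (hL hl) h4 (hL4 l hl).le)
    have hN : ∀ x ∈ P₀, x ∉ v₄.left := fun x hx => (notMem_of_disjoint_pt h.disj hv.d04 hx).1
    have htR : ∀ r ∈ R, r < v₄ → t.left ⊆ arcOut P₀ r v₄ := by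
      intro r hr hr4
      refine (hlub (arcSep P₀ r v₄).inv (hmem r (hR hr) hr4) ?_).1
      rintro _ ⟨l, hl, rfl⟩
      exact ⟨arcOut_mono P₀ (hlt l hl r hr).le le_rfl, arcIn_mono P₀ (hlt l hl r hr).le le_rfl⟩
    have hcR' : ∀ r ∈ R, r < v₄ → t.left \ (v₄.right ∪ P₀) ⊆ r.left := by
      rintro r hr hr4 x ⟨hx, hx'⟩
      rcases htR r hr hr4 hx with (h' | h') | h'
      · exact h'
      · exact absurd (Or.inl h') hx'
      · exact absurd (Or.inr h') hx'
    have hcR : ∀ r ∈ R, t.left \ (v₄.right ∪ P₀) ⊆ r.left := by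
      intro r hr
      rcases h.lt_or_le (hR hr) h4 with hr4 | hr4
      · exact hcR' r hr hr4
      · exact (hcR' _ h3R hv.lt34).trans (hv.lt34.le.trans hr4).1
    have hLt : ∀ l ∈ L, arcOut P₀ l v₄ ⊆ t.left := fun l hl => (hub _ ⟨l, hl, rfl⟩).1
    -- Vertices of `v₄.right` and of `P₀` belong to the arc from `v₄` in any case. They are removed
    -- from `t.left`, since the left side has to stay below all members of `R`.
    have e : (arcSep P₀ ⟨(⋃ l ∈ L, l.left) ∪ (t.left \ (v₄.right ∪ P₀)),
        ⋂ l ∈ L, l.right⟩ v₄).inv = t := by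
      refine VSep.ext ?_ ?_
      · show arcOut P₀ _ v₄ = _
        refine subset_antisymm ?_ ?_
        · rintro x (((hx | hx) | hx) | hx)
          · simp only [Set.mem_iUnion] at hx
            obtain ⟨l, hl, hxl⟩ := hx
            exact hLt l hl (Or.inl (Or.inl hxl))
          · exact hx.1
          · exact hLt _ hbot (Or.inl (Or.inr hx))
          · exact hLt _ hbot (Or.inr hx)
        · intro x hx
          by_cases hx1 : x ∈ v₄.right
          · exact Or.inl (Or.inr hx1)
          by_cases hx2 : x ∈ P₀
          · exact Or.inr hx2
          · exact Or.inl (Or.inl (Or.inr ⟨hx, not_or.2 ⟨hx1, hx2⟩⟩))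
      · rw [hright]
        ext x
        simp only [arcSep, VSep.inv, arcIn, Set.mem_union, Set.mem_inter_iff, Set.mem_iInter,
          Set.mem_image, forall_exists_index, and_imp]
        constructor
        · rintro hx _ l hl rfl
          rcases hx with ⟨hx, hx'⟩ | ⟨hx, hx' | hx'⟩
          · exact Or.inl ⟨hx, hx' l hl⟩
          · exact absurd hx' (hN x hx)
          · exact Or.inr ⟨hx, Or.inr (hx' l hl)⟩
        · intro hx
          by_cases hx2 : x ∈ P₀
          · refine Or.inr ⟨hx2, Or.inr fun l hl => ?_⟩
            rcases hx _ l hl rfl with h' | ⟨-, h' | h'⟩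
            · exact h'.2
            · exact absurd h' (hN x hx2)
            · exact h'
          · have key : ∀ l ∈ L, x ∈ v₄.left ∧ x ∈ l.right := fun l hl =>
              (hx _ l hl rfl).resolve_right fun h' => hx2 h'.1
            exact Or.inl ⟨(key _ hbot).1, fun l hl => (key l hl).2⟩
    refine ⟨⟨(⋃ l ∈ L, l.left) ∪ (t.left \ (v₄.right ∪ P₀)), ⋂ l ∈ L, l.right⟩, ?_, ?_, rfl,
      Or.inl ⟨h3R, by rw [e]; exact ht, by rw [e]; exact hord⟩⟩
    · exact fun l hl => ⟨(Set.subset_biUnion_of_mem (u := fun l : VSep V => l.left) hl).trans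
        Set.subset_union_left, Set.biInter_subset_of_mem hl⟩
    · exact fun r hr => ⟨Set.union_subset (Set.iUnion₂_subset fun l hl => (hlt l hl r hr).le.1)
        (hcR r hr), Set.subset_iInter₂ fun l hl => (hlt l hl r hr).le.2⟩

end LinSys

/-! ### Limits of chains of cut points -/

open VSep

theorem Spread.ne_top {V : Type u} {X P₀ : Set V} {v₂ v₃ v₄ : VSep V} (h : Spread X P₀ v₂ v₃ v₄) :
    v₂ ≠ topSep X ∧ v₃ ≠ topSep X ∧ v₄ ≠ topSep X := by
  refine ⟨?_, ?_, ?_⟩ <;> rintro rfl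
  exacts [h.l2 (Set.univ_union _), h.l3 (Set.univ_union _), h.l4 (Set.univ_union _)]

theorem Spread.ne_bot {V : Type u} {X P₀ : Set V} {v₂ v₃ v₄ : VSep V} (h : Spread X P₀ v₂ v₃ v₄) :
    v₂ ≠ botSep X ∧ v₃ ≠ botSep X ∧ v₄ ≠ botSep X := by
  refine ⟨?_, ?_, ?_⟩ <;> rintro rfl
  exacts [h.r2 (Set.univ_union _), h.r3 (Set.univ_union _), h.r4 (Set.univ_union _)]

namespace LinSys

variable {V : Type u} {U : SepUniverse V} {k : ℕ} {X P₀ : Set V} {D : Set (VSep V)}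

/-- Profiles that agree below order `k` can differ on such a separation only if both of its sides
are `univ`, and then its order is the number of all vertices. -/
theorem not_mem_of_order_lt {n : ℕ} {Q Q' : Set (VSep V)} (hQ : U.IsProfile n Q)
    (hQ' : U.IsProfile n Q') (hQQ : Q ∩ U.sys k = Q' ∩ U.sys k) {s : VSep V} (hs : s.order < k)
    (h1 : s ∈ Q) (h2 : s.inv ∈ Q') : (k : ℕ∞) > (Set.univ : Set V).encard := by
  have h3 : s ∈ Q ∩ U.sys k := ⟨h1, (hQ.subset h1).1, hs⟩
  rw [hQQ] at h3
  obtain ⟨h4, h5⟩ := hQ'.eq_univ_of_mem_of_inv_mem h3.1 h2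
  rwa [VSep.order, h4, h5, Set.univ_inter] at hs

theorem le_encard_univ (h : LinSys U k X P₀ D) {s t : VSep V} (hs : s ∈ D) (ht : t ∈ D)
    (hd : Disjoint (pt X P₀ s) (pt X P₀ t)) : (k : ℕ∞) ≤ (Set.univ : Set V).encard := by
  obtain ⟨m, hm, hc⟩ := h.exists_card
  refine le_trans (le_of_eq ?_)
    (Set.encard_le_encard (Set.subset_univ (pt X P₀ s ∪ pt X P₀ t ∪ X)))
  rw [Set.encard_union_eq, Set.encard_union_eq hd, (hc s).1 (h.card s hs),
    (hc t).1 (h.card t ht), ← hm, two_mul, add_comm]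
  exact Set.disjoint_union_left.2 ⟨IsCutChain.disjoint_pt _ _ _, IsCutChain.disjoint_pt _ _ _⟩

/-- If cut points are not empty, then three profiles are distinguished by proper arcs. -/
theorem exists_proper_arc (h : LinSys U k X P₀ D) {m : ℕ} (hm : X.encard + 2 * m = k)
    (hm0 : m ≠ 0) (hV : (k : ℕ∞) ≤ (Set.univ : Set V).encard)
    {Q Q' : Set (VSep V)} {n : ℕ} (hQ : U.IsProfile n Q) (hQ' : U.IsProfile n Q')
    (hQQ : Q ∩ U.sys k = Q' ∩ U.sys k) {s t : VSep V} (hs : s ∈ D) (ht : t ∈ D) (hst : s ≤ t)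
    (h1 : (arcSep P₀ s t ∈ Q ∧ (arcSep P₀ s t).inv ∈ Q') ∨
        ((arcSep P₀ s t).inv ∈ Q ∧ arcSep P₀ s t ∈ Q')) :
    s < t ∧ ¬(s = botSep X ∧ t = topSep X) := by
  have hX : X.encard ≠ ⊤ := by
    intro h'
    rw [h', top_add] at hm
    exact ENat.natCast_ne_top k hm.symm
  have hc : ∀ s ∈ D, (pt X P₀ s).encard = m := by
    obtain ⟨m', hm', hc⟩ := h.exists_card
    have : m = m' := by
      obtain ⟨x, hx⟩ := ENat.ne_top_iff_exists.1 hX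
      rw [← hx] at hm hm'
      norm_cast at hm hm'
      omega
    subst this
    exact fun s hs => (hc s).1 (h.card s hs)
  -- A distinguishing arc has order at least `k`. Degenerate arcs and the full turn have separators
  -- of size only `m + |X|`.
  have key : ¬ (arcSep P₀ s t).order < k := by
    intro ho
    refine absurd hV (not_le.2 ?_)
    rcases h1 with h1 | h1
    · exact not_mem_of_order_lt hQ hQ' hQQ ho h1.1 h1.2
    · refine not_mem_of_order_lt hQ hQ' hQQ ?_ h1.1 h1.2
      rwa [order_inv]
  have key2 : ∀ A : Set V, A.encard = m → (A ∪ X).encard < k := by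
    intro A hA
    refine (Set.encard_union_le _ _).trans_lt ?_
    rw [hA, ← hm]
    obtain ⟨x, hx⟩ := ENat.ne_top_iff_exists.1 hX
    rw [← hx]
    norm_cast
    omega
  constructor
  · refine hst.lt_of_ne fun e => key ?_
    subst e
    show (arcIn P₀ s s ∩ arcOut P₀ s s).encard < k
    rw [h.inter hs hs le_rfl, Set.union_self]
    exact key2 _ (hc s hs)
  · rintro ⟨rfl, rfl⟩
    refine key ?_
    show (arcIn P₀ _ _ ∩ arcOut P₀ _ _).encard < k
    rw [h.inter hs ht hst, h.pt_bot, h.pt_top, Set.union_self]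
    refine key2 _ ?_
    rw [← hc _ hs, h.pt_bot]

/-- A cut of a chain of cut points has a limit from below that may be added to the chain. -/
theorem exists_limit (h : LinSys U k X P₀ D) (hU : U.LimitClosed) {v₂ v₃ v₄ : VSep V}
    (hv : Spread X P₀ v₂ v₃ v₄) (h2 : v₂ ∈ D) (h3 : v₃ ∈ D) (h4 : v₄ ∈ D)
    (hQ : DistinguishesProfiles U k P₀ D) {L R : Set (VSep V)}
    (hLR : ∀ s ∈ D, s ∈ L ∨ s ∈ R) (hL : L ⊆ D) (hR : R ⊆ D) (hlt : ∀ l ∈ L, ∀ r ∈ R, l < r)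
    (hbot : botSep X ∈ L) (htop : topSep X ∈ R) :
    ∃ c : VSep V, LinSys U k X P₀ (insert c D) ∧ (∀ l ∈ L, l ≤ c) ∧ (∀ r ∈ R, c ≤ r) ∧
      c.right = ⋂ l ∈ L, l.right := by
  obtain ⟨c, hcL, hcR, hcr, hcand⟩ := h.exists_candidate hU hv h2 h3 h4 hLR hL hR hlt hbot htop
  refine ⟨c, ?_, hcL, hcR, hcr⟩
  by_cases hcD : c ∈ D
  · rwa [Set.insert_eq_of_mem hcD]
  have h' : IsCutChain X P₀ (insert c D) := by
    refine h.toIsCutChain.insert ((h.left _ h.bot_mem).trans (hcL _ hbot).1)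
      (hcr ▸ Set.subset_iInter₂ fun l hl => h.right l (hL hl)) ?_ fun s hs =>
        (hLR s hs).imp (hcL s) (hcR s)
    refine Set.eq_univ_of_forall fun x => ?_
    by_cases hx : x ∈ c.right
    · exact Or.inl (Or.inr hx)
    rw [hcr] at hx
    simp only [Set.mem_iInter, not_forall] at hx
    obtain ⟨l, hl, hxl⟩ := hx
    have : x ∈ l.left ∪ l.right ∪ P₀ := h.cover l (hL hl) ▸ Set.mem_univ x
    rcases this with (hx | hx) | hx
    · exact Or.inl (Or.inl ((hcL l hl).1 hx))
    · exact absurd hx hxl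
    · exact Or.inr hx
  obtain ⟨n2, n3, n4⟩ := hv.ne_top
  obtain ⟨b2, b3, b4⟩ := hv.ne_bot
  have hbt : botSep X ≠ topSep X := fun e =>
    b3 ((h.le_top h3).trans (e ▸ le_rfl) |>.antisymm (h.bot_le h3))
  have hct : c ≠ topSep X := fun e => hcD (e ▸ h.top_mem)
  have hcb : c ≠ botSep X := fun e => hcD (e ▸ h.bot_mem)
  have hc2 : c ≠ v₂ := fun e => hcD (e ▸ h2)
  have hc3 : c ≠ v₃ := fun e => hcD (e ▸ h3)
  have hc4 : c ≠ v₄ := fun e => hcD (e ▸ h4)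
  let := h'.circ
  have hW := h'.cutSystem
  let G := ↥((insert c D) \ {topSep X})
  let cG : G := ⟨c, Or.inl rfl, hct⟩
  let bG : G := ⟨botSep X, Or.inr h.bot_mem, hbt⟩
  let g2 : G := ⟨v₂, Or.inr h2, n2⟩
  let g3 : G := ⟨v₃, Or.inr h3, n3⟩
  let g4 : G := ⟨v₄, Or.inr h4, n4⟩
  have lb2 : botSep X < v₂ := (h.bot_le h2).lt_of_ne b2.symm
  have lbc : botSep X < c := (h'.bot_le (Or.inl rfl)).lt_of_ne hcb.symm
  have hS : ∀ {a b : G}, (a : VSep V) < b →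
      (⟨arc P₀ (a : VSep V) b, arc P₀ (b : VSep V) a⟩ : VSep V) = arcSep P₀ a b := fun {a b} hab => by
    rw [arc_of_le _ hab.le, arc_of_lt _ hab]; rfl
  have hS' : ∀ {a b : G}, (a : VSep V) < b →
      (⟨arc P₀ (b : VSep V) a, arc P₀ (a : VSep V) b⟩ : VSep V) = (arcSep P₀ a b).inv :=
    fun {a b} hab => by rw [arc_of_le _ hab.le, arc_of_lt _ hab]; rfl
  have hmem : ∀ {a : G}, a ≠ cG → (a : VSep V) ∈ D := fun {a} ha =>
    a.2.1.resolve_left fun e => ha (Subtype.ext e)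
  have hlt' : ∀ {a b : G}, a ≠ b → (a : VSep V) < b ∨ (b : VSep V) < a := fun {a b} hab =>
    (h'.lt_or_le a.2.1 b.2.1).imp_right fun hle => hle.lt_of_ne fun e => hab (Subtype.ext e.symm)
  have hs0 : ∀ a b : G, a ≠ cG → b ≠ cG → a ≠ b →
      (⟨arc P₀ (a : VSep V) b, arc P₀ (b : VSep V) a⟩ : VSep V) ∈ U.seps := by
    intro a b ha hb hab
    rcases hlt' hab with hl | hl
    · rw [hS hl]
      exact h.sep _ (hmem ha) _ (hmem hb) hl fun e => b.2.2 e.2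
    · rw [hS' hl]
      exact U.inv_mem _ (h.sep _ (hmem hb) _ (hmem ha) hl fun e => a.2.2 e.2)
  obtain ⟨m, hm, hcard⟩ := h.exists_card
  have hPm : ∀ a : G, a ≠ cG → (pt X P₀ (a : VSep V)).encard = m := fun a ha =>
    (hcard a).1 (h.card a (hmem ha))
  have d0 : ∀ {s}, Disjoint P₀ (pt X P₀ s) → Disjoint (pt X P₀ (botSep X)) (pt X P₀ s) :=
    fun {s} hd => by rwa [h.pt_bot]
  -- The candidate is separated in `U` from its viewpoint with order at most `k`. Joins give its
  -- other arcs, and disjointness from the viewpoint gives the upper bound on its size.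
  have hboth : (∀ a b : G, a ≠ b →
      (⟨arc P₀ (a : VSep V) b, arc P₀ (b : VSep V) a⟩ : VSep V) ∈ U.seps) ∧
      (pt X P₀ c).encard ≤ m := by
    rcases hcand with ⟨h3R, hc1, hc2'⟩ | ⟨h3L, hc1, hc2'⟩
    · have lc3 : c < v₃ := (hcR _ h3R).lt_of_ne hc3
      have lc4 := lc3.trans hv.lt34
      have e := hS' (a := cG) (b := g4) lc4
      have s1 : sbtw cG g3 g4 := h'.sbtw_iff.2 (Or.inl ⟨lc3, hv.lt34⟩)
      have s2 : sbtw g4 bG cG := h'.sbtw_iff.2 (Or.inr (Or.inl ⟨lbc, lc4⟩))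
      refine ⟨hW.sep_of_sep_one hs0 (by rw [e]; exact hc1) s1 s2 hv.d34.symm
        (d0 hv.d04).symm, ?_⟩
      exact hW.encard_le_of_order_le (c := cG) (u₀ := g4) (k := k)
        (fun e => hc4 (congrArg Subtype.val e).symm) hm
        (hPm _ fun e => hc4 (congrArg Subtype.val e).symm)
        (hW.disjoint_of_sbtw s2 s1 (d0 hv.d04).symm hv.d34.symm) (by rw [e]; exact hc2')
    · have lc3 : v₃ < c := (hcL _ h3L).lt_of_ne hc3.symm
      have lc2 := hv.lt23.trans lc3
      have e := hS (a := g2) (b := cG) lc2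
      have s1 : sbtw cG bG g2 := h'.sbtw_iff.2 (Or.inr (Or.inl ⟨lb2, lc2⟩))
      have s2 : sbtw g2 g3 cG := h'.sbtw_iff.2 (Or.inl ⟨hv.lt23, lc3⟩)
      refine ⟨hW.sep_of_sep_one hs0 (by rw [e]; exact hc1) s1 s2 (d0 hv.d02).symm hv.d23, ?_⟩
      exact hW.encard_le_of_order_le (c := cG) (u₀ := g2) (k := k)
        (fun e => hc2 (congrArg Subtype.val e).symm) hm
        (hPm _ fun e => hc2 (congrArg Subtype.val e).symm)
        (hW.disjoint_of_sbtw s2 s1 hv.d23 (d0 hv.d02).symm) (by rw [e]; exact hc2')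
  obtain ⟨hsep, hle⟩ := hboth
  have hge : (m : ℕ∞) ≤ (pt X P₀ c).encard := by
    -- For `m = 0` the bound is trivial; otherwise distinguishing arcs are proper and have two
    -- distinct ends in the circular order.
    rcases eq_or_ne m 0 with rfl | hm0
    · simp
    obtain ⟨Q, hQ1, hQ2, hQ3⟩ := hQ
    refine hW.le_encard_of_four hsep cG hm hPm Q hQ1 hQ2 ?_ (p₀ := bG) (p₁ := g2) (p₂ := g3)
      (p₃ := g4) (h'.sbtw_iff.2 (Or.inl ⟨lb2, hv.lt23⟩))
      (h'.sbtw_iff.2 (Or.inl ⟨lb2.trans hv.lt23, hv.lt34⟩)) ?_ ?_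
    · intro i j hij
      obtain ⟨s, hs, t, ht, hst, hQs⟩ := hQ3 i j hij
      obtain ⟨hst, hn⟩ := h.exists_proper_arc hm hm0 (h.le_encard_univ h2 h3 hv.d23) (hQ1 i)
        (hQ1 j) (hQ2 i j) hs ht hst hQs
      have fin : ∀ {s t}, s ∈ D → t ∈ D → s < t → t ≠ topSep X →
          ((arcSep P₀ s t ∈ Q i ∧ (arcSep P₀ s t).inv ∈ Q j) ∨
        ((arcSep P₀ s t).inv ∈ Q i ∧ arcSep P₀ s t ∈ Q j)) →
        ∃ a b : G, a ≠ cG ∧ b ≠ cG ∧ a ≠ b ∧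
          (⟨arc P₀ (a : VSep V) b, arc P₀ (b : VSep V) a⟩ : VSep V) ∈ Q i ∧
          (⟨arc P₀ (b : VSep V) a, arc P₀ (a : VSep V) b⟩ : VSep V) ∈ Q j := by
        intro s t hs ht hst htt hQs
        have hst' : s ≠ topSep X := fun e => (hst.trans_le (h.le_top ht)).ne e
        have e1 := hS (a := ⟨s, Or.inr hs, hst'⟩) (b := ⟨t, Or.inr ht, htt⟩) hst
        have e2 := hS' (a := ⟨s, Or.inr hs, hst'⟩) (b := ⟨t, Or.inr ht, htt⟩) hst
        rcases hQs with hQs | hQs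
        · refine ⟨⟨s, Or.inr hs, hst'⟩, ⟨t, Or.inr ht, htt⟩, ?_, ?_, ?_, e1 ▸ hQs.1,
            e2 ▸ hQs.2⟩
          · exact fun e => hcD (Eq.mp (congrArg (· ∈ D) (congrArg Subtype.val e)) hs)
          · exact fun e => hcD (Eq.mp (congrArg (· ∈ D) (congrArg Subtype.val e)) ht)
          · exact fun e => hst.ne (congrArg Subtype.val e)
        · refine ⟨⟨t, Or.inr ht, htt⟩, ⟨s, Or.inr hs, hst'⟩, ?_, ?_, ?_, e2 ▸ hQs.1,
            e1 ▸ hQs.2⟩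
          · exact fun e => hcD (Eq.mp (congrArg (· ∈ D) (congrArg Subtype.val e)) ht)
          · exact fun e => hcD (Eq.mp (congrArg (· ∈ D) (congrArg Subtype.val e)) hs)
          · exact fun e => hst.ne (congrArg Subtype.val e).symm
      -- An arc ending at the top is rewritten as the complement of an arc starting at the bottom,
      -- which represents the base point in `G`.
      by_cases htt : t = topSep X
      · subst htt
        have hsb : s ≠ botSep X := fun e => hn ⟨e, rfl⟩
        rw [h.arcSep_top hs, VSep.inv_inv] at hQs
        exact fin h.bot_mem hs ((h.bot_le hs).lt_of_ne hsb.symm) hst.ne hQs.symm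
      · exact fin hs ht hst htt hQs
    · have aux : ∀ {a b : G}, (a : VSep V) < b → Disjoint (pt X P₀ (a : VSep V)) (pt X P₀ b) →
          arcIn P₀ (a : VSep V) b ≠ Set.univ → arcOut P₀ (a : VSep V) b ≠ Set.univ →
          (Disjoint (pt X P₀ (a : VSep V)) (pt X P₀ b) ∧ arc P₀ (a : VSep V) b ≠ Set.univ) ∧
          (Disjoint (pt X P₀ (b : VSep V)) (pt X P₀ a) ∧ arc P₀ (b : VSep V) a ≠ Set.univ) := by
        intro a b hab hd hi ho
        rw [arc_of_le _ hab.le, arc_of_lt _ hab]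
        exact ⟨⟨hd, hi⟩, hd.symm, ho⟩
      have x12 := aux (a := bG) (b := g2) lb2 (d0 hv.d02)
        (by rw [IsCutChain.arcIn_bot]; exact hv.l2)
        (by rw [IsCutChain.arcOut_bot (h.right _ h2)]; exact hv.r2)
      have x13 := aux (a := bG) (b := g3) (lb2.trans hv.lt23) (d0 hv.d03)
        (by rw [IsCutChain.arcIn_bot]; exact hv.l3)
        (by rw [IsCutChain.arcOut_bot (h.right _ h3)]; exact hv.r3)
      have x14 := aux (a := bG) (b := g4) ((lb2.trans hv.lt23).trans hv.lt34) (d0 hv.d04)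
        (by rw [IsCutChain.arcIn_bot]; exact hv.l4)
        (by rw [IsCutChain.arcOut_bot (h.right _ h4)]; exact hv.r4)
      have x23 := aux (a := g2) (b := g3) hv.lt23 hv.d23 hv.i23 hv.o23
      have x24 := aux (a := g2) (b := g4) (hv.lt23.trans hv.lt34) hv.d24 hv.i24 hv.o24
      have x34 := aux (a := g3) (b := g4) hv.lt34 hv.d34 hv.i34 hv.o34
      rintro a (rfl | rfl | rfl | rfl) b (rfl | rfl | rfl | rfl) hab
      exacts [absurd rfl hab, x12.1, x13.1, x14.1, x12.2, absurd rfl hab, x23.1, x24.1, x13.2,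
        x23.2, absurd rfl hab, x34.1, x14.2, x24.2, x34.2, absurd rfl hab]
    · rintro (e | e | e | e) <;> have e := congrArg Subtype.val e
      exacts [hcb e, hc2 e, hc3 e, hc4 e]
  have hcm := le_antisymm hle hge
  refine { h' with card := ?_, sep := ?_ }
  · rintro s (rfl | hs)
    · exact (hcard _).2 hcm
    · exact h.card s hs
  · intro s hs t ht hst hn
    by_cases htt : t = topSep X
    · subst htt
      rw [h'.arcSep_top hs]
      refine U.inv_mem _ ?_
      have hsb : botSep X < s := (h'.bot_le hs).lt_of_ne fun e => hn ⟨e.symm, rfl⟩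
      rw [← hS (a := bG) (b := ⟨s, hs, hst.ne⟩) hsb]
      exact hsep _ _ fun e => hsb.ne (congrArg Subtype.val e)
    · have hst' : s ≠ topSep X := fun e => (hst.trans_le (h'.le_top ht)).ne e
      rw [← hS (a := ⟨s, hs, hst'⟩) (b := ⟨t, ht, htt⟩) hst]
      exact hsep _ _ fun e => hst.ne (congrArg Subtype.val e)

/-- A cut of a chain of cut points has a limit from above that may be added to the chain. -/
theorem exists_limit_above (h : LinSys U k X P₀ D) (hU : U.LimitClosed) {v₂ v₃ v₄ : VSep V}
    (hv : Spread X P₀ v₂ v₃ v₄) (h2 : v₂ ∈ D) (h3 : v₃ ∈ D) (h4 : v₄ ∈ D)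
    (hQ : DistinguishesProfiles U k P₀ D) {L R : Set (VSep V)}
    (hLR : ∀ s ∈ D, s ∈ L ∨ s ∈ R) (hL : L ⊆ D) (hR : R ⊆ D) (hlt : ∀ l ∈ L, ∀ r ∈ R, l < r)
    (hbot : botSep X ∈ L) (htop : topSep X ∈ R) :
    ∃ c : VSep V, LinSys U k X P₀ (insert c D) ∧ (∀ l ∈ L, l ≤ c) ∧ (∀ r ∈ R, c ≤ r) ∧
      c.left = ⋂ r ∈ R, r.left := by
  -- Mirroring the chain turns this into a limit from below.
  obtain ⟨c, h1, h2, h3, h4⟩ := h.inv.exists_limit hU hv.inv h4 h3 h2 hQ.inv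
    (L := VSep.inv ⁻¹' R) (R := VSep.inv ⁻¹' L) (fun s hs => (hLR _ hs).symm)
    (Set.preimage_mono hR) (Set.preimage_mono hL) (fun l hl r hr => inv_lt_inv (hlt _ hr _ hl))
    htop hbot
  refine ⟨c.inv, ?_, fun l hl => inv_le_inv (h3 l.inv hl), fun r hr => inv_le_inv (h2 r.inv hr), ?_⟩
  · have e : insert c.inv D = VSep.inv ⁻¹' (insert c (VSep.inv ⁻¹' D)) := by
      ext s
      simp only [Set.mem_insert_iff, Set.mem_preimage, VSep.inv_inv]
      refine or_congr_left ⟨?_, ?_⟩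
      · rintro rfl; rfl
      · rintro rfl; rfl
    rw [e]
    exact h1.inv
  · show c.right = _
    rw [h4]
    ext x
    simp only [Set.mem_iInter, Set.mem_preimage]
    exact ⟨fun hx r hr => hx r.inv hr, fun hx r hr => hx r.inv hr⟩

end LinSys

/-! ### Completions of linear orders -/

/-- The linear analogue of a cycle completion: the lower sets of `I` correspond to the elements
outside `I`. -/
structure IsLineCompletion {L : Type u} [LinearOrder L] [BoundedOrder L] (I : Set L) : Prop where
  bot_notMem : ⊥ ∉ I
  top_notMem : ⊤ ∉ I
  exists_cut : ∀ J ⊆ I, (∀ j ∈ J, ∀ i ∈ I, i < j → i ∈ J) → ∃ s ∉ I, ∀ x ∈ I, x ∈ J ↔ x < s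
  exists_between : ∀ v ∉ I, ∀ w ∉ I, v < w → ∃ i ∈ I, v < i ∧ i < w

namespace IsLineCompletion

variable {L : Type u} [LinearOrder L] [BoundedOrder L] {I : Set L}

/-- The neighbours of `i` are the cuts belonging to `{x < i}` and `{x ≤ i}`. Another element between
them would produce a member of `I` on the wrong side of one of these cuts. -/
theorem exists_petal (h : IsLineCompletion I) {i : L} (hi : i ∈ I) :
    ∃ p ∉ I, ∃ s ∉ I, p < i ∧ i < s ∧ ∀ x, p < x → x < s → x = i := by
  obtain ⟨p, hp, hp'⟩ := h.exists_cut {x ∈ I | x < i} (fun x hx => hx.1)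
    fun j hj x hx hxj => ⟨hx, hxj.trans hj.2⟩
  obtain ⟨s, hs, hs'⟩ := h.exists_cut {x ∈ I | x ≤ i} (fun x hx => hx.1)
    fun j hj x hx hxj => ⟨hx, hxj.le.trans hj.2⟩
  have h1 : p < i := lt_of_le_of_ne (not_lt.1 fun h' => lt_irrefl i ((hp' i hi).2 h').2)
    fun e => hp (e ▸ hi)
  have h2 : i < s := (hs' i hi).1 ⟨hi, le_rfl⟩
  refine ⟨p, hp, s, hs, h1, h2, fun x hpx hxs => ?_⟩
  by_cases hx : x ∈ I
  · have h3 := ((hs' x hx).2 hxs).2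
    exact h3.antisymm (not_lt.1 fun h' => hpx.not_gt ((hp' x hx).1 ⟨hx, h'⟩))
  · rcases lt_trichotomy x i with hxi | hxi | hxi
    · obtain ⟨j, hj, h3, h4⟩ := h.exists_between p hp x hx hpx
      exact absurd ((hp' j hj).1 ⟨hj, h4.trans hxi⟩) h3.not_gt
    · exact hxi
    · obtain ⟨j, hj, h3, h4⟩ := h.exists_between x hx s hs hxs
      exact absurd ((hs' j hj).2 h4).2 (hxi.trans h3).not_ge

theorem exists_cut_between (h : IsLineCompletion I) {x y : L} (hxy : x < y) :
    ∃ v ∉ I, x ≤ v ∧ v ≤ y := by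
  by_cases hx : x ∈ I
  · obtain ⟨p, hp, s, hs, h1, h2, h3⟩ := h.exists_petal hx
    refine ⟨s, hs, h2.le, not_lt.1 fun h' => hxy.ne' (h3 y (h1.trans hxy) h')⟩
  · exact ⟨x, hx, le_rfl, hxy.le⟩

theorem exists_petal_of_covBy (h : IsLineCompletion I) {p s : {x // x ∉ I}} (hps : p ⋖ s) :
    ∃ i ∈ I, (p : L) < i ∧ i < s ∧ ∀ x, (p : L) < x → x < s → x = i := by
  obtain ⟨i, hi, h1, h2⟩ := h.exists_between p p.2 s s.2 hps.1
  obtain ⟨p', hp', s', hs', h3, h4, h5⟩ := h.exists_petal hi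
  have e1 : (p : L) = p' := by
    refine le_antisymm (not_lt.1 fun h' => ?_) (not_lt.1 fun h' => ?_)
    · exact p.2 (h5 p h' (h1.trans h4) ▸ hi)
    · exact hps.2 (c := ⟨p', hp'⟩) h' (h3.trans h2)
  have e2 : (s : L) = s' := by
    refine le_antisymm (not_lt.1 fun h' => ?_) (not_lt.1 fun h' => ?_)
    · exact hps.2 (c := ⟨s', hs'⟩) (h1.trans h4) h'
    · exact s.2 (h5 s (h3.trans h2) h' ▸ hi)
  exact ⟨i, hi, h1, h2, fun x hx hx' => h5 x (e1 ▸ hx) (e2 ▸ hx')⟩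

theorem exists_covBy (h : IsLineCompletion I) {i : L} (hi : i ∈ I) :
    ∃ p s : {x // x ∉ I}, p ⋖ s ∧ (p : L) < i ∧ i < s ∧ ∀ x, (p : L) < x → x < s → x = i := by
  obtain ⟨p, hp, s, hs, h1, h2, h3⟩ := h.exists_petal hi
  exact ⟨⟨p, hp⟩, ⟨s, hs⟩, ⟨h1.trans h2, fun c hc hc' => c.2 (h3 c hc hc' ▸ hi)⟩, h1, h2, h3⟩

/-- The supremum is the cut above the members of `I` that lie below some element of `S`. -/
theorem exists_isLUB (h : IsLineCompletion I) (S : Set {x // x ∉ I}) : ∃ a, IsLUB S a := by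
  obtain ⟨s, hs, hs'⟩ := h.exists_cut {x ∈ I | ∃ v ∈ S, x < v} (fun x hx => hx.1)
    fun j ⟨_, v, hv, hjv⟩ x hx hxj => ⟨hx, v, hv, hxj.trans hjv⟩
  refine ⟨⟨s, hs⟩, fun v hv => not_lt.1 fun h' => ?_, fun u hu => not_lt.1 fun h' => ?_⟩
  · obtain ⟨i, hi, h1, h2⟩ := h.exists_between s hs v v.2 h'
    exact h1.not_gt ((hs' i hi).1 ⟨hi, v, hv, h2⟩)
  · obtain ⟨i, hi, h1, h2⟩ := h.exists_between u u.2 s hs h'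
    obtain ⟨-, v, hv, hiv⟩ := (hs' i hi).2 h2
    exact (h1.trans hiv).not_ge (hu hv)

theorem exists_covBy_between (h : IsLineCompletion I) {a b : {x // x ∉ I}} (hab : a < b) :
    ∃ p s, a ≤ p ∧ p ⋖ s ∧ s ≤ b := by
  obtain ⟨i, hi, h1, h2⟩ := h.exists_between a a.2 b b.2 hab
  obtain ⟨p, s, hps, h3, h4, h5⟩ := h.exists_covBy hi
  refine ⟨p, s, not_lt.1 fun h' => ?_, hps, not_lt.1 fun h' => ?_⟩
  · exact a.2 (h5 a h' (h1.trans h4) ▸ hi)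
  · exact b.2 (h5 b (h3.trans h2) h' ▸ hi)

end IsLineCompletion

/-! ### Pseudoflowers on a line -/

/-- The vertices of a closed interval of a line. -/
def lineIn {V L : Type u} [LinearOrder L] (X : Set V) (P : L → Set V) (v w : L) : Set V :=
  {x | x ∈ X ∨ ∃ z, v ≤ z ∧ z ≤ w ∧ x ∈ P z}

/-- The vertices of the complement of an open interval of a line. -/
def lineOut {V L : Type u} [LinearOrder L] (X : Set V) (P : L → Set V) (v w : L) : Set V :=
  {x | x ∈ X ∨ ∃ z, (z ≤ v ∨ w ≤ z) ∧ x ∈ P z}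

/-- A pseudoflower that is cut open at a base point, which becomes both ends of a line. -/
structure LinFlower {V L : Type u} [LinearOrder L] [BoundedOrder L] (U : SepUniverse V) (k : ℕ)
    (X : Set V) (I : Set L) (P : L → Set V) : Prop extends IsLineCompletion I where
  nontrivial : I.Nontrivial
  top_eq : P ⊤ = P ⊥
  mem_X : ∀ x, x ∈ X ↔ ∀ z, x ∉ P z
  card : ∀ v ∉ I, 2 * (P v).encard + X.encard = k
  sep : ∀ v ∉ I, ∀ w ∉ I, v < w → ¬(v = ⊥ ∧ w = ⊤) →
    (⟨lineIn X P v w, lineOut X P v w⟩ : VSep V) ∈ U.seps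
  inter : ∀ v ∉ I, ∀ w ∉ I, v < w → ¬(v = ⊥ ∧ w = ⊤) →
    lineIn X P v w ∩ lineOut X P v w = P v ∪ P w ∪ X
  neighbor : ∀ i ∈ I, ∀ c, c ⋖ i ∨ i ⋖ c → P c ⊆ P i
  star : ∀ i ∈ I, ∀ j ∈ I, 2 * (P i).encard + X.encard = k → P i = P j → i = j

/-! ### Cutting a pseudoflower open at a cut point -/

/-- A circular order cut open at `b`, which becomes both ends of a linear order. -/
def Line {C : Type u} (_ : C) : Type u := WithTop C

namespace Line

variable {C : Type u} {b : C}

/-- An element of a circular order as an element of the line. -/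
def of (b c : C) : Line b := (c : WithTop C)

instance : Top (Line b) := ⟨(⊤ : WithTop C)⟩

instance : Bot (Line b) := ⟨of b b⟩

theorem of_self : of b b = ⊥ := rfl

theorem eq_top_or (x : Line b) : x = ⊤ ∨ ∃ c, x = of b c := by
  induction x using WithTop.recTopCoe with
  | top => exact Or.inl rfl
  | coe c => exact Or.inr ⟨c, rfl⟩

theorem of_injective : Function.Injective (of b : C → Line b) := fun _ _ h => WithTop.coe_injective h

theorem of_ne_top (c : C) : of b c ≠ ⊤ := WithTop.coe_ne_top

/-- A family of sets indexed by a circular order, on the line. -/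
noncomputable def family {V : Type u} (b : C) (P : C → Set V) : Line b → Set V := fun x =>
  WithTop.recTopCoe (C := fun _ => Set V) (P b) P x

/-- The set of elements of the line that come from a set `I`. -/
def image (b : C) (I : Set C) : Set (Line b) := of b '' I

theorem of_mem_image {I : Set C} {c : C} : of b c ∈ image b I ↔ c ∈ I :=
  of_injective.mem_set_image

theorem top_notMem_image {I : Set C} : ⊤ ∉ image b I := by
  rintro ⟨c, -, h⟩
  exact of_ne_top c h

variable [CircularOrder C]

noncomputable instance : LinearOrder (Line b) :=
  let _ := baseOrder b
  inferInstanceAs (LinearOrder (WithTop C))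

noncomputable instance : BoundedOrder (Line b) where
  le_top x := by
    let := baseOrder b
    exact @le_top (WithTop C) _ _ (x : WithTop C)
  bot_le x := by
    let := baseOrder b
    show ((b : WithTop C)) ≤ (x : WithTop C)
    induction x using WithTop.recTopCoe with
    | top => exact le_top
    | coe c => exact WithTop.coe_le_coe.2 (Or.inl rfl)

theorem of_lt_top (c : C) : of b c < ⊤ := lt_top_iff_ne_top.2 (of_ne_top c)

theorem of_lt_of {x y : C} : of b x < of b y ↔ x ≠ y ∧ (x = b ∨ sbtw b x y) := by
  rw [← baseOrder_lt_iff]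
  let := baseOrder b
  exact WithTop.coe_lt_coe

theorem sbtw_iff {x y z : C} : sbtw x y z ↔ (of b x < of b y ∧ of b y < of b z) ∨
    (of b y < of b z ∧ of b z < of b x) ∨ (of b z < of b x ∧ of b x < of b y) := by
  rw [sbtw_iff_baseOrder b]
  simp only [of_lt_of, ← baseOrder_lt_iff]

theorem mem_closedArc_of_le {v w c : C} (h : of b v ≤ of b w) :
    c ∈ closedArc v w ↔ of b v ≤ of b c ∧ of b c ≤ of b w := by
  rw [mem_closedArc, sbtw_iff (b := b), ← of_injective.eq_iff (f := of b),
    ← of_injective.eq_iff (f := of b) (b := w)]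
  grind

theorem mem_closedArc_of_lt {v w c : C} (h : of b v < of b w) :
    c ∈ closedArc w v ↔ of b c ≤ of b v ∨ of b w ≤ of b c := by
  rw [mem_closedArc, sbtw_iff (b := b), ← of_injective.eq_iff (f := of b),
    ← of_injective.eq_iff (f := of b) (b := v)]
  grind

/-- A proper lower set of `I` is an initial arc. -/
theorem exists_cut_of_isCycleCompletion {I : Set C} (hI : IsCycleCompletion I) (hb : b ∉ I)
    {J : Set C} (hJ : J ⊆ I) (hlow : ∀ j ∈ J, ∀ i ∈ I, of b i < of b j → i ∈ J)
    (hne : J.Nonempty) (hJI : J ≠ I) :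
    ∃ s ∉ I, (∀ x ∈ I, x ∈ J ↔ of b x < of b s) ∧
      ∀ v ∉ I, ∀ w ∉ I, closedArc v w ∩ I = J → v = b ∧ w = s := by
  have hint : IsIntervalOf I J := by
    refine ⟨hJ, fun s hs t ht => ?_⟩
    have key : ∀ {s t}, s ∈ J → t ∈ J → of b s ≤ of b t → closedArc s t ∩ I ⊆ J := by
      rintro s t hs ht hst x ⟨hx, hxI⟩
      rw [mem_closedArc_of_le hst] at hx
      rcases hx.2.eq_or_lt with e | hlt
      · exact of_injective e ▸ ht
      · exact hlow t ht x hxI hlt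
    exact (le_total (of b s) (of b t)).imp (key hs ht) (key ht hs)
  obtain ⟨⟨p, s⟩, ⟨hp, hs, hps⟩, huniq⟩ := hI J hint hne hJI
  have hmem : ∀ x, x ∈ J ↔ x ∈ closedArc p s ∧ x ∈ I := fun x => by rw [← hps]; rfl
  have hcut : ∀ x ∈ I, x ∈ J ↔ of b x < of b s := by
    have hns : ∀ x ∈ I, of b x ≠ of b s := fun x hx e => hs (of_injective e ▸ hx)
    obtain ⟨j, hj⟩ := hne
    rcases le_or_gt (of b p) (of b s) with hle | hlt
    · simp only [mem_closedArc_of_le hle] at hmem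
      grind
    · simp only [mem_closedArc_of_lt hlt] at hmem
      have : ∃ i ∈ I, i ∉ J := by
        by_contra! hcon
        exact hJI (hJ.antisymm hcon)
      grind
  have hbs : closedArc b s ∩ I = J := by
    ext x
    have hbot : of b b ≤ of b s := bot_le
    rw [Set.mem_inter_iff, mem_closedArc_of_le hbot]
    refine ⟨fun h => (hcut x h.2).2 (h.1.2.lt_of_ne fun e => hs (of_injective e ▸ h.2)), fun h => ?_⟩
    exact ⟨⟨bot_le, ((hcut x (hJ h)).1 h).le⟩, hJ h⟩
  -- The arc representing `J` may a priori start elsewhere. Since `[b, s]` represents `J` too,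
  -- uniqueness says that it starts at `b`.
  have e1 := huniq (b, s) ⟨hb, hs, hbs⟩
  refine ⟨s, hs, hcut, fun v hv w hw hvw => ?_⟩
  have e2 := huniq (v, w) ⟨hv, hw, hvw⟩
  rw [← e1] at e2
  exact ⟨congrArg Prod.fst e2, congrArg Prod.snd e2⟩

/-- Existence of end points gives the cuts, and uniqueness puts a member of `I` between two cuts, as
otherwise both would bound the same interval. Empty and full lower sets are cut off by the two
copies of `b`. -/
theorem isLineCompletion {I : Set C} (hI : IsCycleCompletion I) (hb : b ∉ I)
    (hnt : I.Nontrivial) : IsLineCompletion (image b I) where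
  bot_notMem := fun h => hb (of_mem_image.1 h)
  top_notMem := top_notMem_image
  exists_cut J hJ hlow := by
    rcases J.eq_empty_or_nonempty with rfl | hne
    · exact ⟨⊥, fun h => hb (of_mem_image.1 h), fun x _ => ⟨fun h => h.elim, fun h => (not_lt_bot h).elim⟩⟩
    by_cases hJI : J = image b I
    · refine ⟨⊤, top_notMem_image, fun x hx => ?_⟩
      refine ⟨fun _ => ?_, fun _ => hJI ▸ hx⟩
      obtain ⟨c, -, rfl⟩ := hx
      exact of_lt_top c
    obtain ⟨s, hs, hcut, -⟩ := exists_cut_of_isCycleCompletion hI hb (J := of b ⁻¹' J)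
      (fun x hx => of_mem_image.1 (hJ hx))
      (fun j hj i hi hij => hlow _ hj _ (of_mem_image.2 hi) hij)
      (by
        obtain ⟨j, hj⟩ := hne
        obtain ⟨c, -, rfl⟩ := hJ hj
        exact ⟨c, hj⟩)
      (by
        intro e
        refine hJI (hJ.antisymm ?_)
        rintro _ ⟨c, hc, rfl⟩
        rw [← e] at hc
        exact hc)
    refine ⟨of b s, fun h => hs (of_mem_image.1 h), ?_⟩
    rintro _ ⟨c, hc, rfl⟩
    exact hcut c hc
  exists_between := by
    obtain ⟨i, hi, j, hj, hij⟩ : ∃ i ∈ I, ∃ j ∈ I, of b i < of b j := by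
      obtain ⟨i, hi, j, hj, hne⟩ := hnt
      rcases lt_or_gt_of_ne (of_injective.ne hne : of b i ≠ of b j) with h | h
      exacts [⟨i, hi, j, hj, h⟩, ⟨j, hj, i, hi, h⟩]
    -- A reference cut with members of `I` on both sides. If no member of `I` lay beyond `v`, or
    -- none before it, then `[v, s]` and `[b, s]` would meet `I` in the same interval and `v` would
    -- be `b`.
    obtain ⟨s, hs, hcut, huniq⟩ := exists_cut_of_isCycleCompletion hI hb
      (J := {x ∈ I | of b x ≤ of b i}) (fun x hx => hx.1)
      (fun y hy x hx hxy => ⟨hx, hxy.le.trans hy.2⟩) ⟨i, hi, le_rfl⟩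
      (fun e => ((Set.ext_iff.1 e j).2 hj).2.not_gt hij)
    have hneI : ∀ {x v}, x ∈ I → v ∉ I → of b x ≠ of b v := fun hx hv e => hv (of_injective e ▸ hx)
    have his : of b i < of b s := (hcut i hi).1 ⟨hi, le_rfl⟩
    have hsj : of b s < of b j := lt_of_le_of_ne
      (not_lt.1 fun h => ((hcut j hj).2 h).2.not_gt hij) (hneI hj hs).symm
    have key1 : ∀ v ∉ I, v ≠ b → ∃ x ∈ I, of b v < of b x := by
      intro v hv hvb
      by_contra! hcon
      refine hvb (huniq v hv s hs ?_).1
      ext x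
      have hsv : of b s < of b v := hsj.trans_le (hcon j hj)
      rw [Set.mem_inter_iff, mem_closedArc_of_lt hsv, Set.mem_ofPred_eq]
      constructor
      · rintro ⟨h | h, hx⟩
        · exact (hcut x hx).2 (h.lt_of_ne (hneI hx hs))
        · exact absurd (h.antisymm (hcon x hx)) (hneI hx hv).symm
      · exact fun h => ⟨Or.inl ((hcut x h.1).1 h).le, h.1⟩
    have key2 : ∀ v ∉ I, v ≠ b → ∃ x ∈ I, of b x < of b v := by
      intro v hv hvb
      by_contra! hcon
      refine hvb (huniq v hv s hs ?_).1
      ext x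
      have hsv : of b v ≤ of b s := (hcon i hi).trans his.le
      rw [Set.mem_inter_iff, mem_closedArc_of_le hsv, Set.mem_ofPred_eq]
      constructor
      · rintro ⟨h, hx⟩
        exact (hcut x hx).2 (h.2.lt_of_ne (hneI hx hs))
      · exact fun h => ⟨⟨hcon x h.1, ((hcut x h.1).1 h).le⟩, h.1⟩
    intro v hv w hw hvw
    obtain ⟨v, rfl⟩ : ∃ c, v = of b c := (eq_top_or v).resolve_left fun e => by
      subst e; exact not_top_lt hvw
    rw [of_mem_image] at hv
    suffices ∃ x ∈ I, of b v < of b x ∧ of b x < w by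
      obtain ⟨x, hx, h⟩ := this
      exact ⟨_, of_mem_image.2 hx, h⟩
    rcases eq_top_or w with rfl | ⟨w, rfl⟩
    · rcases eq_or_ne v b with rfl | hvb
      · exact ⟨i, hi, lt_of_le_of_ne bot_le (hneI hi hv).symm, of_lt_top i⟩
      · obtain ⟨x, hx, h⟩ := key1 v hv hvb
        exact ⟨x, hx, h, of_lt_top x⟩
    · rw [of_mem_image] at hw
      have hwb : w ≠ b := by rintro rfl; exact not_lt_bot hvw
      obtain ⟨x, hx, hxw⟩ := key2 w hw hwb
      rcases eq_or_ne v b with rfl | hvb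
      · exact ⟨x, hx, lt_of_le_of_ne bot_le (hneI hx hv).symm, hxw⟩
      by_contra! hcon
      have hsame : ∀ y ∈ I, of b y < of b w → of b y < of b v := fun y hy h =>
        lt_of_le_of_ne (not_lt.1 fun h' => (hcon y hy h').not_gt h) (hneI hy hv)
      obtain ⟨y, hy, hvy⟩ := key1 v hv hvb
      obtain ⟨t, ht, hcut', huniq'⟩ := exists_cut_of_isCycleCompletion hI hb
        (J := {y ∈ I | of b y < of b v}) (fun x hx => hx.1)
        (fun y hy x hx hxy => ⟨hx, hxy.trans hy.2⟩) ⟨x, hx, hsame x hx hxw⟩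
        (fun e => ((Set.ext_iff.1 e y).2 hy).2.not_gt hvy)
      -- A cut with the same members of `I` below it bounds the same initial interval, so it equals
      -- `t`; this applies to `v` and to `w`.
      have hrep : ∀ u ∉ I, (∀ y ∈ I, of b y < of b u ↔ of b y < of b v) → u = t := by
        intro u hu hu'
        refine (huniq' b hb u hu ?_).2
        ext y
        have hbot : of b b ≤ of b u := bot_le
        rw [Set.mem_inter_iff, mem_closedArc_of_le hbot, Set.mem_ofPred_eq]
        constructor
        · exact fun h => ⟨h.2, (hu' y h.2).1 (h.1.2.lt_of_ne (hneI h.2 hu))⟩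
        · exact fun h => ⟨⟨bot_le, ((hu' y h.1).2 h.2).le⟩, h.1⟩
      have e1 := hrep v hv fun _ _ => Iff.rfl
      have e2 := hrep w hw fun y hy => ⟨hsame y hy, fun h => h.trans hvw⟩
      exact hvw.ne (by rw [e1, e2])

end Line

namespace Pseudoflower

variable {V : Type u} {U : SepUniverse V} {k : ℕ} (Φ : Pseudoflower U k) {b : Φ.C}

theorem mem_X_iff {x : V} : x ∈ Φ.X ↔ ∀ z, x ∉ Φ.P z := by
  simp only [CyclicFamily.X, Set.mem_compl_iff, Set.mem_iUnion, not_exists]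

theorem mem_intervalSet {v w : Φ.C} {x : V} :
    x ∈ Φ.intervalSet v w ↔ x ∈ Φ.X ∨ ∃ z ∈ closedArc v w, x ∈ Φ.P z := by
  simp only [CyclicFamily.intervalSet, Set.mem_union, Set.mem_iUnion, exists_prop]
  exact or_comm

theorem intervalSet_of_le {v w : Φ.C} (h : Line.of b v ≤ Line.of b w) :
    Φ.intervalSet v w = lineIn Φ.X (Line.family b Φ.P) (Line.of b v) (Line.of b w) := by
  ext x
  rw [mem_intervalSet]
  refine or_congr_right ⟨?_, ?_⟩
  · rintro ⟨z, hz, hx⟩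
    rw [Line.mem_closedArc_of_le h] at hz
    exact ⟨_, hz.1, hz.2, hx⟩
  · rintro ⟨z, h1, h2, hx⟩
    rcases Line.eq_top_or z with rfl | ⟨c, rfl⟩
    · exact absurd h2 (Line.of_lt_top w).not_ge
    · exact ⟨c, (Line.mem_closedArc_of_le h).2 ⟨h1, h2⟩, hx⟩

theorem intervalSet_of_lt {v w : Φ.C} (h : Line.of b v < Line.of b w) :
    Φ.intervalSet w v = lineOut Φ.X (Line.family b Φ.P) (Line.of b v) (Line.of b w) := by
  ext x
  rw [mem_intervalSet]
  refine or_congr_right ⟨?_, ?_⟩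
  · rintro ⟨z, hz, hx⟩
    rw [Line.mem_closedArc_of_lt h] at hz
    exact ⟨_, hz, hx⟩
  · rintro ⟨z, h1, hx⟩
    rcases Line.eq_top_or z with rfl | ⟨c, rfl⟩
    · exact ⟨b, (Line.mem_closedArc_of_lt h).2 (Or.inl bot_le), hx⟩
    · exact ⟨c, (Line.mem_closedArc_of_lt h).2 h1, hx⟩

theorem intervalSet_base_right {v : Φ.C} (h : v ≠ b) :
    Φ.intervalSet v b = lineIn Φ.X (Line.family b Φ.P) (Line.of b v) ⊤ := by
  have h' : Line.of b b < Line.of b v := bot_lt_iff_ne_bot.2 (Line.of_injective.ne h)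
  ext x
  rw [mem_intervalSet]
  refine or_congr_right ⟨?_, ?_⟩
  · rintro ⟨z, hz, hx⟩
    rw [Line.mem_closedArc_of_lt h'] at hz
    rcases hz with hz | hz
    · refine ⟨⊤, le_top, le_rfl, ?_⟩
      rwa [Line.of_injective (hz.antisymm bot_le)] at hx
    · exact ⟨_, hz, le_top, hx⟩
  · rintro ⟨z, h1, h2, hx⟩
    rcases Line.eq_top_or z with rfl | ⟨c, rfl⟩
    · exact ⟨b, (Line.mem_closedArc_of_lt h').2 (Or.inl le_rfl), hx⟩
    · exact ⟨c, (Line.mem_closedArc_of_lt h').2 (Or.inr h1), hx⟩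

theorem intervalSet_base_left (v : Φ.C) :
    Φ.intervalSet b v = lineOut Φ.X (Line.family b Φ.P) (Line.of b v) ⊤ := by
  have h' : Line.of b b ≤ Line.of b v := bot_le
  ext x
  rw [mem_intervalSet]
  refine or_congr_right ⟨?_, ?_⟩
  · rintro ⟨z, hz, hx⟩
    rw [Line.mem_closedArc_of_le h'] at hz
    exact ⟨_, Or.inl hz.2, hx⟩
  · rintro ⟨z, h1, hx⟩
    rcases Line.eq_top_or z with rfl | ⟨c, rfl⟩
    · exact ⟨b, (Line.mem_closedArc_of_le h').2 ⟨le_rfl, bot_le⟩, hx⟩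
    · refine ⟨c, (Line.mem_closedArc_of_le h').2 ⟨bot_le, h1.resolve_right ?_⟩, hx⟩
      exact (Line.of_lt_top c).not_ge

theorem linFlower (hb : b ∉ Φ.I) :
    LinFlower U k Φ.X (Line.image b Φ.I) (Line.family b Φ.P) := by
  -- Each pair of cuts of the line other than the two ends is a pair of distinct cut points of the
  -- cycle, with the top read as `b`.
  have hsep : ∀ v ∉ Line.image b Φ.I, ∀ w ∉ Line.image b Φ.I, v < w → ¬(v = ⊥ ∧ w = ⊤) →
      ∃ v' ∉ Φ.I, ∃ w' ∉ Φ.I, v' ≠ w' ∧ Φ.P v' = Line.family b Φ.P v ∧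
        Φ.P w' = Line.family b Φ.P w ∧ lineIn Φ.X (Line.family b Φ.P) v w = Φ.intervalSet v' w' ∧
        lineOut Φ.X (Line.family b Φ.P) v w = Φ.intervalSet w' v' := by
    intro v hv w hw hvw hn
    obtain ⟨v, rfl⟩ : ∃ c, v = Line.of b c := (Line.eq_top_or v).resolve_left fun e => by
      subst e; exact not_top_lt hvw
    rw [Line.of_mem_image] at hv
    rcases Line.eq_top_or w with rfl | ⟨w, rfl⟩
    · have hvb : v ≠ b := by
        rintro rfl
        exact hn ⟨rfl, rfl⟩
      exact ⟨v, hv, b, hb, hvb, rfl, rfl, (Φ.intervalSet_base_right hvb).symm,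
        (Φ.intervalSet_base_left v).symm⟩
    · rw [Line.of_mem_image] at hw
      exact ⟨v, hv, w, hw, fun e => hvw.ne (by rw [e]), rfl, rfl,
        (Φ.intervalSet_of_le hvw.le).symm, (Φ.intervalSet_of_lt hvw).symm⟩
  refine { Line.isLineCompletion Φ.completion hb Φ.nontrivial with
    nontrivial := Φ.nontrivial.image Line.of_injective
    top_eq := rfl
    mem_X := fun x => ?_
    card := fun v hv => ?_
    sep := fun v hv w hw hvw hn => ?_
    inter := fun v hv w hw hvw hn => ?_
    neighbor := ?_
    star := ?_ }
  · rw [mem_X_iff]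
    refine ⟨fun h z => ?_, fun h z => h (Line.of b z)⟩
    rcases Line.eq_top_or z with rfl | ⟨c, rfl⟩
    exacts [h b, h c]
  · rcases Line.eq_top_or v with rfl | ⟨c, rfl⟩
    · exact Φ.card_cutpoint b hb
    · exact Φ.card_cutpoint c fun h => hv (Line.of_mem_image.2 h)
  · obtain ⟨v', hv', w', hw', hne, -, -, e1, e2⟩ := hsep v hv w hw hvw hn
    rw [e1, e2]
    exact Φ.sep_mem v' hv' w' hw' hne
  · obtain ⟨v', hv', w', hw', hne, e3, e4, e1, e2⟩ := hsep v hv w hw hvw hn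
    rw [e1, e2, ← e3, ← e4]
    exact Φ.separator v' hv' w' hw' hne
  · rintro _ ⟨i, hi, rfl⟩ c hc
    have hbi : Line.of b b < Line.of b i :=
      bot_lt_iff_ne_bot.2 (Line.of_injective.ne fun e => hb (e ▸ hi))
    show _ ⊆ Φ.P i
    rcases Line.eq_top_or c with rfl | ⟨c, rfl⟩
    · have hc' : Line.of b i ⋖ ⊤ := hc.resolve_left fun h => not_top_lt h.1
      refine Φ.neighbor_subset i hi b (Or.inr ⟨fun e => hb (e ▸ hi), fun x hxi hxb hx => ?_⟩)
      rw [Line.mem_closedArc_of_lt hbi] at hx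
      rcases hx with hx | hx
      · exact hxb (Line.of_injective (hx.antisymm bot_le))
      · exact hc'.2 (hx.lt_of_ne (Line.of_injective.ne hxi.symm)) (Line.of_lt_top x)
    · refine Φ.neighbor_subset i hi c ?_
      refine hc.imp (fun hc => ⟨fun e => hc.1.ne (by rw [e]), fun x hxi hxc hx => ?_⟩)
        fun hc => ⟨fun e => hc.1.ne (by rw [e]), fun x hxi hxc hx => ?_⟩
      · rw [Line.mem_closedArc_of_le hc.1.le] at hx
        exact hc.2 (hx.1.lt_of_ne (Line.of_injective.ne hxc.symm))
          (hx.2.lt_of_ne (Line.of_injective.ne hxi))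
      · rw [Line.mem_closedArc_of_le hc.1.le] at hx
        exact hc.2 (hx.1.lt_of_ne (Line.of_injective.ne hxi.symm))
          (hx.2.lt_of_ne (Line.of_injective.ne hxc))
  · rintro _ ⟨i, hi, rfl⟩ _ ⟨j, hj, rfl⟩ h1 h2
    exact congrArg _ (Φ.star i hi j hj h1 h2)

end Pseudoflower

/-! ### Closing a line up to a cycle -/

namespace IsLineCompletion

variable {L : Type u} [LinearOrder L] [BoundedOrder L] {I : Set L}

theorem eq_of_forall_iff (h : IsLineCompletion I) {v w v' w' : L} (hv : v ∉ I) (hw : w ∉ I)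
    (hv' : v' ∉ I) (hw' : w' ∉ I) (hvw : v < w) (hvw' : v' < w')
    (H : ∀ x ∈ I, (v < x ∧ x < w) ↔ (v' < x ∧ x < w')) : v = v' ∧ w = w' := by
  have key : ∀ {v w v' w' : L}, v ∉ I → w ∉ I → v' ∉ I → v < w →
      (∀ x ∈ I, (v < x ∧ x < w) ↔ (v' < x ∧ x < w')) → v' ≤ v ∧ w ≤ w' := by
    intro v w v' w' hv hw hv' hvw H
    constructor
    · by_contra! hlt
      rcases le_total v' w with h1 | h1
      · obtain ⟨i, hi, h2, h3⟩ := h.exists_between v hv v' hv' hlt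
        exact h3.not_gt ((H i hi).1 ⟨h2, h3.trans_le h1⟩).1
      · obtain ⟨i, hi, h2, h3⟩ := h.exists_between v hv w hw hvw
        exact (h3.trans_le h1).not_gt ((H i hi).1 ⟨h2, h3⟩).1
    · by_contra! hlt
      by_cases hw' : w' ∈ I
      · rcases lt_or_ge v w' with h1 | h1
        · exact lt_irrefl _ ((H w' hw').1 ⟨h1, hlt⟩).2
        · obtain ⟨i, hi, h2, h3⟩ := h.exists_between v hv w hw hvw
          exact (h1.trans_lt h2).not_gt ((H i hi).1 ⟨h2, h3⟩).2
      · rcases lt_or_ge v w' with h1 | h1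
        · obtain ⟨i, hi, h2, h3⟩ := h.exists_between w' hw' w hw hlt
          exact h2.not_gt ((H i hi).1 ⟨h1.trans h2, h3⟩).2
        · obtain ⟨i, hi, h2, h3⟩ := h.exists_between v hv w hw hvw
          exact (h1.trans_lt h2).not_gt ((H i hi).1 ⟨h2, h3⟩).2
  have k1 := key hv hw hv' hvw H
  have k2 := key hv' hw' hv hvw' fun x hx => (H x hx).symm
  exact ⟨k2.1.antisymm k1.1, k1.2.antisymm k2.2⟩

/-- There are members of `I` before, inside and after the inner interval, so its complement is not
convex. Hence no interval of the loop is represented both by an interval of the line and by the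
complement of an inner one. -/
theorem not_forall_iff (h : IsLineCompletion I) {v w v' w' : L} (hv' : v' ∉ I) (hw' : w' ∉ I)
    (hbot : v' ≠ ⊥) (htop : w' ≠ ⊤) (hvw' : v' < w') :
    ¬ ∀ x ∈ I, (v < x ∧ x < w) ↔ ¬ (v' < x ∧ x < w') := by
  intro H
  obtain ⟨i, hi, -, h1⟩ := h.exists_between ⊥ h.bot_notMem v' hv' (bot_lt_iff_ne_bot.2 hbot)
  obtain ⟨j, hj, h2, h3⟩ := h.exists_between v' hv' w' hw' hvw'
  obtain ⟨l, hl, h4, -⟩ := h.exists_between w' hw' ⊤ h.top_notMem (lt_top_iff_ne_top.2 htop)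
  have h5 := (H i hi).2 fun h' => h'.1.not_gt h1
  have h6 := (H l hl).2 fun h' => h'.2.not_gt h4
  exact (H j hj).1 ⟨h5.1.trans (h1.trans h2), (h3.trans h4).trans h6.2⟩ ⟨h2, h3⟩

theorem exists_of_convex (h : IsLineCompletion I) {A : Set L} (hA : A ⊆ I) (hne : A.Nonempty)
    (hc : ∀ x ∈ A, ∀ z ∈ A, ∀ y ∈ I, x < y → y < z → y ∈ A) :
    ∃ v ∉ I, ∃ w ∉ I, v < w ∧ ∀ x ∈ I, x ∈ A ↔ v < x ∧ x < w := by
  obtain ⟨v, hv, hv'⟩ := h.exists_cut {x ∈ I | ∀ a ∈ A, x < a} (fun x hx => hx.1)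
    fun j hj x hx hxj => ⟨hx, fun a ha => hxj.trans (hj.2 a ha)⟩
  obtain ⟨w, hw, hw'⟩ := h.exists_cut {x ∈ I | ∃ a ∈ A, x ≤ a} (fun x hx => hx.1)
    fun j ⟨_, a, ha, hja⟩ x hx hxj => ⟨hx, a, ha, hxj.le.trans hja⟩
  have key : ∀ x ∈ I, x ∈ A ↔ v < x ∧ x < w := by
    intro x hx
    have h1 : x ≠ v := fun e => hv (e ▸ hx)
    rw [← hw' x hx]
    have h2 := hv' x hx
    constructor
    · intro hxA
      exact ⟨lt_of_le_of_ne (not_lt.1 fun h' => lt_irrefl x ((h2.2 h').2 x hxA)) h1.symm, hx, x,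
        hxA, le_rfl⟩
    · rintro ⟨h3, -, a, ha, hxa⟩
      obtain ⟨c, hc', hcx⟩ : ∃ c ∈ A, c ≤ x := by
        by_contra! hcon
        exact h3.not_gt (h2.1 ⟨hx, hcon⟩)
      rcases hcx.eq_or_lt with rfl | hcx
      · exact hc'
      rcases hxa.eq_or_lt with rfl | hxa
      · exact ha
      exact hc c hc' a ha x hx hcx hxa
  obtain ⟨a, ha⟩ := hne
  have := (key a (hA ha)).1 ha
  exact ⟨v, hv, w, hw, this.1.trans this.2, key⟩

end IsLineCompletion

/-! ### The loop of a line -/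

/-- The circular order obtained from a bounded linear order by identifying its ends. -/
abbrev Loop (L : Type u) [LinearOrder L] [BoundedOrder L] : Type u := {x : L // x ≠ ⊤}

namespace Loop

variable {L : Type u} [LinearOrder L] [BoundedOrder L] {I : Set L}

noncomputable instance : CircularOrder (Loop L) := LinearOrder.toCircularOrder _

theorem sbtw_iff {a b c : Loop L} : sbtw a b c ↔
    (a < b ∧ b < c) ∨ (b < c ∧ c < a) ∨ (c < a ∧ a < b) := Iff.rfl

theorem mem_closedArc_of_le {v w c : Loop L} (h : v ≤ w) : c ∈ closedArc v w ↔ v ≤ c ∧ c ≤ w := by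
  rw [mem_closedArc, sbtw_iff]
  grind

theorem mem_closedArc_of_lt {v w c : Loop L} (h : v < w) : c ∈ closedArc w v ↔ c ≤ v ∨ w ≤ c := by
  rw [mem_closedArc, sbtw_iff]
  grind

/-- An interval of the loop is convex in the line or has a convex complement there. Either convex
set is bounded by two cuts, and a cut at the top is replaced by the bottom. -/
theorem isCycleCompletion (h : IsLineCompletion I) :
    IsCycleCompletion {x : Loop L | (x : L) ∈ I} := by
  intro J ⟨hJ, hint⟩ hne hJI
  have htop : ∀ {x}, x ∈ I → x ≠ ⊤ := fun hx e => h.top_notMem (e ▸ hx)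
  have hmem : ∀ x (hx : x ∈ I), x ∈ ((↑) '' J : Set L) ↔ (⟨x, htop hx⟩ : Loop L) ∈ J := fun x hx =>
    ⟨by rintro ⟨y, hy, rfl⟩; exact hy, fun hy => ⟨_, hy, rfl⟩⟩
  -- a pair of cut points and the open interval or the complement of an open interval it bounds
  have rep : ∀ v w : Loop L, (v : L) ∉ I → (w : L) ∉ I →
      closedArc v w ∩ {x : Loop L | (x : L) ∈ I} = J →
      (∃ b ∉ I, (v : L) < b ∧ (b = w ∨ (b = ⊤ ∧ (w : L) = ⊥)) ∧
        ∀ x (hx : x ∈ I), (⟨x, htop hx⟩ : Loop L) ∈ J ↔ v < x ∧ x < b) ∨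
      ((w : L) < v ∧ (w : L) ≠ ⊥ ∧
        ∀ x (hx : x ∈ I), ¬ (⟨x, htop hx⟩ : Loop L) ∈ J ↔ w < x ∧ x < v) := by
    intro v w hv hw hvw
    have hx' : ∀ x (hx : x ∈ I), (⟨x, htop hx⟩ : Loop L) ∈ J ↔
        (⟨x, htop hx⟩ : Loop L) ∈ closedArc v w := fun x hx => by
      rw [← hvw]; exact ⟨fun h' => h'.1, fun h' => ⟨h', hx⟩⟩
    have hnv : ∀ {x}, x ∈ I → x ≠ v := fun hx e => hv (e ▸ hx)
    have hnw : ∀ {x}, x ∈ I → x ≠ w := fun hx e => hw (e ▸ hx)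
    rcases lt_trichotomy v w with hlt | rfl | hlt
    · refine Or.inl ⟨w, hw, hlt, Or.inl rfl, fun x hx => ?_⟩
      rw [hx' x hx, mem_closedArc_of_le hlt.le]
      exact ⟨fun h' => ⟨lt_of_le_of_ne (show (v : L) ≤ x from h'.1) (hnv hx).symm,
        lt_of_le_of_ne (show x ≤ (w : L) from h'.2) (hnw hx)⟩,
        fun h' => ⟨h'.1.le, h'.2.le⟩⟩
    · exfalso
      obtain ⟨j, hj⟩ := hne
      rw [← hvw, closedArc_self] at hj
      exact hv (hj.1 ▸ hj.2)
    · by_cases hwb : (w : L) = ⊥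
      · refine Or.inl ⟨⊤, h.top_notMem, lt_top_iff_ne_top.2 v.2, Or.inr ⟨rfl, hwb⟩,
          fun x hx => ?_⟩
        rw [hx' x hx, mem_closedArc_of_lt hlt]
        constructor
        · rintro (h' | h')
          · exact absurd (le_antisymm h' (by rw [hwb]; exact bot_le) : x = w) (hnw hx)
          · exact ⟨lt_of_le_of_ne h' (hnv hx).symm, lt_top_iff_ne_top.2 (htop hx)⟩
        · exact fun h' => Or.inr h'.1.le
      · refine Or.inr ⟨hlt, hwb, fun x hx => ?_⟩
        rw [hx' x hx, mem_closedArc_of_lt hlt, not_or, not_le, not_le]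
        exact Iff.rfl
  have hex : ∃ v w : Loop L, (v : L) ∉ I ∧ (w : L) ∉ I ∧
      closedArc v w ∩ {x : Loop L | (x : L) ∈ I} = J := by
    by_cases hconv : ∀ x ∈ J, ∀ z ∈ J, ∀ y : Loop L, (y : L) ∈ I → x < y → y < z → y ∈ J
    · obtain ⟨v, hv, w, hw, hvw, H⟩ := h.exists_of_convex (A := (↑) '' J)
        (by rintro _ ⟨x, hx, rfl⟩; exact hJ hx) (hne.image _)
        (by
          rintro _ ⟨x, hx, rfl⟩ _ ⟨z, hz, rfl⟩ y hy hxy hyz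
          exact ⟨⟨y, htop hy⟩, hconv x hx z hz ⟨y, htop hy⟩ hy hxy hyz, rfl⟩)
      have hvt : v ≠ ⊤ := (hvw.trans_le le_top).ne
      have hmem' : ∀ x : Loop L, (x : L) ∈ I → (x ∈ J ↔ v < x ∧ (x : L) < w) := fun x hx => by
        rw [← H x hx, hmem x hx]
      by_cases hwt : w = ⊤
      · have hvb : (⊥ : L) < v := by
          refine bot_lt_iff_ne_bot.2 ?_
          rintro rfl
          refine hJI (hJ.antisymm fun x hx => (hmem' x hx).2 ?_)
          rw [hwt]
          exact ⟨bot_lt_iff_ne_bot.2 fun e => h.bot_notMem (e ▸ hx),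
            lt_top_iff_ne_top.2 (htop hx)⟩
        refine ⟨⟨v, hvt⟩, ⟨⊥, (hvb.trans_le le_top).ne⟩, hv, h.bot_notMem, ?_⟩
        ext x
        rw [Set.mem_inter_iff, mem_closedArc_of_lt (show (⟨⊥, _⟩ : Loop L) < ⟨v, hvt⟩ from hvb)]
        constructor
        · rintro ⟨hx', hx⟩
          refine (hmem' x hx).2 ⟨?_, by rw [hwt]; exact lt_top_iff_ne_top.2 x.2⟩
          rcases hx' with hx' | hx'
          · exact absurd (le_antisymm hx' bot_le : (x : L) = ⊥) fun e => h.bot_notMem (e ▸ hx)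
          · exact lt_of_le_of_ne hx' fun e => hv (e ▸ hx)
        · exact fun hx => ⟨Or.inr ((hmem' x (hJ hx)).1 hx).1.le, hJ hx⟩
      · refine ⟨⟨v, hvt⟩, ⟨w, hwt⟩, hv, hw, ?_⟩
        ext x
        rw [Set.mem_inter_iff,
          mem_closedArc_of_le (show (⟨v, hvt⟩ : Loop L) ≤ ⟨w, hwt⟩ from hvw.le)]
        constructor
        · rintro ⟨hx', hx⟩
          exact (hmem' x hx).2 ⟨lt_of_le_of_ne hx'.1 fun e => hv (e ▸ hx),
            lt_of_le_of_ne hx'.2 fun e => hw (e ▸ hx)⟩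
        · intro hx
          have := (hmem' x (hJ hx)).1 hx
          exact ⟨⟨this.1.le, this.2.le⟩, hJ hx⟩
    -- If `J` omits something between two of its elements, then it contains all of `I` outside them;
    -- hence its complement is convex.
    · push Not at hconv
      obtain ⟨s, hs, t, ht, x, hx, hsx, hxt, hxJ⟩ := hconv
      have hout : ∀ s ∈ J, ∀ t ∈ J, ∀ x : Loop L, (x : L) ∈ I → s < x → x < t → x ∉ J →
          ∀ y : Loop L, (y : L) ∈ I → y ≤ s ∨ t ≤ y → y ∈ J := by
        intro s hs t ht x hx hsx hxt hxJ y hy hst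
        rcases hint s hs t ht with h' | h'
        · exact absurd (h' ⟨(mem_closedArc_of_le (hsx.trans hxt).le).2 ⟨hsx.le, hxt.le⟩, hx⟩) hxJ
        · exact h' ⟨(mem_closedArc_of_lt (hsx.trans hxt)).2 hst, hy⟩
      have hin := hout s hs t ht x hx hsx hxt hxJ
      obtain ⟨v, hv, w, hw, hvw, H⟩ := h.exists_of_convex (A := I \ (↑) '' J)
        Set.sdiff_subset ⟨x, hx, by rw [hmem _ hx]; exact hxJ⟩
        (by
          rintro a ⟨ha, haJ⟩ c ⟨hc, hcJ⟩ y hy hay hyc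
          refine ⟨hy, fun hyJ => ?_⟩
          rw [hmem _ ha] at haJ
          rw [hmem _ hc] at hcJ
          rw [hmem _ hy] at hyJ
          have h1 : s < (⟨a, htop ha⟩ : Loop L) := not_le.1 fun h' => haJ (hin _ ha (Or.inl h'))
          have h2 : (⟨c, htop hc⟩ : Loop L) < t := not_le.1 fun h' => hcJ (hin _ hc (Or.inr h'))
          exact hcJ (hout s hs _ hyJ _ ha h1 hay haJ _ hc (Or.inr (le_of_lt hyc))))
      have hvt : v ≠ ⊤ := (hvw.trans_le le_top).ne
      have hmem' : ∀ x : Loop L, (x : L) ∈ I → (x ∈ J ↔ ¬ (v < x ∧ (x : L) < w)) := fun x hx => by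
        rw [← H x hx, Set.mem_sdiff, hmem x hx]
        tauto
      by_cases hwt : w = ⊤
      · refine ⟨⟨⊥, ((bot_le (a := v)).trans_lt (lt_top_iff_ne_top.2 hvt)).ne⟩, ⟨v, hvt⟩,
          h.bot_notMem, hv, ?_⟩
        ext x
        rw [Set.mem_inter_iff,
          mem_closedArc_of_le (show (⟨⊥, _⟩ : Loop L) ≤ ⟨v, hvt⟩ from (bot_le : ⊥ ≤ v))]
        constructor
        · rintro ⟨hx', hx⟩
          exact (hmem' x hx).2 fun h' => h'.1.not_ge hx'.2
        · intro hx
          have := (hmem' x (hJ hx)).1 hx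
          rw [hwt] at this
          exact ⟨⟨bot_le (a := (x : L)), not_lt.1 fun h' =>
            this ⟨h', lt_top_iff_ne_top.2 x.2⟩⟩, hJ hx⟩
      · refine ⟨⟨w, hwt⟩, ⟨v, hvt⟩, hw, hv, ?_⟩
        ext x
        rw [Set.mem_inter_iff, mem_closedArc_of_lt (show (⟨v, hvt⟩ : Loop L) < ⟨w, hwt⟩ from hvw)]
        constructor
        · rintro ⟨hx', hx⟩
          refine (hmem' x hx).2 fun h' => ?_
          exact hx'.elim (fun h'' => h'.1.not_ge h'') fun h'' => h'.2.not_ge h''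
        · intro hx
          have := (hmem' x (hJ hx)).1 hx
          rw [not_and_or, not_lt, not_lt] at this
          exact ⟨this, hJ hx⟩
  obtain ⟨v, w, hv, hw, hvw⟩ := hex
  refine ⟨(v, w), ⟨hv, hw, hvw⟩, ?_⟩
  rintro ⟨v', w'⟩ ⟨hv', hw', hvw'⟩
  dsimp only at hv' hw' hvw'
  have htv : (v : L) ≠ ⊤ := v.2
  have htw : (w : L) ≠ ⊤ := w.2
  have htw' : (w' : L) ≠ ⊤ := w'.2
  rcases rep v w hv hw hvw with ⟨b, hb, h1, h2, h3⟩ | ⟨h1, h2, h3⟩ <;>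
  rcases rep v' w' hv' hw' hvw' with ⟨b', hb', h1', h2', h3'⟩ | ⟨h1', h2', h3'⟩
  · obtain ⟨e1, e2⟩ := h.eq_of_forall_iff hv hb hv' hb' h1 h1' fun x hx => by
      rw [← h3 x hx, h3' x hx]
    refine Prod.ext (Subtype.ext e1.symm) (Subtype.ext ?_)
    show (w' : L) = w
    grind
  · exact absurd (fun x hx => by rw [← h3 x hx, ← h3' x hx, not_not])
      (h.not_forall_iff (v := v) (w := b) hw' hv' h2' v'.2 h1')
  · exact absurd (fun x hx => by rw [← h3' x hx, ← h3 x hx, not_not])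
      (h.not_forall_iff (v := v') (w := b') hw hv h2 v.2 h1)
  · obtain ⟨e1, e2⟩ := h.eq_of_forall_iff hw hv hw' hv' h1 h1' fun x hx => by
      rw [← h3 x hx, h3' x hx]
    exact Prod.ext (Subtype.ext e2.symm) (Subtype.ext e1.symm)

end Loop

theorem add_add_le_of_two_mul_add_eq {a b x : ℕ∞} {k : ℕ} (ha : 2 * a + x = k)
    (hb : 2 * b + x = k) : a + b + x ≤ k := by
  rcases le_total a b with h | h
  · rw [← hb, two_mul]; gcongr
  · rw [← ha, two_mul]; gcongr

namespace LinFlower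

variable {V L : Type u} [LinearOrder L] [BoundedOrder L] {U : SepUniverse V} {k : ℕ}
  {X : Set V} {I : Set L} {P : L → Set V}

/-- The family on the loop. -/
noncomputable def loopFamily (h : LinFlower U k X I P) : CyclicFamily V where
  C := Loop L
  circ := inferInstance
  I := {x | (x : L) ∈ I}
  nontrivial := by
    obtain ⟨i, hi, j, hj, hne⟩ := h.nontrivial
    have htop : ∀ {x}, x ∈ I → x ≠ ⊤ := fun hx e => h.top_notMem (e ▸ hx)
    exact ⟨⟨i, htop hi⟩, hi, ⟨j, htop hj⟩, hj, fun e => hne (congrArg Subtype.val e)⟩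
  completion := Loop.isCycleCompletion h.toIsLineCompletion
  P x := P x

theorem bot_ne_top (h : LinFlower U k X I P) : (⊥ : L) ≠ ⊤ := by
  obtain ⟨i, hi, -⟩ := h.nontrivial
  intro e
  have : i = ⊥ := le_antisymm (e ▸ le_top) bot_le
  exact h.bot_notMem (this ▸ hi)

theorem exists_loop (h : LinFlower U k X I P) (z : L) : ∃ y : Loop L, P y = P z ∧
    ((y : L) = z ∨ (z = ⊤ ∧ (y : L) = ⊥)) := by
  by_cases hz : z = ⊤
  · exact ⟨⟨⊥, h.bot_ne_top⟩, by rw [hz, h.top_eq], Or.inr ⟨hz, rfl⟩⟩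
  · exact ⟨⟨z, hz⟩, rfl, Or.inl rfl⟩

theorem loopFamily_X (h : LinFlower U k X I P) : h.loopFamily.X = X := by
  ext x
  rw [h.mem_X]
  simp only [CyclicFamily.X, Set.mem_compl_iff, Set.mem_iUnion, not_exists]
  refine ⟨fun H z => ?_, fun H y => H y.1⟩
  obtain ⟨y, hy, -⟩ := h.exists_loop z
  rw [← hy]
  exact H y

theorem mem_loopFamily_intervalSet (h : LinFlower U k X I P) {v w : Loop L} {x : V} :
    x ∈ h.loopFamily.intervalSet v w ↔ x ∈ X ∨ ∃ z ∈ closedArc v w, x ∈ P z := by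
  simp only [CyclicFamily.intervalSet, Set.mem_union, Set.mem_iUnion, exists_prop]
  rw [h.loopFamily_X]
  exact or_comm

theorem loopFamily_intervalSet_of_le (h : LinFlower U k X I P) {v w : Loop L} (hvw : v ≤ w) :
    h.loopFamily.intervalSet v w = lineIn X P v w := by
  ext x
  rw [mem_loopFamily_intervalSet]
  refine or_congr_right ⟨?_, ?_⟩
  · rintro ⟨z, hz, hx⟩
    rw [Loop.mem_closedArc_of_le hvw] at hz
    exact ⟨z, hz.1, hz.2, hx⟩
  · rintro ⟨z, h1, h2, hx⟩
    exact ⟨⟨z, fun e => w.2 (top_le_iff.1 (e ▸ h2))⟩, (Loop.mem_closedArc_of_le hvw).2 ⟨h1, h2⟩, hx⟩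

theorem loopFamily_intervalSet_of_lt (h : LinFlower U k X I P) {v w : Loop L} (hvw : v < w) :
    h.loopFamily.intervalSet w v = lineOut X P v w := by
  ext x
  rw [mem_loopFamily_intervalSet]
  refine or_congr_right ⟨?_, ?_⟩
  · rintro ⟨z, hz, hx⟩
    rw [Loop.mem_closedArc_of_lt hvw] at hz
    exact ⟨z, hz, hx⟩
  · rintro ⟨z, h1, hx⟩
    obtain ⟨y, hy, hyz⟩ := h.exists_loop z
    refine ⟨y, (Loop.mem_closedArc_of_lt hvw).2 ?_, hy ▸ hx⟩
    rcases hyz with hyz | ⟨-, hyz⟩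
    · rw [← hyz] at h1
      exact h1
    · left
      show (y : L) ≤ v
      rw [hyz]
      exact bot_le

theorem loopFamily_neighbor (h : LinFlower U k X I P) {i c : Loop L} (hi : (i : L) ∈ I)
    (hc : IsCyclicPred i c ∨ IsCyclicSucc i c) :
    ∃ c' : L, P c' = P c ∧ (c' ⋖ i ∨ (i : L) ⋖ c') := by
  obtain ⟨p, hp, s, hs, h1, h2, h3⟩ := h.exists_petal hi
  have hpt : p ≠ ⊤ := (h1.trans_le le_top).ne
  have cp : p ⋖ (i : L) := ⟨h1, fun x hx hx' => hx'.ne (h3 x hx (hx'.trans h2))⟩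
  have cs : (i : L) ⋖ s := ⟨h2, fun x hx hx' => hx.ne' (h3 x (h1.trans hx) hx')⟩
  rcases hc with hc | hc
  · have hle : (⟨p, hpt⟩ : Loop L) ≤ i := h1.le
    refine ⟨p, ?_, Or.inl cp⟩
    by_contra hne
    have hpc : (⟨p, hpt⟩ : Loop L) ≠ c := fun e => hne (by rw [← e])
    refine hc.2 ⟨p, hpt⟩ (fun e => h1.ne (congrArg Subtype.val e)) hpc ?_
    rcases lt_or_gt_of_ne hc.1 with h' | h'
    · rw [Loop.mem_closedArc_of_le h'.le]
      refine ⟨?_, hle⟩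
      by_contra! h''
      exact cp.2 (c := c) h'' h'
    · rw [Loop.mem_closedArc_of_lt h']
      exact Or.inl hle
  · obtain ⟨y, hy, hys⟩ := h.exists_loop s
    refine ⟨s, ?_, Or.inr cs⟩
    by_contra hne
    have hyc : y ≠ c := fun e => hne (by rw [← e, hy])
    have hyi : y ≠ i := by
      rintro rfl
      rcases hys with e | ⟨-, e⟩
      · exact h2.ne e
      · exact h.bot_notMem (e ▸ hi)
    refine hc.2 y hyi hyc ?_
    rcases lt_or_gt_of_ne hc.1 with h' | h'
    · rw [Loop.mem_closedArc_of_lt h']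
      rcases hys with e | ⟨-, e⟩
      · right
        show (i : L) ≤ y
        rw [e]
        exact h2.le
      · left
        show (y : L) ≤ c
        rw [e]
        exact bot_le
    · have hsc : s ≤ c := by
        by_contra! h''
        exact cs.2 (c := c) h' h''
      rw [Loop.mem_closedArc_of_le h'.le]
      rcases hys with e | ⟨e, -⟩
      · constructor
        · show (i : L) ≤ y
          rw [e]; exact h2.le
        · show (y : L) ≤ c
          rw [e]; exact hsc
      · exact absurd (top_le_iff.1 (e ▸ hsc)) c.2

/-- The pseudoflower on the loop. -/
noncomputable def toPseudoflower (h : LinFlower U k X I P) : Pseudoflower U k where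
  toCyclicFamily := h.loopFamily
  card_cutpoint v hv := by
    rw [h.loopFamily_X]
    exact h.card v.1 hv
  sep_mem v hv w hw hvw := by
    rcases lt_or_gt_of_ne (α := Loop L) hvw with hlt | hlt
    · rw [CyclicFamily.S, h.loopFamily_intervalSet_of_le hlt.le, h.loopFamily_intervalSet_of_lt hlt]
      exact h.sep v.1 hv w.1 hw hlt fun e => w.2 e.2
    · rw [CyclicFamily.S, h.loopFamily_intervalSet_of_le hlt.le, h.loopFamily_intervalSet_of_lt hlt]
      exact U.inv_mem _ (h.sep w.1 hw v.1 hv hlt fun e => v.2 e.2)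
  sep_order v hv w hw hvw := by
    have key : (h.loopFamily.S v w).left ∩ (h.loopFamily.S v w).right =
        h.loopFamily.P v ∪ h.loopFamily.P w ∪ X := by
      rcases lt_or_gt_of_ne (α := Loop L) hvw with hlt | hlt
      · rw [CyclicFamily.S, h.loopFamily_intervalSet_of_le hlt.le,
          h.loopFamily_intervalSet_of_lt hlt]
        exact h.inter v.1 hv w.1 hw hlt fun e => w.2 e.2
      · rw [CyclicFamily.S, h.loopFamily_intervalSet_of_le hlt.le,
          h.loopFamily_intervalSet_of_lt hlt, Set.inter_comm, Set.union_comm (h.loopFamily.P v)]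
        exact h.inter w.1 hw v.1 hv hlt fun e => v.2 e.2
    rw [VSep.order, key]
    exact (Set.encard_union_le _ _).trans ((add_le_add_left (Set.encard_union_le _ _) _).trans
      (add_add_le_of_two_mul_add_eq (h.card v.1 hv) (h.card w.1 hw)))
  separator v hv w hw hvw := by
    rw [h.loopFamily_X]
    rcases lt_or_gt_of_ne (α := Loop L) hvw with hlt | hlt
    · rw [h.loopFamily_intervalSet_of_le hlt.le, h.loopFamily_intervalSet_of_lt hlt]
      exact h.inter v.1 hv w.1 hw hlt fun e => w.2 e.2
    · rw [h.loopFamily_intervalSet_of_le hlt.le, h.loopFamily_intervalSet_of_lt hlt,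
        Set.inter_comm, Set.union_comm (h.loopFamily.P v)]
      exact h.inter w.1 hw v.1 hv hlt fun e => v.2 e.2
  neighbor_subset i hi c hc := by
    obtain ⟨c', e, hc'⟩ := h.loopFamily_neighbor hi hc
    exact e.symm.subset.trans (h.neighbor i.1 hi c' hc')
  star i hi j hj h1 h2 := by
    rw [h.loopFamily_X] at h1
    exact Subtype.ext (h.star i.1 hi j.1 hj h1 h2)

end LinFlower

/-! ### Pseudoflowers as families of separations on a line -/

open VSep

/-- A pseudoflower as a family of separations that is indexed by a linear order. -/
structure LinModel {V K : Type u} [LinearOrder K] (U : SepUniverse V) (k : ℕ) (X P₀ : Set V)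
    (e : K → VSep V) : Prop where
  mono : Monotone e
  exists_bot : ∃ a, (∀ c, a ≤ c) ∧ e a = botSep X
  exists_top : ∃ a, (∀ c, c ≤ a) ∧ e a = topSep X
  sys : LinSys U k X P₀ (Set.range e)
  sep : ∀ a b : K, a < b → ((∃ c : K, c < a) ∨ ∃ c : K, b < c) → arcSep P₀ (e a) (e b) ∈ U.seps
  exists_isLUB : ∀ S : Set K, ∃ a, IsLUB S a
  exists_covBy : ∀ a b : K, a < b → ∃ p s, a ≤ p ∧ p ⋖ s ∧ s ≤ b
  loc : ∀ x ∉ X, (∃ a, x ∈ pt X P₀ (e a)) ∨ ∃ p s, p ⋖ s ∧ x ∈ arcIn P₀ (e p) (e s)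
  star : ∀ p s p' s' : K, p ⋖ s → p' ⋖ s' → e p = e s → e p' = e s' →
    pt X P₀ (e p) = pt X P₀ (e p') → p = p'
  mid : ∃ d, (∃ c, c < d) ∧ (∃ c, d < c) ∧ Disjoint P₀ (pt X P₀ (e d))

/-! ### Encoding the cut points of a line by pairs -/

/-- The separation at an element of a line. The vertices of the base point are distributed with the
help of an element `d` whose vertex set does not meet the base point. -/
def lineSep {V L : Type u} [LinearOrder L] [BoundedOrder L] (X : Set V) (P : L → Set V) (d x : L) :
    VSep V :=
  ⟨(lineIn X P ⊥ x \ P ⊥) ∪ {y | (y ∈ P ⊥ ∧ y ∈ P x) ∧ d < x},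
    (lineIn X P x ⊤ \ P ⊥) ∪ {y | (y ∈ P ⊥ ∧ y ∈ P x) ∧ x < d}⟩

namespace LinFlower

variable {V L : Type u} [LinearOrder L] [BoundedOrder L] {U : SepUniverse V} {k : ℕ}
  {X : Set V} {I : Set L} {P : L → Set V} {d : L}

theorem notMem_of_mem_X (h : LinFlower U k X I P) {x : V} (hx : x ∈ X) (z : L) : x ∉ P z :=
  (h.mem_X x).1 hx z

theorem mem_lineSep_left (h : LinFlower U k X I P) {v : L} {x : V} :
    x ∈ (lineSep X P d v).left ↔ x ∈ X ∨ (x ∉ P ⊥ ∧ ∃ z ≤ v, x ∈ P z) ∨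
      (x ∈ P ⊥ ∧ x ∈ P v ∧ d < v) := by
  have := fun hx => h.notMem_of_mem_X (x := x) hx ⊥
  simp only [lineSep, lineIn, Set.mem_union, Set.mem_sdiff, Set.mem_ofPred_eq, bot_le, true_and]
  grind

theorem mem_lineSep_right (h : LinFlower U k X I P) {v : L} {x : V} :
    x ∈ (lineSep X P d v).right ↔ x ∈ X ∨ (x ∉ P ⊥ ∧ ∃ z, v ≤ z ∧ x ∈ P z) ∨
      (x ∈ P ⊥ ∧ x ∈ P v ∧ v < d) := by
  have := fun hx => h.notMem_of_mem_X (x := x) hx ⊥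
  simp only [lineSep, lineIn, Set.mem_union, Set.mem_sdiff, Set.mem_ofPred_eq, le_top, true_and]
  grind

/-- The separator of the arc from `d` to `w` is `P d ∪ P w ∪ X`, and `P d` avoids the base point. So
a vertex of the base point that is used beyond `d` is used at all later cuts, which makes the left
sides of `lineSep` increase. -/
theorem mem_base_of_le (h : LinFlower U k X I P) (hd : d ∉ I) (hd0 : d ≠ ⊥)
    (hdis : Disjoint (P ⊥) (P d)) {z w : L} (hw : w ∉ I) {x : V} (hx : x ∈ P ⊥) (hz : x ∈ P z)
    (hdz : d ≤ z) (hzw : z ≤ w) : x ∈ P w := by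
  by_cases hwt : w = ⊤
  · rw [hwt, h.top_eq]; exact hx
  rcases (hdz.trans hzw).eq_or_lt with rfl | hlt
  · rwa [hzw.antisymm hdz] at hz
  have h1 : x ∈ P d ∪ P w ∪ X := by
    rw [← h.inter d hd w hw hlt fun e => hd0 e.1]
    exact ⟨Or.inr ⟨z, hdz, hzw, hz⟩, Or.inr ⟨⊥, Or.inl bot_le, hx⟩⟩
  have h2 : x ∉ P d := Set.disjoint_left.1 hdis hx
  have h3 : x ∉ X := fun hx' => h.notMem_of_mem_X hx' _ hx
  exact (h1.resolve_right h3).resolve_left h2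

theorem mem_base_of_ge (h : LinFlower U k X I P) (hd : d ∉ I) (hd1 : d ≠ ⊤)
    (hdis : Disjoint (P ⊥) (P d)) {z w : L} (hw : w ∉ I) {x : V} (hx : x ∈ P ⊥) (hz : x ∈ P z)
    (hdz : z ≤ d) (hzw : w ≤ z) : x ∈ P w := by
  by_cases hwt : w = ⊥
  · rw [hwt]; exact hx
  rcases (hzw.trans hdz).eq_or_lt with rfl | hlt
  · rwa [hdz.antisymm hzw] at hz
  have h1 : x ∈ P w ∪ P d ∪ X := by
    rw [← h.inter w hw d hd hlt fun e => hd1 e.2]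
    exact ⟨Or.inr ⟨z, hzw, hdz, hz⟩, Or.inr ⟨⊥, Or.inl bot_le, hx⟩⟩
  have h2 : x ∉ P d := Set.disjoint_left.1 hdis hx
  have h3 : x ∉ X := fun hx' => h.notMem_of_mem_X hx' _ hx
  exact (h1.resolve_right h3).resolve_right h2

/-- The cut `v` and the base point separate what lies before `v` from what lies after it, so a
vertex outside the base point is used in a convex part of the line. -/
theorem mem_of_le_of_le (h : LinFlower U k X I P) {v z z' : L} (hv : v ∉ I) {x : V}
    (hx : x ∉ P ⊥) (hz : x ∈ P z) (hz' : x ∈ P z') (h1 : z ≤ v) (h2 : v ≤ z') : x ∈ P v := by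
  by_cases hv0 : v = ⊥
  · rwa [← le_antisymm h1 (hv0 ▸ bot_le)]
  by_cases hv1 : v = ⊤
  · rwa [le_antisymm h2 (hv1 ▸ le_top)]
  have h3 : x ∈ P ⊥ ∪ P v ∪ X := by
    rw [← h.inter ⊥ h.bot_notMem v hv (bot_lt_iff_ne_bot.2 hv0) fun e => hv1 e.2]
    exact ⟨Or.inr ⟨z, bot_le, h1, hz⟩, Or.inr ⟨z', Or.inr h2, hz'⟩⟩
  have h4 : x ∉ X := fun hx' => h.notMem_of_mem_X hx' _ hz
  exact (h3.resolve_right h4).resolve_left hx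

theorem pt_lineSep (h : LinFlower U k X I P) (hdis : Disjoint (P ⊥) (P d)) {v : L} (hv : v ∉ I) :
    pt X (P ⊥) (lineSep X P d v) = P v := by
  ext x
  have h0 := fun hx => h.notMem_of_mem_X (x := x) hx v
  have h1 := fun a z z' => h.mem_of_le_of_le (x := x) (v := v) (z := z) (z' := z') hv a
  have h2 : x ∈ P ⊥ → x ∉ P d := fun hx => Set.disjoint_left.1 hdis hx
  have h3 := lt_trichotomy d v
  simp only [pt, arcIn, Set.mem_sdiff, Set.mem_union, Set.mem_inter_iff, h.mem_lineSep_left,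
    h.mem_lineSep_right]
  constructor
  · grind
  · intro hx
    refine ⟨?_, fun hX => h0 hX hx⟩
    by_cases hx0 : x ∈ P ⊥
    · grind
    · exact Or.inl ⟨Or.inr (Or.inl ⟨hx0, v, le_rfl, hx⟩), Or.inr (Or.inl ⟨hx0, v, le_rfl, hx⟩)⟩

/-- The encoding loses no information about arcs. For a vertex of the base point, the position
relative to `d` tells at which end of the line it is used. -/
theorem arcIn_lineSep (h : LinFlower U k X I P) (hd : d ∉ I) (hd0 : d ≠ ⊥) (hd1 : d ≠ ⊤)
    (hdis : Disjoint (P ⊥) (P d)) {v w : L} (hv : v ∉ I) (hw : w ∉ I) (hvw : v ≤ w) :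
    arcIn (P ⊥) (lineSep X P d v) (lineSep X P d w) = lineIn X P v w := by
  ext x
  have h1 := fun a z z' => h.mem_of_le_of_le (x := x) (v := v) (z := z) (z' := z') hv a
  have h2 : x ∈ P ⊥ → x ∉ P d := fun hx => Set.disjoint_left.1 hdis hx
  have h3 := fun z a b => h.mem_base_of_le hd hd0 hdis (z := z) hw (x := x) a b
  have h4 := fun z a b => h.mem_base_of_ge hd hd1 hdis (z := z) hv (x := x) a b
  have h5 := fun hx => h.notMem_of_mem_X (x := x) hx
  simp only [arcIn, Set.mem_union, Set.mem_inter_iff, h.mem_lineSep_left,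
    h.mem_lineSep_right, lineIn, Set.mem_ofPred_eq]
  by_cases hX : x ∈ X
  · simp [hX]
  by_cases hx : x ∈ P ⊥
  · simp only [hX, hx, false_or, true_and, not_true_eq_false, false_and]
    constructor
    · rintro (h' | ⟨h', h''⟩ | ⟨h', h''⟩)
      · exact ⟨w, hvw, le_rfl, h'.1.1⟩
      · exact ⟨w, hvw, le_rfl, h'⟩
      · exact ⟨v, le_rfl, hvw, h'⟩
    · rintro ⟨z, hvz, hzw, hxz⟩
      rcases lt_trichotomy d z with hdz | rfl | hdz
      · exact Or.inr (Or.inl ⟨h3 z hx hxz hdz.le hzw, hdz.trans_le hzw⟩)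
      · exact absurd hxz (h2 hx)
      · exact Or.inr (Or.inr ⟨h4 z hx hxz hdz.le hvz, hvz.trans_lt hdz⟩)
  · simp only [hX, hx, false_or, true_and, not_false_eq_true, false_and, or_false]
    constructor
    · rintro ⟨⟨z, hz, hxz⟩, z', hz', hxz'⟩
      rcases le_total v z with h' | h'
      · exact ⟨z, h', hz, hxz⟩
      · exact ⟨v, le_rfl, hvw, h1 hx z z' hxz hxz' h' hz'⟩
    · rintro ⟨z, hvz, hzw, hxz⟩
      exact ⟨⟨z, hzw, hxz⟩, z, hvz, hxz⟩

theorem arcOut_lineSep (h : LinFlower U k X I P) {v w : L} :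
    arcOut (P ⊥) (lineSep X P d v) (lineSep X P d w) = lineOut X P v w := by
  ext x
  have h5 := fun hx => h.notMem_of_mem_X (x := x) hx
  have h6 : ⊥ ≤ v := bot_le
  simp only [arcOut, Set.mem_union, h.mem_lineSep_left,
    h.mem_lineSep_right, lineOut, Set.mem_ofPred_eq]
  grind

theorem lineSep_mono (h : LinFlower U k X I P) (hd : d ∉ I) (hd0 : d ≠ ⊥) (hd1 : d ≠ ⊤)
    (hdis : Disjoint (P ⊥) (P d)) {v w : L} (hv : v ∉ I) (hw : w ∉ I) (hvw : v ≤ w) :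
    lineSep X P d v ≤ lineSep X P d w := by
  constructor <;> intro x
  · have h3 := fun z a b => h.mem_base_of_le hd hd0 hdis (z := z) hw (x := x) a b
    rw [h.mem_lineSep_left, h.mem_lineSep_left]
    grind
  · have h4 := fun z a b => h.mem_base_of_ge hd hd1 hdis (z := z) hv (x := x) a b
    rw [h.mem_lineSep_right, h.mem_lineSep_right]
    grind

theorem lineSep_bot (h : LinFlower U k X I P) (hd0 : d ≠ ⊥) :
    lineSep X P d ⊥ = botSep X := by
  have h7 : ⊥ < d := bot_lt_iff_ne_bot.2 hd0
  refine VSep.ext ?_ ?_ <;> ext x <;>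
  simp only [h.mem_lineSep_left, h.mem_lineSep_right, botSep, le_bot_iff, bot_le, true_and,
    exists_eq_left, not_lt_bot, Set.mem_univ, iff_true]
  · tauto
  · have := h.mem_X x
    grind

theorem lineSep_top (h : LinFlower U k X I P) (hd1 : d ≠ ⊤) :
    lineSep X P d ⊤ = topSep X := by
  have h7 : d < ⊤ := lt_top_iff_ne_top.2 hd1
  refine VSep.ext ?_ ?_ <;> ext x <;>
  simp only [h.mem_lineSep_left, h.mem_lineSep_right, topSep, top_le_iff, le_top, true_and,
    exists_eq_left, not_top_lt, Set.mem_univ, iff_true, h.top_eq]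
  · have := h.mem_X x
    grind
  · tauto

theorem arcSep_lineSep (h : LinFlower U k X I P) (hd : d ∉ I) (hd0 : d ≠ ⊥) (hd1 : d ≠ ⊤)
    (hdis : Disjoint (P ⊥) (P d)) {v w : L} (hv : v ∉ I) (hw : w ∉ I) (hvw : v ≤ w) :
    arcSep (P ⊥) (lineSep X P d v) (lineSep X P d w) = ⟨lineIn X P v w, lineOut X P v w⟩ := by
  rw [arcSep, h.arcIn_lineSep hd hd0 hd1 hdis hv hw hvw, h.arcOut_lineSep]

theorem linModel (h : LinFlower U k X I P) (hd : d ∉ I) (hd0 : d ≠ ⊥) (hd1 : d ≠ ⊤)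
    (hdis : Disjoint (P ⊥) (P d)) :
    LinModel U k X (P ⊥) fun v : {x // x ∉ I} => lineSep X P d v := by
  have hchain : IsCutChain X (P ⊥) (Set.range fun v : {x // x ∉ I} => lineSep X P d v) := by
    refine ⟨?_, ?_, ⟨⟨⊥, h.bot_notMem⟩, h.lineSep_bot hd0⟩, ⟨⟨⊤, h.top_notMem⟩, h.lineSep_top hd1⟩,
      ?_, ?_, ?_⟩
    · exact Set.disjoint_right.2 fun x hx => h.notMem_of_mem_X hx _
    · rintro _ ⟨v, rfl⟩ _ ⟨w, rfl⟩
      exact (le_total v w).imp (h.lineSep_mono hd hd0 hd1 hdis v.2 w.2)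
        (h.lineSep_mono hd hd0 hd1 hdis w.2 v.2)
    · rintro _ ⟨v, rfl⟩ x hx
      exact h.mem_lineSep_left.2 (Or.inl hx)
    · rintro _ ⟨v, rfl⟩ x hx
      exact h.mem_lineSep_right.2 (Or.inl hx)
    · rintro _ ⟨v, rfl⟩
      refine Set.eq_univ_of_forall fun x => ?_
      have h1 := h.mem_X x
      have h2 := fun z => le_total z v.1
      simp only [Set.mem_union, h.mem_lineSep_left, h.mem_lineSep_right]
      grind
  have hsep : ∀ v w : {x // x ∉ I}, v < w → ¬((v : L) = ⊥ ∧ (w : L) = ⊤) →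
      arcSep (P ⊥) (lineSep X P d v) (lineSep X P d w) ∈ U.seps := by
    intro v w hvw hn
    rw [h.arcSep_lineSep hd hd0 hd1 hdis v.2 w.2 hvw.le]
    exact h.sep v v.2 w w.2 hvw hn
  exact
  { mono := fun v w hvw => h.lineSep_mono hd hd0 hd1 hdis v.2 w.2 hvw
    exists_bot := ⟨⟨⊥, h.bot_notMem⟩, fun c => bot_le (a := c.1), h.lineSep_bot hd0⟩
    exists_top := ⟨⟨⊤, h.top_notMem⟩, fun c => le_top (a := c.1), h.lineSep_top hd1⟩
    sys :=
    { hchain with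
      card := by
        rintro _ ⟨v, rfl⟩
        rw [h.pt_lineSep hdis v.2]
        exact h.card v v.2
      sep := by
        rintro _ ⟨v, rfl⟩ _ ⟨w, rfl⟩ hvw hn
        refine hsep v w ?_ ?_
        · exact not_le.1 fun h' => hvw.not_ge (h.lineSep_mono hd hd0 hd1 hdis w.2 v.2 h')
        · rintro ⟨e1, e2⟩
          refine hn ⟨?_, ?_⟩
          · show lineSep X P d v = _
            rw [e1, h.lineSep_bot hd0]
          · show lineSep X P d w = _
            rw [e2, h.lineSep_top hd1] }
    sep := by
      rintro v w hvw hc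
      refine hsep v w hvw ?_
      rintro ⟨e1, e2⟩
      rcases hc with ⟨c, hc⟩ | ⟨c, hc⟩
      · have : (c : L) < v := hc
        rw [e1] at this
        exact not_lt_bot this
      · have : (w : L) < c := hc
        rw [e2] at this
        exact not_top_lt this
    exists_isLUB := h.exists_isLUB
    exists_covBy := fun a b hab => h.exists_covBy_between hab
    loc := by
      intro x hx
      rw [h.mem_X] at hx
      push Not at hx
      obtain ⟨z, hz⟩ := hx
      by_cases hzI : z ∈ I
      · obtain ⟨p, s, hps, h1, h2, h3⟩ := h.exists_covBy hzI
        refine Or.inr ⟨p, s, hps, ?_⟩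
        rw [h.arcIn_lineSep hd hd0 hd1 hdis p.2 s.2 hps.1.le]
        exact Or.inr ⟨z, h1.le, h2.le, hz⟩
      · refine Or.inl ⟨⟨z, hzI⟩, ?_⟩
        rwa [h.pt_lineSep hdis hzI]
    star := by
      intro p s p' s' hps hps' e1 e2 e3
      -- A jump whose two ends have the same pair carries a petal with the vertex set of the cut
      -- point; axiom 4 applies to such petals.
      have key : ∀ {p s : {x // x ∉ I}}, p ⋖ s → lineSep X P d p = lineSep X P d s →
          ∃ i ∈ I, (p : L) < i ∧ i < s ∧ (∀ x, (p : L) < x → x < s → x = i) ∧ P i = P p := by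
        intro p s hps e
        obtain ⟨i, hi, h1, h2, h3⟩ := h.exists_petal_of_covBy hps
        refine ⟨i, hi, h1, h2, h3, subset_antisymm ?_ ?_⟩
        · intro x hx
          have h4 : x ∈ arcIn (P ⊥) (lineSep X P d p) (lineSep X P d s) := by
            rw [h.arcIn_lineSep hd hd0 hd1 hdis p.2 s.2 hps.1.le]
            exact Or.inr ⟨i, h1.le, h2.le, hx⟩
          rw [← e, hchain.arcIn_self ⟨p, rfl⟩, h.pt_lineSep hdis p.2] at h4
          exact h4.resolve_right fun h' => h.notMem_of_mem_X h' _ hx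
        · refine h.neighbor i hi p (Or.inl ⟨h1, fun x hx hx' => ?_⟩)
          exact hx'.ne (h3 x hx (hx'.trans h2))
      rw [h.pt_lineSep hdis p.2, h.pt_lineSep hdis p'.2] at e3
      obtain ⟨i, hi, h1, h2, h3, h4⟩ := key hps e1
      obtain ⟨j, hj, h1', h2', h3', h4'⟩ := key hps' e2
      have hij : i = j := h.star i hi j hj (by rw [h4]; exact h.card p p.2) (by rw [h4, h4', e3])
      subst hij
      refine le_antisymm (not_lt.1 fun h' => ?_) (not_lt.1 fun h' => ?_)
      · exact p.2 (h3' p h' (h1.trans h2') ▸ hi)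
      · exact p'.2 (h3 p' h' (h1'.trans h2) ▸ hi)
    mid := by
      refine ⟨⟨d, hd⟩, ⟨⟨⊥, h.bot_notMem⟩, bot_lt_iff_ne_bot.2 hd0⟩,
        ⟨⟨⊤, h.top_notMem⟩, lt_top_iff_ne_top.2 hd1⟩, ?_⟩
      rw [h.pt_lineSep hdis hd]
      exact hdis }

end LinFlower

/-! ### From families of separations to pseudoflowers -/

open VSep

/-- A linear order with a new element inserted into each of its jumps. -/
def JumpLine (K : Type u) [LinearOrder K] : Type u :=
  {x : K ×ₗ Bool // (ofLex x).2 = true → ∃ s, (ofLex x).1 ⋖ s}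

namespace JumpLine

variable {K : Type u} [LinearOrder K]

noncomputable instance : LinearOrder (JumpLine K) :=
  inferInstanceAs (LinearOrder {x : K ×ₗ Bool // (ofLex x).2 = true → ∃ s, (ofLex x).1 ⋖ s})

/-- The elements of the original order. -/
def cut (a : K) : JumpLine K := ⟨toLex (a, false), fun h => absurd h Bool.false_ne_true⟩

/-- The new element in a jump. -/
def petal {p s : K} (h : p ⋖ s) : JumpLine K := ⟨toLex (p, true), fun _ => ⟨s, h⟩⟩

theorem cut_or_petal (x : JumpLine K) : (∃ a, x = cut a) ∨ ∃ (p s : K) (h : p ⋖ s), x = petal h := by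
  obtain ⟨⟨a, b⟩, h⟩ := x
  cases b
  · exact Or.inl ⟨a, rfl⟩
  · obtain ⟨s, hs⟩ := h rfl
    exact Or.inr ⟨a, s, hs, rfl⟩

theorem lt_def {x y : JumpLine K} : x < y ↔ (ofLex x.1).1 < (ofLex y.1).1 ∨
    (ofLex x.1).1 = (ofLex y.1).1 ∧ (ofLex x.1).2 < (ofLex y.1).2 := Prod.Lex.lt_iff

@[simp] theorem cut_lt_cut {a b : K} : cut a < cut b ↔ a < b := by
  rw [lt_def]; simp [cut]

@[simp] theorem cut_le_cut {a b : K} : cut a ≤ cut b ↔ a ≤ b := by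
  rw [← not_lt, ← not_lt, cut_lt_cut]

theorem cut_injective : Function.Injective (cut : K → JumpLine K) := fun _ _ h =>
  le_antisymm (cut_le_cut.1 h.le) (cut_le_cut.1 h.ge)

@[simp] theorem cut_lt_petal {a p s : K} {h : p ⋖ s} : cut a < petal h ↔ a ≤ p := by
  rw [lt_def]; simp [cut, petal, le_iff_lt_or_eq]

@[simp] theorem petal_lt_cut {a p s : K} {h : p ⋖ s} : petal h < cut a ↔ p < a := by
  rw [lt_def]; simp [cut, petal]

@[simp] theorem petal_lt_petal {p s q t : K} {h : p ⋖ s} {h' : q ⋖ t} :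
    petal h < petal h' ↔ p < q := by
  rw [lt_def]; simp [petal]

@[simp] theorem cut_le_petal {a p s : K} {h : p ⋖ s} : cut a ≤ petal h ↔ a ≤ p := by
  rw [← not_lt, petal_lt_cut, not_lt]

@[simp] theorem petal_le_cut {a p s : K} {h : p ⋖ s} : petal h ≤ cut a ↔ p < a := by
  rw [← not_lt, cut_lt_petal, not_le]

theorem petal_eq {p s q t : K} {h : p ⋖ s} {h' : q ⋖ t} (e : p = q) : petal h = petal h' := by
  subst e; rfl

noncomputable instance [BoundedOrder K] : BoundedOrder (JumpLine K) where
  top := cut ⊤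
  le_top x := by
    rcases cut_or_petal x with ⟨a, rfl⟩ | ⟨p, s, h, rfl⟩
    · exact cut_le_cut.2 le_top
    · exact petal_le_cut.2 (h.1.trans_le le_top)
  bot := cut ⊥
  bot_le x := by
    rcases cut_or_petal x with ⟨a, rfl⟩ | ⟨p, s, h, rfl⟩
    · exact cut_le_cut.2 bot_le
    · exact cut_le_petal.2 bot_le

theorem cut_bot [BoundedOrder K] : cut (⊥ : K) = ⊥ := rfl

theorem cut_top [BoundedOrder K] : cut (⊤ : K) = ⊤ := rfl

/-- The set of the new elements. -/
def petals (K : Type u) [LinearOrder K] : Set (JumpLine K) := {x | (ofLex x.1).2 = true}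

@[simp] theorem cut_notMem (a : K) : cut a ∉ petals K := Bool.false_ne_true

@[simp] theorem petal_mem {p s : K} (h : p ⋖ s) : petal h ∈ petals K := rfl

theorem exists_eq_cut {x : JumpLine K} (hx : x ∉ petals K) : ∃ a, x = cut a := by
  rcases cut_or_petal x with h | ⟨p, s, h, rfl⟩
  · exact h
  · exact absurd (petal_mem h) hx

theorem exists_eq_petal {x : JumpLine K} (hx : x ∈ petals K) :
    ∃ (p s : K) (h : p ⋖ s), x = petal h := by
  rcases cut_or_petal x with ⟨a, rfl⟩ | h
  · exact absurd hx (cut_notMem a)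
  · exact h

/-- The family of vertex sets that belongs to a family of separations. -/
def family {V : Type u} (X P₀ : Set V) (e : K → VSep V) (x : JumpLine K) : Set V :=
  {y | ((ofLex x.1).2 = false ∧ y ∈ pt X P₀ (e (ofLex x.1).1)) ∨
    ((ofLex x.1).2 = true ∧ y ∉ X ∧ ∃ s, (ofLex x.1).1 ⋖ s ∧
      y ∈ arcIn P₀ (e (ofLex x.1).1) (e s))}

theorem family_cut {V : Type u} (X P₀ : Set V) (e : K → VSep V) (a : K) :
    family X P₀ e (cut a) = pt X P₀ (e a) := by
  ext y
  simp [family, cut]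

theorem family_petal {V : Type u} (X P₀ : Set V) (e : K → VSep V) {p s : K} (h : p ⋖ s) :
    family X P₀ e (petal h) = arcIn P₀ (e p) (e s) \ X := by
  ext y
  simp only [family, petal, ofLex_toLex, Bool.true_eq_false, false_and, true_and, false_or,
    Set.mem_ofPred_eq, Set.mem_sdiff]
  constructor
  · rintro ⟨hy, s', hs', h'⟩
    rw [h.unique_right hs']
    exact ⟨h', hy⟩
  · exact fun h' => ⟨h'.2, s, h, h'.1⟩

/-- A lower set of petals is cut off at the supremum of the upper ends of their jumps; the jump in
each interval of `K` provides a petal between two cuts. -/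
theorem isLineCompletion [BoundedOrder K] (hlub : ∀ S : Set K, ∃ a, IsLUB S a)
    (hcov : ∀ a b : K, a < b → ∃ p s, a ≤ p ∧ p ⋖ s ∧ s ≤ b) : IsLineCompletion (petals K) where
  bot_notMem := cut_notMem ⊥
  top_notMem := cut_notMem ⊤
  exists_cut J hJ hlow := by
    obtain ⟨a, ha⟩ := hlub {s | ∃ (p : K) (h : p ⋖ s), petal h ∈ J}
    refine ⟨cut a, cut_notMem a, fun x hx => ?_⟩
    obtain ⟨q, t, hqt, rfl⟩ := exists_eq_petal hx
    rw [petal_lt_cut]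
    constructor
    · intro hq
      exact hqt.1.trans_le (ha.1 ⟨q, hqt, hq⟩)
    · intro hqa
      by_contra hq
      refine hqa.not_ge (ha.2 ?_)
      rintro s ⟨p, hps, hp⟩
      by_contra! hqs
      rcases (hps.le_of_lt hqs : q ≤ p).eq_or_lt with e | hlt
      · exact hq (petal_eq (h := hqt) (h' := hps) e ▸ hp)
      · exact hq (hlow _ hp _ hx (petal_lt_petal.2 hlt))
  exists_between v hv w hw hvw := by
    obtain ⟨a, rfl⟩ := exists_eq_cut hv
    obtain ⟨b, rfl⟩ := exists_eq_cut hw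
    obtain ⟨p, s, hap, hps, hsb⟩ := hcov a b (cut_lt_cut.1 hvw)
    exact ⟨petal hps, petal_mem hps, cut_lt_petal.2 hap, petal_lt_cut.2 (hps.1.trans_le hsb)⟩

theorem eq_of_cut_covBy {a p s : K} {h : p ⋖ s} (hc : cut a ⋖ petal h) : a = p := by
  have h1 := cut_lt_petal.1 hc.1
  refine h1.antisymm (not_lt.1 fun hlt => ?_)
  exact hc.2 (cut_lt_cut.2 hlt) (cut_lt_petal.2 le_rfl)

theorem eq_of_covBy_cut {a p s : K} {h : p ⋖ s} (hc : petal h ⋖ cut a) : a = s := by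
  have h1 := petal_lt_cut.1 hc.1
  refine le_antisymm (not_lt.1 fun hlt => ?_) (not_lt.1 fun hlt => h.2 h1 hlt)
  exact hc.2 (petal_lt_cut.2 h.1) (cut_lt_cut.2 hlt)

theorem not_petal_covBy_petal {p s q t : K} {h : p ⋖ s} {h' : q ⋖ t} : ¬ petal h ⋖ petal h' :=
  fun hc => hc.2 (petal_lt_cut.2 h.1) (cut_lt_petal.2 (not_lt.1 fun hlt =>
    h.2 (petal_lt_petal.1 hc.1) hlt))

end JumpLine

theorem arcIn_subset_arcOut {V : Type u} (P₀ : Set V) {s t v w : VSep V} (h : t ≤ v ∨ w ≤ s) :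
    arcIn P₀ s t ⊆ arcOut P₀ v w := by
  rintro x (⟨h1, h2⟩ | ⟨h1, -⟩)
  · rcases h with h | h
    · exact Or.inl (Or.inl (h.1 h1))
    · exact Or.inl (Or.inr (h.2 h2))
  · exact Or.inr h1

namespace LinModel

variable {V K : Type u} [LinearOrder K] {U : SepUniverse V} {k : ℕ} {X P₀ : Set V} {e : K → VSep V}

/-- The place of `x`, a cut point or a jump, lies inside `[v, w]` or outside it. As `x` is not in
the separator, this decides which of the two sides contains `x`. -/
theorem subset_arcIn_of_notMem_X (h : LinModel U k X P₀ e) {v w : K} (hvw : v ≤ w) {x : V}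
    (hx : x ∉ X) (hxv : x ∉ pt X P₀ (e v)) (hxw : x ∉ pt X P₀ (e w)) :
    ((∃ a, v ≤ a ∧ a ≤ w ∧ x ∈ pt X P₀ (e a)) ∨
      ∃ p s, p ⋖ s ∧ v ≤ p ∧ s ≤ w ∧ x ∈ arcIn P₀ (e p) (e s)) ∧ x ∉ arcOut P₀ (e v) (e w) ∨
    ((∃ a, (a ≤ v ∨ w ≤ a) ∧ x ∈ pt X P₀ (e a)) ∨
      ∃ p s, p ⋖ s ∧ (s ≤ v ∨ w ≤ p) ∧ x ∈ arcIn P₀ (e p) (e s)) ∧ x ∉ arcIn P₀ (e v) (e w) := by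
  have hnot : ¬ (x ∈ arcIn P₀ (e v) (e w) ∧ x ∈ arcOut P₀ (e v) (e w)) := by
    intro h'
    have h'' : x ∈ pt X P₀ (e v) ∪ pt X P₀ (e w) ∪ X := by
      rw [← h.sys.inter ⟨v, rfl⟩ ⟨w, rfl⟩ (h.mono hvw)]; exact h'
    rcases h'' with (h'' | h'') | h''
    exacts [hxv h'', hxw h'', hx h'']
  rcases h.loc x hx with ⟨a, ha⟩ | ⟨p, s, hps, hxs⟩
  · by_cases hc : v ≤ a ∧ a ≤ w
    · exact Or.inl ⟨Or.inl ⟨a, hc.1, hc.2, ha⟩, fun h' => hnot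
        ⟨arcIn_mono P₀ (h.mono hc.1) (h.mono hc.2) ha.1, h'⟩⟩
    · have hc' : a ≤ v ∨ w ≤ a := by grind
      exact Or.inr ⟨Or.inl ⟨a, hc', ha⟩, fun h' => hnot ⟨h', arcIn_subset_arcOut P₀
        (hc'.imp (fun h => ‹LinModel U k X P₀ e›.mono h) fun h => ‹LinModel U k X P₀ e›.mono h)
        ha.1⟩⟩
  · by_cases hc : v ≤ p ∧ s ≤ w
    · exact Or.inl ⟨Or.inr ⟨p, s, hps, hc.1, hc.2, hxs⟩, fun h' => hnot
        ⟨arcIn_mono P₀ (h.mono hc.1) (h.mono hc.2) hxs, h'⟩⟩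
    · have hc' : s ≤ v ∨ w ≤ p := by
        have h1 := fun h' : p < v => not_lt.1 (hps.2 h')
        have h2 := fun h' : w < s => not_lt.1 fun h'' => hps.2 h'' h'
        grind
      exact Or.inr ⟨Or.inr ⟨p, s, hps, hc', hxs⟩, fun h' => hnot ⟨h', arcIn_subset_arcOut P₀
        (hc'.imp (fun h => ‹LinModel U k X P₀ e›.mono h) fun h => ‹LinModel U k X P₀ e›.mono h)
        hxs⟩⟩

theorem lineIn_cut (h : LinModel U k X P₀ e) {v w : K} (hvw : v ≤ w) :
    lineIn X (JumpLine.family X P₀ e) (JumpLine.cut v) (JumpLine.cut w) =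
      arcIn P₀ (e v) (e w) := by
  ext x
  constructor
  · rintro (hx | ⟨z, h1, h2, hx⟩)
    · exact Or.inl ⟨h.sys.left _ ⟨w, rfl⟩ hx, h.sys.right _ ⟨v, rfl⟩ hx⟩
    · rcases JumpLine.cut_or_petal z with ⟨a, rfl⟩ | ⟨p, s, hps, rfl⟩
      · rw [JumpLine.family_cut] at hx
        exact arcIn_mono P₀ (h.mono (JumpLine.cut_le_cut.1 h1)) (h.mono (JumpLine.cut_le_cut.1 h2))
          hx.1
      · rw [JumpLine.family_petal] at hx
        have h3 : s ≤ w := not_lt.1 fun h' => hps.2 (JumpLine.petal_le_cut.1 h2) h'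
        exact arcIn_mono P₀ (h.mono (JumpLine.cut_le_petal.1 h1)) (h.mono h3) hx.1
  · intro hx
    by_cases hX : x ∈ X
    · exact Or.inl hX
    by_cases hv : x ∈ pt X P₀ (e v)
    · exact Or.inr ⟨_, le_rfl, JumpLine.cut_le_cut.2 hvw, by rwa [JumpLine.family_cut]⟩
    by_cases hw : x ∈ pt X P₀ (e w)
    · exact Or.inr ⟨_, JumpLine.cut_le_cut.2 hvw, le_rfl, by rwa [JumpLine.family_cut]⟩
    rcases h.subset_arcIn_of_notMem_X hvw hX hv hw with ⟨h1, -⟩ | ⟨-, h1⟩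
    · rcases h1 with ⟨a, h1, h2, h3⟩ | ⟨p, s, hps, h1, h2, h3⟩
      · exact Or.inr ⟨_, JumpLine.cut_le_cut.2 h1, JumpLine.cut_le_cut.2 h2,
          by rwa [JumpLine.family_cut]⟩
      · refine Or.inr ⟨JumpLine.petal hps, JumpLine.cut_le_petal.2 h1,
          JumpLine.petal_le_cut.2 (hps.1.trans_le h2), ?_⟩
        rw [JumpLine.family_petal]
        exact ⟨h3, hX⟩
    · exact absurd hx h1

theorem bot_or_top (h : LinModel U k X P₀ e) [BoundedOrder K] : e ⊥ = botSep X ∧ e ⊤ = topSep X := by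
  obtain ⟨a, ha, ha'⟩ := h.exists_bot
  obtain ⟨b, hb, hb'⟩ := h.exists_top
  rw [← (ha ⊥).antisymm bot_le, ← le_top.antisymm (hb ⊤)]
  exact ⟨ha', hb'⟩

theorem lineOut_cut (h : LinModel U k X P₀ e) [BoundedOrder K] {v w : K} (hvw : v ≤ w) :
    lineOut X (JumpLine.family X P₀ e) (JumpLine.cut v) (JumpLine.cut w) =
      arcOut P₀ (e v) (e w) := by
  ext x
  constructor
  · rintro (hx | ⟨z, h1, hx⟩)
    · exact Or.inl (Or.inl (h.sys.left _ ⟨v, rfl⟩ hx))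
    · rcases JumpLine.cut_or_petal z with ⟨a, rfl⟩ | ⟨p, s, hps, rfl⟩
      · rw [JumpLine.family_cut] at hx
        exact arcIn_subset_arcOut P₀ (h1.imp (fun h' => h.mono (JumpLine.cut_le_cut.1 h'))
          fun h' => h.mono (JumpLine.cut_le_cut.1 h')) hx.1
      · rw [JumpLine.family_petal] at hx
        refine arcIn_subset_arcOut P₀ (h1.imp (fun h' => h.mono (not_lt.1 fun h3 => ?_))
          fun h' => h.mono (JumpLine.cut_le_petal.1 h')) hx.1
        exact hps.2 (JumpLine.petal_le_cut.1 h') h3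
  · intro hx
    by_cases hX : x ∈ X
    · exact Or.inl hX
    by_cases hv : x ∈ pt X P₀ (e v)
    · exact Or.inr ⟨_, Or.inl le_rfl, by rwa [JumpLine.family_cut]⟩
    by_cases hw : x ∈ pt X P₀ (e w)
    · exact Or.inr ⟨_, Or.inr le_rfl, by rwa [JumpLine.family_cut]⟩
    rcases h.subset_arcIn_of_notMem_X hvw hX hv hw with ⟨-, h1⟩ | ⟨h1, -⟩
    · exact absurd hx h1
    · rcases h1 with ⟨a, h1, h3⟩ | ⟨p, s, hps, h1, h3⟩
      · exact Or.inr ⟨_, h1.imp JumpLine.cut_le_cut.2 JumpLine.cut_le_cut.2,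
          by rwa [JumpLine.family_cut]⟩
      · refine Or.inr ⟨JumpLine.petal hps, h1.imp
          (fun h' => JumpLine.petal_le_cut.2 (hps.1.trans_le h')) JumpLine.cut_le_petal.2, ?_⟩
        rw [JumpLine.family_petal]
        exact ⟨h3, hX⟩

/-- Adjacent separations are equal if the arc between them is as small as a cut point. -/
theorem eq_of_arcIn_subset (h : LinModel U k X P₀ e) {p s : K} (hps : p ⋖ s)
    (h1 : arcIn P₀ (e p) (e s) \ X ⊆ pt X P₀ (e p)) (h2 : arcIn P₀ (e p) (e s) \ X ⊆ pt X P₀ (e s)) :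
    e p = e s := by
  obtain ⟨d, -, -, hd⟩ := h.mid
  have hd' : ∀ x ∈ P₀, x ∉ (e d).left ∧ x ∉ (e d).right := fun x hx =>
    notMem_of_disjoint_pt h.sys.disj hd hx
  have hle := h.mono hps.1.le
  -- A jump lies on one side of `d`. There, only one of the two components of a pair can contain
  -- vertices of `P₀`; this settles what `arcIn` alone leaves open for these vertices.
  have hds : d ≤ p ∨ s ≤ d := (le_or_gt d p).imp_right fun h' => not_lt.1 (hps.2 h')
  have key : ∀ x, (x ∈ (e s).left → x ∈ (e p).left) ∧ (x ∈ (e p).right → x ∈ (e s).right) := by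
    intro x
    have c1 : x ∈ (e p).left ∪ (e p).right ∪ P₀ := h.sys.cover _ ⟨p, rfl⟩ ▸ Set.mem_univ x
    have c2 : x ∈ (e s).left ∪ (e s).right ∪ P₀ := h.sys.cover _ ⟨s, rfl⟩ ▸ Set.mem_univ x
    have c3 := fun hx => h.sys.left _ ⟨p, rfl⟩ (a := x) hx
    have c4 := fun hx => h.sys.right _ ⟨s, rfl⟩ (a := x) hx
    have c5 := hd' x
    have c6 := @h1 x
    have c7 := @h2 x
    have c8 : (x ∈ (e d).left → x ∈ (e p).left) ∧ (x ∈ (e p).right → x ∈ (e d).right) ∨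
        (x ∈ (e s).left → x ∈ (e d).left) ∧ (x ∈ (e d).right → x ∈ (e s).right) :=
      hds.imp (fun h' => ⟨fun hx => (h.mono h').1 hx, fun hx => (h.mono h').2 hx⟩)
        fun h' => ⟨fun hx => (h.mono h').1 hx, fun hx => (h.mono h').2 hx⟩
    have c9 := @hle.1 x
    have c10 := @hle.2 x
    simp only [pt, arcIn, Set.mem_union, Set.mem_inter_iff, Set.mem_sdiff] at *
    grind
  exact VSep.ext (hle.1.antisymm fun x => (key x).1) (subset_antisymm (fun x => (key x).2) hle.2)

theorem encard_pt_eq (h : LinModel U k X P₀ e) : ∃ m : ℕ, (∀ a, (pt X P₀ (e a)).encard = m) ∧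
    ∀ s : Set V, 2 * s.encard + X.encard = k → s.encard = m := by
  obtain ⟨m, hm, hc⟩ := h.sys.exists_card
  refine ⟨m, fun a => (hc _).1 (h.sys.card _ ⟨a, rfl⟩), fun s hs => ?_⟩
  have hXf : X.encard ≠ ⊤ := by
    intro h'
    rw [h', top_add] at hm
    exact ENat.natCast_ne_top k hm.symm
  have hsf : s.encard ≠ ⊤ := by
    intro h'
    rw [h', ENat.mul_top (by norm_num), top_add] at hs
    exact ENat.natCast_ne_top k hs.symm
  obtain ⟨x, hx⟩ := ENat.ne_top_iff_exists.1 hXf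
  obtain ⟨y, hy⟩ := ENat.ne_top_iff_exists.1 hsf
  rw [← hx] at hm hs
  rw [← hy] at hs ⊢
  norm_cast at hm hs ⊢
  omega

theorem linFlower (h : LinModel U k X P₀ e) [BoundedOrder K] :
    LinFlower U k X (JumpLine.petals K) (JumpLine.family X P₀ e) := by
  obtain ⟨e0, e1⟩ := h.bot_or_top
  have hn : ∀ {v w : K}, ¬(JumpLine.cut v = ⊥ ∧ JumpLine.cut w = ⊤) →
      (∃ c, c < v) ∨ ∃ c, w < c := by
    intro v w hn
    by_cases hv : v = ⊥
    · right
      refine ⟨⊤, lt_top_iff_ne_top.2 fun hw => hn ⟨by rw [hv]; rfl, by rw [hw]; rfl⟩⟩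
    · exact Or.inl ⟨⊥, bot_lt_iff_ne_bot.2 hv⟩
  refine { JumpLine.isLineCompletion h.exists_isLUB h.exists_covBy with
    nontrivial := ?_
    top_eq := ?_
    mem_X := fun x => ?_
    card := fun v hv => ?_
    sep := fun v hv w hw hvw hvw' => ?_
    inter := fun v hv w hw hvw hvw' => ?_
    neighbor := ?_
    star := ?_ }
  · obtain ⟨d, ⟨a, ha⟩, ⟨b, hb⟩, -⟩ := h.mid
    obtain ⟨p, s, -, hps, hsd⟩ := h.exists_covBy a d ha
    obtain ⟨q, t, hdq, hqt, -⟩ := h.exists_covBy d b hb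
    exact ⟨_, JumpLine.petal_mem hps, _, JumpLine.petal_mem hqt,
      (JumpLine.petal_lt_petal.2 ((hps.1.trans_le hsd).trans_le hdq)).ne⟩
  · rw [← JumpLine.cut_bot, ← JumpLine.cut_top, JumpLine.family_cut, JumpLine.family_cut, e0, e1,
      h.sys.pt_bot, h.sys.pt_top]
  · constructor
    · intro hx z hz
      rcases JumpLine.cut_or_petal z with ⟨a, rfl⟩ | ⟨p, s, hps, rfl⟩
      · rw [JumpLine.family_cut] at hz; exact hz.2 hx
      · rw [JumpLine.family_petal] at hz; exact hz.2 hx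
    · intro H
      by_contra hx
      rcases h.loc x hx with ⟨a, ha⟩ | ⟨p, s, hps, hxs⟩
      · exact H (JumpLine.cut a) (by rwa [JumpLine.family_cut])
      · exact H (JumpLine.petal hps) (by rw [JumpLine.family_petal]; exact ⟨hxs, hx⟩)
  · obtain ⟨a, rfl⟩ := JumpLine.exists_eq_cut hv
    rw [JumpLine.family_cut]
    exact h.sys.card _ ⟨a, rfl⟩
  · obtain ⟨a, rfl⟩ := JumpLine.exists_eq_cut hv
    obtain ⟨b, rfl⟩ := JumpLine.exists_eq_cut hw
    have hab := JumpLine.cut_lt_cut.1 hvw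
    rw [h.lineIn_cut hab.le, h.lineOut_cut hab.le]
    exact h.sep a b hab (hn hvw')
  · obtain ⟨a, rfl⟩ := JumpLine.exists_eq_cut hv
    obtain ⟨b, rfl⟩ := JumpLine.exists_eq_cut hw
    have hab := JumpLine.cut_lt_cut.1 hvw
    rw [h.lineIn_cut hab.le, h.lineOut_cut hab.le, JumpLine.family_cut, JumpLine.family_cut]
    exact h.sys.inter ⟨a, rfl⟩ ⟨b, rfl⟩ (h.mono hab.le)
  · intro i hi c hc
    obtain ⟨p, s, hps, rfl⟩ := JumpLine.exists_eq_petal hi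
    rw [JumpLine.family_petal]
    rcases JumpLine.cut_or_petal c with ⟨a, rfl⟩ | ⟨q, t, hqt, rfl⟩
    · rw [JumpLine.family_cut]
      refine Set.sdiff_subset_sdiff_left ?_
      rcases hc with hc | hc
      · rw [JumpLine.eq_of_cut_covBy hc]
        exact arcIn_mono P₀ le_rfl (h.mono hps.1.le)
      · rw [JumpLine.eq_of_covBy_cut hc]
        exact arcIn_mono P₀ (h.mono hps.1.le) le_rfl
    · exact (hc.elim JumpLine.not_petal_covBy_petal JumpLine.not_petal_covBy_petal).elim
  · intro i hi j hj hc hij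
    obtain ⟨p, s, hps, rfl⟩ := JumpLine.exists_eq_petal hi
    obtain ⟨q, t, hqt, rfl⟩ := JumpLine.exists_eq_petal hj
    obtain ⟨m, hm, hm'⟩ := h.encard_pt_eq
    -- A petal contains both neighbouring cut points. If it has only `m` vertices, it equals both of
    -- them, and the two ends of the jump have the same pair.
    have key : ∀ {p s : K} (hps : p ⋖ s), (arcIn P₀ (e p) (e s) \ X).encard = m →
        arcIn P₀ (e p) (e s) \ X = pt X P₀ (e p) ∧ e p = e s := by
      intro p s hps hc
      have hf : (arcIn P₀ (e p) (e s) \ X).Finite := by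
        rw [← Set.encard_ne_top_iff, hc]; exact ENat.natCast_ne_top m
      have h1 : pt X P₀ (e p) = arcIn P₀ (e p) (e s) \ X :=
        hf.eq_of_subset_of_encard_le'
          (Set.sdiff_subset_sdiff_left (arcIn_mono P₀ le_rfl (h.mono hps.1.le)))
          (by rw [hc, hm])
      have h2 : pt X P₀ (e s) = arcIn P₀ (e p) (e s) \ X :=
        hf.eq_of_subset_of_encard_le'
          (Set.sdiff_subset_sdiff_left (arcIn_mono P₀ (h.mono hps.1.le) le_rfl))
          (by rw [hc, hm])
      exact ⟨h1.symm, h.eq_of_arcIn_subset hps h1.symm.subset h2.symm.subset⟩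
    have hci := hm' _ hc
    rw [JumpLine.family_petal, JumpLine.family_petal] at hij
    rw [JumpLine.family_petal] at hci
    obtain ⟨k1, k2⟩ := key hps hci
    obtain ⟨k3, k4⟩ := key hqt (by rw [← hij]; exact hci)
    refine JumpLine.petal_eq (h.star p s q t hps hqt k2 k4 ?_)
    rw [← k1, ← k3, hij]

end LinModel

/-! ### Extensions of pseudoflowers and refinements of lines -/

open VSep

/-- A strictly monotone map of indexed families of separations that adds new elements only to the
jumps. -/
structure IsRefinement {S K₁ K₂ : Type u} [LinearOrder K₁] [LinearOrder K₂] (e₁ : K₁ → S)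
    (e₂ : K₂ → S) (g : K₁ → K₂) : Prop where
  strictMono : StrictMono g
  comp : ∀ a, e₂ (g a) = e₁ a
  cover : ∀ c, (∃ a, g a = c) ∨ ∃ p s, p ⋖ s ∧ g p < c ∧ c < g s

namespace IsRefinement

variable {S K₁ K₂ K₃ : Type u} [LinearOrder K₁] [LinearOrder K₂] [LinearOrder K₃] {e₁ : K₁ → S}
  {e₂ : K₂ → S} {e₃ : K₃ → S} {g : K₁ → K₂} {g' : K₂ → K₃}

theorem exists_covBy (h : IsRefinement e₁ e₂ g) {c c' : K₂} (hc : c ⋖ c') :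
    ∃ p s, p ⋖ s ∧ g p ≤ c ∧ c' ≤ g s := by
  rcases h.cover c with ⟨a, rfl⟩ | ⟨p, s, hps, h1, h2⟩
  · rcases h.cover c' with ⟨b, rfl⟩ | ⟨p, s, hps, h1, h2⟩
    · refine ⟨a, b, ⟨h.strictMono.lt_iff_lt.1 hc.1, fun x hx hx' => ?_⟩, le_rfl, le_rfl⟩
      exact hc.2 (h.strictMono hx) (h.strictMono hx')
    · exact ⟨p, s, hps, hc.le_of_lt h1, h2.le⟩
  · exact ⟨p, s, hps, h1.le, not_lt.1 (hc.2 h2)⟩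

theorem trans (h : IsRefinement e₁ e₂ g) (h' : IsRefinement e₂ e₃ g') :
    IsRefinement e₁ e₃ (g' ∘ g) where
  strictMono := h'.strictMono.comp h.strictMono
  comp a := (h'.comp (g a)).trans (h.comp a)
  cover c := by
    rcases h'.cover c with ⟨b, rfl⟩ | ⟨p, s, hps, h1, h2⟩
    · rcases h.cover b with ⟨a, rfl⟩ | ⟨p, s, hps, h1, h2⟩
      · exact Or.inl ⟨a, rfl⟩
      · exact Or.inr ⟨p, s, hps, h'.strictMono h1, h'.strictMono h2⟩
    · obtain ⟨q, t, hqt, h3, h4⟩ := h.exists_covBy hps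
      exact Or.inr ⟨q, t, hqt, (h'.strictMono.monotone h3).trans_lt h1,
        h2.trans_le (h'.strictMono.monotone h4)⟩

theorem map_top (h : IsRefinement e₁ e₂ g) {a : K₁} {c : K₂} (ha : ∀ x, x ≤ a) (hc : ∀ x, x ≤ c) :
    g a = c := by
  rcases h.cover c with ⟨b, rfl⟩ | ⟨p, s, hps, h1, h2⟩
  · exact (hc _).antisymm (h.strictMono.monotone (ha b))
  · exact absurd (hc _) h2.not_ge

end IsRefinement

namespace Pseudoflower

variable {V : Type u} {U : SepUniverse V} {k : ℕ} {Φ Ψ : Pseudoflower U k}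

theorem exists_petals_between (Φ : Pseudoflower U k) {v w : Φ.C} (hv : v ∉ Φ.I) (hw : w ∉ Φ.I)
    (hvw : v ≠ w) : ∃ i ∈ Φ.I, ∃ j ∈ Φ.I, sbtw v i w ∧ sbtw w j v := by
  have h := Line.isLineCompletion Φ.completion hv Φ.nontrivial
  have h0 : (⊥ : Line v) < Line.of v w :=
    bot_lt_iff_ne_bot.2 (Line.of_injective.ne hvw.symm : Line.of v w ≠ Line.of v v)
  obtain ⟨_, ⟨i, hi, rfl⟩, h1, h2⟩ := h.exists_between ⊥ h.bot_notMem _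
    (fun h' => hw (Line.of_mem_image.1 h')) h0
  obtain ⟨_, ⟨j, hj, rfl⟩, h3, h4⟩ := h.exists_between _
    (fun h' => hw (Line.of_mem_image.1 h')) ⊤ h.top_notMem (Line.of_lt_top w)
  refine ⟨i, hi, j, hj, ?_, ?_⟩
  · exact (Line.sbtw_iff (b := v)).2 (Or.inl ⟨h1, h2⟩)
  · exact (Line.sbtw_iff (b := v)).2 (Or.inr (Or.inr ⟨h0, h3⟩))

/-- For distinct `v` and `w` with a common image, monotonicity forces a petal in `]v, w[` and a
petal in `]w, v[` to have the same image. Then all petals have the same image, although the image of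
the petals has at least two elements. -/
theorem eq_of_map_eq {F : Ψ.C → Φ.C} (hF : CyclicMonotone F) (hI : F '' Ψ.I = Φ.I) {v w : Ψ.C}
    (hv : v ∉ Ψ.I) (hw : w ∉ Ψ.I) (hvI : F v ∉ Φ.I) (hvw : F v = F w) : v = w := by
  by_contra hne
  have hmem : ∀ {i}, i ∈ Ψ.I → F i ∈ Φ.I := fun hi => hI ▸ Set.mem_image_of_mem F hi
  have key : ∀ i ∈ Ψ.I, ∀ j ∈ Ψ.I, sbtw v i w → sbtw w j v → F i = F j := by
    intro i hi j hj h1 h2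
    by_contra hij
    have hiv : F v ≠ F i := fun e => hvI (e ▸ hmem hi)
    have hjv : F j ≠ F v := fun e => hvI (e ▸ hmem hj)
    rw [Line.sbtw_iff (b := v)] at h1 h2
    rcases sbtw_total_of_ne hiv hij hjv with h3 | h3
    · have h4 := hF w i j (hvw ▸ h3)
      rw [Line.sbtw_iff (b := v)] at h4
      grind
    · have h4 := hF v j i h3
      rw [Line.sbtw_iff (b := v)] at h4
      have h5 := Line.of_self (b := v)
      grind
  obtain ⟨i, hi, j, hj, h1, h2⟩ := Ψ.exists_petals_between hv hw hne
  have hall : ∀ x ∈ Φ.I, x = F i := by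
    rw [← hI]
    rintro _ ⟨y, hy, rfl⟩
    have hyv : v ≠ y := fun e => hv (e ▸ hy)
    have hyw : y ≠ w := fun e => hw (e ▸ hy)
    rcases sbtw_total_of_ne hyv hyw (Ne.symm hne) with h3 | h3
    · rw [key y hy j hj h3 h2, key i hi j hj h1 h2]
    · exact (key i hi y hy h1 h3.cyclic_left).symm
  obtain ⟨a, ha, c, hc, hac⟩ := Φ.nontrivial
  exact hac ((hall a ha).trans (hall c hc).symm)

/-- An extension identifies the cut points of a pseudoflower with cut points of the other. -/
theorem ExtendedBy.exists_section (h : Φ.ExtendedBy Ψ) : ∃ (F : Ψ.C → Φ.C) (G : Φ.C → Ψ.C),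
    CyclicMonotone F ∧ F '' Ψ.I = Φ.I ∧ ∀ v ∉ Φ.I, G v ∉ Ψ.I ∧ F (G v) = v ∧
      (∀ z, F z = v → z = G v) ∧ Ψ.P (G v) = Φ.P v ∧
      ∀ w ∉ Φ.I, Φ.intervalSet v w = Ψ.intervalSet (G v) (G w) := by
  obtain ⟨hX, F, hsurj, hF, hI, hint⟩ := h
  choose G hG using hsurj
  have hnot : ∀ z, F z ∉ Φ.I → z ∉ Ψ.I := fun z hz hz' => hz (hI ▸ Set.mem_image_of_mem F hz')
  have huniq : ∀ v ∉ Φ.I, ∀ z, F z = v → z = G v := by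
    intro v hv z hz
    exact eq_of_map_eq hF hI (hnot z (hz ▸ hv)) (hnot _ (by rwa [hG])) (hz ▸ hv)
      (by rw [hG, hz])
  -- Monotonicity lifts open arcs. Conversely, an image outside the closed arc lies in the opposite
  -- open arc, and lifting that contradicts the position of `z`.
  have hpre : ∀ v ∉ Φ.I, ∀ w ∉ Φ.I, F ⁻¹' closedArc v w = closedArc (G v) (G w) := by
    intro v hv w hw
    ext z
    rw [Set.mem_preimage, mem_closedArc, mem_closedArc]
    constructor
    · rintro (h1 | h1 | h1)
      · exact Or.inl (hF _ _ _ (by rwa [hG, hG]))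
      · exact Or.inr (Or.inl (huniq v hv z h1))
      · exact Or.inr (Or.inr (huniq w hw z h1))
    · rintro (h1 | rfl | rfl)
      · by_contra hcon
        push Not at hcon
        have hvw : v ≠ w := by
          rintro rfl
          exact sbtw_irrefl_left_right h1
        rcases sbtw_total_of_ne hcon.2.1.symm hcon.2.2 hvw.symm with h2 | h2
        · exact hcon.1 h2
        · have h3 := hF (G v) (G w) z (by rwa [hG, hG])
          exact sbtw_irrefl_right (h1.trans_right h3)
      · exact Or.inr (Or.inl (hG v))
      · exact Or.inr (Or.inr (hG w))
  have hint' : ∀ v ∉ Φ.I, ∀ w ∉ Φ.I, Φ.intervalSet v w = Ψ.intervalSet (G v) (G w) := by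
    intro v hv w hw
    rw [hint v hv w hw, hpre v hv w hw, hX, Set.union_comm]
    rfl
  refine ⟨F, G, hF, hI, fun v hv => ⟨hnot _ (by rwa [hG]), hG v, huniq v hv, ?_, hint' v hv⟩⟩
  -- The degenerate arc at `v` consists of `P v` and `X`, which recovers the vertex set of `v`.
  have h1 := hint' v hv v hv
  ext x
  have h2 := Set.ext_iff.1 h1 x
  rw [mem_intervalSet, mem_intervalSet, closedArc_self, closedArc_self, hX] at h2
  simp only [Set.mem_singleton_iff, exists_eq_left] at h2
  have h3 : x ∈ Ψ.X → x ∉ Φ.P v := fun hx => by rw [← hX] at hx; exact Φ.mem_X_iff.1 hx v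
  have h4 : x ∈ Ψ.X → x ∉ Ψ.P (G v) := fun hx => Ψ.mem_X_iff.1 hx _
  tauto

end Pseudoflower

/-! ### From extensions to refinements -/

namespace LinFlower

variable {V L : Type u} [LinearOrder L] [BoundedOrder L] {U : SepUniverse V} {k : ℕ}
  {X : Set V} {I : Set L} {P : L → Set V} {d : L}

theorem lineIn_top (h : LinFlower U k X I P) (v : L) : lineIn X P v ⊤ = lineOut X P ⊥ v := by
  ext x
  refine or_congr_right ⟨?_, ?_⟩
  · rintro ⟨z, h1, -, hz⟩
    exact ⟨z, Or.inr h1, hz⟩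
  · rintro ⟨z, h1 | h1, hz⟩
    · rw [le_bot_iff.1 h1, ← h.top_eq] at hz
      exact ⟨⊤, le_top, le_rfl, hz⟩
    · exact ⟨z, h1, le_top, hz⟩

theorem lineIn_bot_top (h : LinFlower U k X I P) : lineIn X P ⊥ ⊤ = Set.univ := by
  refine Set.eq_univ_of_forall fun x => ?_
  by_cases hx : x ∈ X
  · exact Or.inl hx
  · rw [h.mem_X] at hx
    push Not at hx
    obtain ⟨z, hz⟩ := hx
    exact Or.inr ⟨z, bot_le, le_top, hz⟩

/-- An extension of a pseudoflower that is given by a line is a refinement of the line. -/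
theorem exists_refinement (h : LinFlower U k X I P) (hd : d ∉ I) (hd0 : d ≠ ⊥) (hd1 : d ≠ ⊤)
    {Ψ : Pseudoflower U k} (hΨ : h.toPseudoflower.ExtendedBy Ψ) :
    Ψ.X = X ∧ ∃ b ∉ Ψ.I, Ψ.P b = P ⊥ ∧ ∃ d' ∉ Ψ.I, d' ≠ b ∧ Ψ.P d' = P d ∧
      ∃ g : {x // x ∉ I} → {x // x ∉ Line.image b Ψ.I},
        IsRefinement (fun v : {x // x ∉ I} => lineSep X P d v)
          (fun v : {x // x ∉ Line.image b Ψ.I} => lineSep Ψ.X (Line.family b Ψ.P) (Line.of b d') v) g := by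
  have hX : Ψ.X = X := hΨ.1.symm.trans h.loopFamily_X
  refine ⟨hX, ?_⟩
  obtain ⟨F, G, hF, hI, hG⟩ := hΨ.exists_section
  let botL : Loop L := ⟨⊥, h.bot_ne_top⟩
  let dL : Loop L := ⟨d, hd1⟩
  have hbot := hG botL h.bot_notMem
  have hdL := hG dL hd
  let b : Ψ.C := G botL
  -- the map of lines
  let FL : Line b → L := fun x => WithTop.recTopCoe (C := fun _ => L) ⊤ (fun z => (F z).1) x
  have FLof : ∀ z, FL (Line.of b z) = (F z).1 := fun _ => rfl
  have FLtop : FL ⊤ = ⊤ := rfl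
  have hlt : ∀ x y, FL x < FL y → x < y := by
    intro x y hxy
    rcases Line.eq_top_or x with rfl | ⟨x, rfl⟩
    · rw [FLtop] at hxy
      exact absurd hxy not_top_lt
    rcases Line.eq_top_or y with rfl | ⟨y, rfl⟩
    · exact Line.of_lt_top x
    rw [FLof, FLof] at hxy
    rw [Line.of_lt_of]
    refine ⟨fun e => hxy.ne (by rw [e]), ?_⟩
    by_cases hx : (F x).1 = ⊥
    · exact Or.inl (hbot.2.2.1 x (Subtype.ext hx))
    · refine Or.inr (hF _ _ _ ?_)
      rw [hbot.2.1]
      exact Or.inl ⟨bot_lt_iff_ne_bot.2 hx, hxy⟩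
  have hfib : ∀ v : {x // x ∉ I}, ∃ x : {x // x ∉ Line.image b Ψ.I}, FL x = v ∧
      (∀ y, FL y = v → y = x) ∧ ((x : Line b) = ⊤ ∧ (v : L) = ⊤ ∨
        ∃ hv : (v : L) ≠ ⊤, x = Line.of b (G ⟨v, hv⟩)) := by
    rintro ⟨v, hv⟩
    by_cases hvt : v = ⊤
    · refine ⟨⟨⊤, Line.top_notMem_image⟩, hvt.symm, fun y hy => ?_, Or.inl ⟨rfl, hvt⟩⟩
      rcases Line.eq_top_or y with rfl | ⟨y, rfl⟩
      · rfl
      · exact absurd (hy.trans hvt) (F y).2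
    · have h1 := hG ⟨v, hvt⟩ hv
      refine ⟨⟨Line.of b (G ⟨v, hvt⟩), fun h' => h1.1 (Line.of_mem_image.1 h')⟩, ?_, ?_,
        Or.inr ⟨hvt, rfl⟩⟩
      · exact congrArg Subtype.val h1.2.1
      · intro y hy
        rcases Line.eq_top_or y with rfl | ⟨y, rfl⟩
        · exact absurd hy.symm hvt
        · exact congrArg _ (h1.2.2.1 y (Subtype.ext hy))
  choose g hg1 hg2 hg3 using hfib
  have hΨl := Ψ.linFlower hbot.1
  have hdb : G dL ≠ b := by
    intro e
    have e1 : dL = botL := hdL.2.1.symm.trans ((congrArg F e).trans hbot.2.1)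
    exact hd0 (congrArg Subtype.val e1)
  refine ⟨b, hbot.1, hbot.2.2.2.1, G dL, hdL.1, hdb, hdL.2.2.2.1, g, ?_⟩
  have hmono : StrictMono g := fun v w hvw => hlt _ _ (by rw [hg1, hg1]; exact hvw)
  have hcover : ∀ c, (∃ a, g a = c) ∨ ∃ p s, p ⋖ s ∧ g p < c ∧ c < g s := by
    intro c
    by_cases hc : FL c ∈ I
    · obtain ⟨p, s, hps, h1, h2, -⟩ := h.exists_covBy hc
      exact Or.inr ⟨p, s, hps, hlt _ _ (by rwa [hg1]), hlt _ _ (by rwa [hg1])⟩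
    · exact Or.inl ⟨⟨FL c, hc⟩, Subtype.ext (hg2 ⟨FL c, hc⟩ c rfl).symm⟩
  have hgd : g ⟨d, hd⟩ = Line.of b (G dL) := by
    rcases hg3 ⟨d, hd⟩ with h' | ⟨h', h''⟩
    · exact absurd h'.2 hd1
    · exact h''
  refine ⟨hmono, fun v => ?_, hcover⟩
  have hP0 : Line.family b Ψ.P ⊥ = P ⊥ := hbot.2.2.2.1
  have hd0' : Line.of b (G dL) ≠ ⊥ := Line.of_injective.ne hdb
  -- A pair depends only on `X`, the initial and final arcs, the vertex sets at the base point and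
  -- at `v`, and the position relative to `d`. The extension preserves all of these.
  show lineSep Ψ.X (Line.family b Ψ.P) (Line.of b (G dL)) (g v) = lineSep X P d v
  rcases hg3 v with ⟨e1, e2⟩ | ⟨hvt, e1⟩
  · rw [e1, e2, h.lineSep_top hd1, hΨl.lineSep_top (Line.of_ne_top _), hX]
  · have hv := hG ⟨v, hvt⟩ v.2
    have h1 : lineIn Ψ.X (Line.family b Ψ.P) ⊥ (g v) = lineIn X P ⊥ v := by
      rw [e1, ← Line.of_self, ← Ψ.intervalSet_of_le (b := b)
        (show Line.of b b ≤ Line.of b (G ⟨v, hvt⟩) from bot_le)]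
      exact (hbot.2.2.2.2 ⟨v, hvt⟩ v.2).symm.trans
        (h.loopFamily_intervalSet_of_le (show botL ≤ ⟨v, hvt⟩ from (bot_le : ⊥ ≤ v.1)))
    have h2 : lineIn Ψ.X (Line.family b Ψ.P) (g v) ⊤ = lineIn X P v ⊤ := by
      rcases eq_or_ne (v : L) ⊥ with hvb | hvb
      · have e3 : (g v : Line b) = ⊥ :=
          e1.trans (congrArg (Line.of b) (congrArg G (Subtype.ext hvb)))
        rw [e3, hvb, h.lineIn_bot_top, hΨl.lineIn_bot_top]
      · have hvb' : botL < ⟨v, hvt⟩ := bot_lt_iff_ne_bot.2 hvb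
        have hGb : G ⟨v, hvt⟩ ≠ b := fun e => hvb'.ne
          (hbot.2.1.symm.trans ((congrArg F e).symm.trans hv.2.1))
        rw [e1, h.lineIn_top, ← Ψ.intervalSet_base_right hGb]
        exact (hv.2.2.2.2 botL h.bot_notMem).symm.trans (h.loopFamily_intervalSet_of_lt hvb')
    have h3 : Line.family b Ψ.P (g v) = P v := by
      rw [e1]
      exact hv.2.2.2.1
    rw [← hgd, lineSep, lineSep, h1, h2, h3, hP0]
    have h4 : ((g ⟨d, hd⟩ : Line b) < g v ↔ d < v) := hmono.lt_iff_lt (a := ⟨d, hd⟩) (b := v)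
    have h5 : ((g v : Line b) < g ⟨d, hd⟩ ↔ (v : L) < d) := hmono.lt_iff_lt (a := v) (b := ⟨d, hd⟩)
    simp only [h4, h5]

end LinFlower

/-! ### From refinements to extensions -/

open VSep

namespace IsRefinement

variable {S L₁ L₂ : Type u} [LinearOrder L₁] [BoundedOrder L₁] [LinearOrder L₂] [BoundedOrder L₂]
  {I₁ : Set L₁} {I₂ : Set L₂} {e₁ : {x // x ∉ I₁} → S} {e₂ : {x // x ∉ I₂} → S}
  {g : {x // x ∉ I₁} → {x // x ∉ I₂}}

/-- The element of the coarser line in which an element of the finer line lies. -/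
theorem exists_projection (hg : IsRefinement e₁ e₂ g) (h₁ : IsLineCompletion I₁)
    (h₂ : IsLineCompletion I₂) (z : L₂) : ∃ y : L₁, (z ∈ I₂ → y ∈ I₁) ∧
      ∀ v : {x // x ∉ I₁}, ((v : L₁) ≤ y ↔ (g v : L₂) ≤ z) ∧ (y ≤ v ↔ z ≤ g v) := by
  have key : ∀ p s : {x // x ∉ I₁}, p ⋖ s → (g p : L₂) < z → z < g s → ∃ y : L₁, y ∈ I₁ ∧
      ∀ v : {x // x ∉ I₁}, ((v : L₁) ≤ y ↔ (g v : L₂) ≤ z) ∧ (y ≤ v ↔ z ≤ g v) := by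
    intro p s hps h1 h2
    obtain ⟨i, hi, h3, h4, -⟩ := h₁.exists_petal_of_covBy hps
    refine ⟨i, hi, fun v => ?_⟩
    rcases le_or_gt v p with hv | hv
    · have h5 : (g v : L₂) ≤ g p := hg.strictMono.monotone hv
      have h6 : (v : L₁) ≤ p := hv
      exact ⟨⟨fun _ => h5.trans h1.le, fun _ => h6.trans h3.le⟩,
        ⟨fun h => absurd (h3.trans_le h) h6.not_gt, fun h => absurd (h1.trans_le h) h5.not_gt⟩⟩
    · have hv' : s ≤ v := not_lt.1 (hps.2 hv)
      have h5 : (g s : L₂) ≤ g v := hg.strictMono.monotone hv'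
      have h6 : (s : L₁) ≤ v := hv'
      exact ⟨⟨fun h => absurd (h.trans_lt h4) h6.not_gt, fun h => absurd (h.trans_lt h2) h5.not_gt⟩,
        ⟨fun _ => h2.le.trans h5, fun _ => h4.le.trans h6⟩⟩
  by_cases hz : z ∈ I₂
  · obtain ⟨p₂, s₂, hps₂, h1, h2, -⟩ := h₂.exists_covBy hz
    obtain ⟨p, s, hps, h3, h4⟩ := hg.exists_covBy hps₂
    obtain ⟨y, hy, hy'⟩ := key p s hps (lt_of_le_of_lt (show (g p : L₂) ≤ p₂ from h3) h1)
      (lt_of_lt_of_le h2 (show (s₂ : L₂) ≤ g s from h4))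
    exact ⟨y, fun _ => hy, hy'⟩
  · rcases hg.cover ⟨z, hz⟩ with ⟨a, ha⟩ | ⟨p, s, hps, h1, h2⟩
    · have ha' : (g a : L₂) = z := congrArg Subtype.val ha
      refine ⟨a, fun h => absurd h hz, fun v => ?_⟩
      rw [← ha']
      exact ⟨(hg.strictMono.le_iff_le (a := v) (b := a)).symm,
        (hg.strictMono.le_iff_le (a := a) (b := v)).symm⟩
    · obtain ⟨y, hy, hy'⟩ := key p s hps h1 h2
      exact ⟨y, fun _ => hy, hy'⟩

end IsRefinement

/-- A refinement of the line of a pseudoflower gives an extension. -/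
theorem Pseudoflower.extendedBy_of_isRefinement {V S L : Type u} [LinearOrder L] [BoundedOrder L]
    {U : SepUniverse V} {k : ℕ} (Φ : Pseudoflower U k) {b : Φ.C} (hb : b ∉ Φ.I) {I : Set L}
    {P : L → Set V} (h : LinFlower U k Φ.X I P) {e₁ : {x // x ∉ Line.image b Φ.I} → S}
    {e₂ : {x // x ∉ I} → S} {g : {x // x ∉ Line.image b Φ.I} → {x // x ∉ I}}
    (hg : IsRefinement e₁ e₂ g)
    (hin : ∀ v w, v ≤ w → lineIn Φ.X (Line.family b Φ.P) v.1 w.1 = lineIn Φ.X P (g v).1 (g w).1)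
    (hout : ∀ v w, v < w →
      lineOut Φ.X (Line.family b Φ.P) v.1 w.1 = lineOut Φ.X P (g v).1 (g w).1) :
    Φ.ExtendedBy h.toPseudoflower := by
  have hl := Φ.linFlower hb
  have hgt : g ⟨⊤, hl.top_notMem⟩ = ⟨⊤, h.top_notMem⟩ :=
    hg.map_top (fun x => le_top (a := x.1)) fun x => le_top (a := x.1)
  -- The image of `z` is determined by the position of `z` relative to the cuts that come from `Φ`;
  -- it is a cut point if `z` is one of these cuts and a petal otherwise.
  have hF : ∀ z : Loop L, ∃ c : Φ.C, ((z : L) ∈ I → c ∈ Φ.I) ∧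
      ∀ v : {x // x ∉ Line.image b Φ.I}, ((v : Line b) ≤ Line.of b c ↔ (g v : L) ≤ z) ∧
        (Line.of b c ≤ v ↔ (z : L) ≤ g v) := by
    intro z
    obtain ⟨y, hy, hy'⟩ := hg.exists_projection hl.toIsLineCompletion h.toIsLineCompletion z
    rcases Line.eq_top_or y with rfl | ⟨c, rfl⟩
    · have := (hy' ⟨⊤, hl.top_notMem⟩).1.1 le_rfl
      rw [hgt] at this
      exact absurd (top_le_iff.1 this) z.2
    · exact ⟨c, fun hz => Line.of_mem_image.1 (hy hz), hy'⟩
  choose F hFI hF using hF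
  have hlt : ∀ x y, Line.of b (F x) < Line.of b (F y) → x < y := by
    intro x y hxy
    obtain ⟨v, hv, h1, h2⟩ := hl.exists_cut_between hxy
    have h3 := ((hF x ⟨v, hv⟩).2.1 h1).trans ((hF y ⟨v, hv⟩).1.1 h2)
    exact lt_of_le_of_ne h3 fun e => hxy.ne (congrArg (fun t => Line.of b (F t)) e)
  have hlift : ∀ c ∈ Φ.I, ∃ z : Loop L, (z : L) ∈ I ∧ F z = c := by
    intro c hc
    obtain ⟨p, s, hps, h1, h2, h3⟩ := hl.exists_covBy (Line.of_mem_image.2 hc)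
    obtain ⟨i, hi, h4, h5⟩ := h.exists_between _ (g p).2 _ (g s).2 (hg.strictMono hps.1)
    refine ⟨⟨i, fun e => h.top_notMem (e ▸ hi)⟩, hi, Line.of_injective (b := b) (h3 _ ?_ ?_)⟩
    · exact not_le.1 fun h' => h4.not_ge ((hF _ p).2.1 h')
    · exact not_le.1 fun h' => h5.not_ge ((hF _ s).1.1 h')
  have hXeq : h.toPseudoflower.X = Φ.X := h.loopFamily_X
  refine ⟨hXeq.symm, F, ?_, ?_, ?_, ?_⟩
  · intro c
    by_cases hc : c ∈ Φ.I
    · obtain ⟨z, -, hz⟩ := hlift c hc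
      exact ⟨z, hz⟩
    · have hc' : Line.of b c ∉ Line.image b Φ.I := fun h' => hc (Line.of_mem_image.1 h')
      have hne : (g ⟨_, hc'⟩ : L) ≠ ⊤ := by
        have h1 : g ⟨_, hc'⟩ < g ⟨⊤, hl.top_notMem⟩ := hg.strictMono (Line.of_lt_top c)
        rw [hgt] at h1
        exact (show ((g _ : L) < ⊤) from h1).ne
      refine ⟨⟨g ⟨_, hc'⟩, hne⟩, Line.of_injective (b := b) ?_⟩
      have h1 := hF ⟨g ⟨_, hc'⟩, hne⟩ ⟨_, hc'⟩
      exact le_antisymm (h1.2.2 le_rfl) (h1.1.2 le_rfl)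
  · intro x y z hxyz
    rw [Line.sbtw_iff (b := b)] at hxyz
    exact hxyz.imp (fun h' => ⟨hlt _ _ h'.1, hlt _ _ h'.2⟩)
      (Or.imp (fun h' => ⟨hlt _ _ h'.1, hlt _ _ h'.2⟩) fun h' => ⟨hlt _ _ h'.1, hlt _ _ h'.2⟩)
  · refine subset_antisymm ?_ ?_
    · rintro _ ⟨z, hz, rfl⟩
      exact hFI z hz
    · intro c hc
      obtain ⟨z, hz, hzc⟩ := hlift c hc
      exact ⟨z, hz, hzc⟩
  · intro v hv w hw
    have hv' : Line.of b v ∉ Line.image b Φ.I := fun h' => hv (Line.of_mem_image.1 h')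
    have hw' : Line.of b w ∉ Line.image b Φ.I := fun h' => hw (Line.of_mem_image.1 h')
    have hne : ∀ v (hv' : Line.of b v ∉ Line.image b Φ.I), (g ⟨_, hv'⟩ : L) ≠ ⊤ := by
      intro v hv'
      have h1 : g ⟨_, hv'⟩ < g ⟨⊤, hl.top_notMem⟩ := hg.strictMono (Line.of_lt_top v)
      rw [hgt] at h1
      exact (show ((g _ : L) < ⊤) from h1).ne
    ext x
    have hmem : x ∈ Φ.X ∪ ⋃ z ∈ F ⁻¹' closedArc v w, h.toPseudoflower.P z ↔
        x ∈ Φ.X ∨ ∃ z : Loop L, F z ∈ closedArc v w ∧ x ∈ P z := by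
      simp only [Set.mem_union, Set.mem_iUnion, exists_prop, Set.mem_preimage]
      exact Iff.rfl
    refine Iff.trans ?_ hmem.symm
    rcases le_or_gt (Line.of b v) (Line.of b w) with hle | hgt'
    · rw [Φ.intervalSet_of_le hle, hin ⟨_, hv'⟩ ⟨_, hw'⟩ hle]
      refine or_congr_right ⟨?_, ?_⟩
      · rintro ⟨z, h1, h2, hx⟩
        have hz : z ≠ ⊤ := fun e => hne w hw' (top_le_iff.1 (e ▸ h2))
        refine ⟨⟨z, hz⟩, (Line.mem_closedArc_of_le hle).2 ⟨?_, ?_⟩, hx⟩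
        · exact (hF ⟨z, hz⟩ ⟨_, hv'⟩).1.2 h1
        · exact (hF ⟨z, hz⟩ ⟨_, hw'⟩).2.2 h2
      · rintro ⟨z, hz, hx⟩
        rw [Line.mem_closedArc_of_le hle] at hz
        exact ⟨z, (hF z ⟨_, hv'⟩).1.1 hz.1, (hF z ⟨_, hw'⟩).2.1 hz.2, hx⟩
    · rw [Φ.intervalSet_of_lt hgt', hout ⟨_, hw'⟩ ⟨_, hv'⟩ hgt']
      refine or_congr_right ⟨?_, ?_⟩
      · rintro ⟨z, h1, hx⟩
        obtain ⟨y, hy, hyz⟩ := h.exists_loop z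
        refine ⟨y, (Line.mem_closedArc_of_lt hgt').2 ?_, hy ▸ hx⟩
        rcases hyz with e | ⟨-, e⟩
        · rw [← e] at h1
          exact h1.imp (hF y ⟨_, hw'⟩).2.2 (hF y ⟨_, hv'⟩).1.2
        · exact Or.inl ((hF y ⟨_, hw'⟩).2.2 (e ▸ bot_le))
      · rintro ⟨z, hz, hx⟩
        rw [Line.mem_closedArc_of_lt hgt'] at hz
        exact ⟨z, hz.imp (hF z ⟨_, hw'⟩).2.1 (hF z ⟨_, hv'⟩).1.1, hx⟩

/-! ### Maximal chains of cut points with doubled members -/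

open VSep

/-- A chain of separations in which the members of `D₂` occur twice. -/
def DoubledChain {V : Type u} {D : Set (VSep V)} (_ : ∀ s ∈ D, ∀ t ∈ D, s ≤ t ∨ t ≤ s)
    (D₂ : Set (VSep V)) : Type u :=
  {x : VSep V × Bool // x.1 ∈ D ∧ (x.2 = true → x.1 ∈ D₂)}

namespace DoubledChain

variable {V : Type u} {D D₂ : Set (VSep V)} {h : ∀ s ∈ D, ∀ t ∈ D, s ≤ t ∨ t ≤ s}

/-- The separation of an element. -/
def sep (x : DoubledChain h D₂) : VSep V := x.1.1

/-- Whether an element is the second copy of its separation. -/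
def flag (x : DoubledChain h D₂) : Bool := x.1.2

theorem sep_mem (x : DoubledChain h D₂) : x.sep ∈ D := x.2.1

theorem sep_mem_of_flag {x : DoubledChain h D₂} (hx : x.flag = true) : x.sep ∈ D₂ := x.2.2 hx

theorem ext {x y : DoubledChain h D₂} (h1 : x.sep = y.sep) (h2 : x.flag = y.flag) : x = y :=
  Subtype.ext (Prod.ext h1 h2)

noncomputable instance : LinearOrder (DoubledChain h D₂) :=
  let _ := chainOrder h
  LinearOrder.lift' (fun x => toLex ((⟨x.sep, x.sep_mem⟩ : D), x.flag)) fun x y hxy => by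
    have := toLex.injective hxy
    rw [Prod.mk.injEq, Subtype.mk.injEq] at this
    exact DoubledChain.ext this.1 this.2

theorem lt_iff {x y : DoubledChain h D₂} :
    x < y ↔ x.sep < y.sep ∨ x.sep = y.sep ∧ x.flag = false ∧ y.flag = true := by
  let := chainOrder h
  refine (Prod.Lex.lt_iff (x := toLex ((⟨x.sep, x.sep_mem⟩ : D), x.flag))
    (y := toLex ((⟨y.sep, y.sep_mem⟩ : D), y.flag))).trans ?_
  refine or_congr Iff.rfl (and_congr Subtype.mk_eq_mk ?_)
  simp only [ofLex_toLex]
  cases x.flag <;> cases y.flag <;> decide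

theorem sep_mono : Monotone (sep : DoubledChain h D₂ → VSep V) := by
  intro x y hxy
  rcases hxy.eq_or_lt with rfl | hlt
  · exact le_rfl
  · exact (lt_iff.1 hlt).elim le_of_lt fun h' => h'.1.le

theorem lt_of_sep_lt {x y : DoubledChain h D₂} (hxy : x.sep < y.sep) : x < y := lt_iff.2 (Or.inl hxy)

/-- The first copy of a separation. -/
def lo (D₂ : Set (VSep V)) (h : ∀ s ∈ D, ∀ t ∈ D, s ≤ t ∨ t ≤ s) {s : VSep V} (hs : s ∈ D) :
    DoubledChain h D₂ :=
  ⟨(s, false), hs, fun h' => absurd h' Bool.false_ne_true⟩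

/-- The last copy of a separation. -/
noncomputable def hi (D₂ : Set (VSep V)) (h : ∀ s ∈ D, ∀ t ∈ D, s ≤ t ∨ t ≤ s) {s : VSep V}
    (hs : s ∈ D) : DoubledChain h D₂ :=
  open Classical in ⟨(s, decide (s ∈ D₂)), hs, fun h' => of_decide_eq_true h'⟩

theorem flag_hi {s : VSep V} (hs : s ∈ D) : (hi D₂ h hs).flag = true ↔ s ∈ D₂ := by
  classical
  exact decide_eq_true_iff

theorem lo_le {s : VSep V} (hs : s ∈ D) {x : DoubledChain h D₂} (hx : s ≤ x.sep) :
    lo D₂ h hs ≤ x := by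
  refine not_lt.1 fun hlt => ?_
  rcases lt_iff.1 hlt with h1 | ⟨-, -, h1⟩
  · exact h1.not_ge hx
  · exact Bool.false_ne_true h1

theorem le_hi {s : VSep V} (hs : s ∈ D) {x : DoubledChain h D₂} (hx : x.sep ≤ s) :
    x ≤ hi D₂ h hs := by
  refine not_lt.1 fun hlt => ?_
  rcases lt_iff.1 hlt with h1 | ⟨h1, h2, h3⟩
  · exact h1.not_ge hx
  · have h4 := sep_mem_of_flag h3
    have h5 : s = x.sep := h1
    rw [← h5, ← flag_hi (h := h) hs, h2] at h4
    exact Bool.false_ne_true h4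

theorem hi_covBy_lo {s t : VSep V} (hs : s ∈ D) (ht : t ∈ D) (hst : s < t)
    (hno : ∀ r ∈ D, s < r → ¬ r < t) : hi D₂ h hs ⋖ lo D₂ h ht := by
  refine ⟨lt_of_sep_lt hst, fun x hx hx' => ?_⟩
  have h1 : s ≤ x.sep := sep_mono hx.le
  have h2 : x.sep ≤ t := sep_mono hx'.le
  rcases h1.eq_or_lt with e | h1
  · exact hx.not_ge (le_hi hs e.ge)
  · rcases h2.eq_or_lt with e | h2
    · exact hx'.not_ge (lo_le ht e.ge)
    · exact hno _ x.sep_mem h1 h2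

theorem lo_covBy_hi {s : VSep V} (hs : s ∈ D) (hs2 : s ∈ D₂) : lo D₂ h hs ⋖ hi D₂ h hs := by
  refine ⟨lt_iff.2 (Or.inr ⟨rfl, rfl, (flag_hi hs).2 hs2⟩), fun x hx hx' => ?_⟩
  have e : x.sep = s := le_antisymm (sep_mono hx'.le) (sep_mono hx.le)
  cases hf : x.flag
  · exact hx.ne (DoubledChain.ext e.symm hf.symm)
  · exact hx'.ne (DoubledChain.ext e (hf.trans ((flag_hi hs).2 hs2).symm))

theorem range_sep : Set.range (sep : DoubledChain h D₂ → VSep V) = D :=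
  subset_antisymm (by rintro _ ⟨x, rfl⟩; exact x.sep_mem) fun _ hs => ⟨lo D₂ h hs, rfl⟩

end DoubledChain

/-! ### Degenerate arcs, needed between two copies of one pair -/

/-- The degenerate arc at `s` is the infimum of an arc ending at `s` and one starting there;
disjoint outer ends leave only `P s ∪ X` in both. -/
theorem LinSys.arcSep_self_of_between {V : Type u} {U : SepUniverse V} {k : ℕ} {X P₀ : Set V}
    {D : Set (VSep V)} (h : LinSys U k X P₀ D) {r s t : VSep V} (hr : r ∈ D) (hs : s ∈ D) (ht : t ∈ D)
    (hrs : r < s) (hst : s < t) (hd : Disjoint (pt X P₀ r) (pt X P₀ t)) :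
    arcSep P₀ s s ∈ U.seps := by
  have h1 := h.sep r hr s hs hrs fun e => (hst.trans_le (h.le_top ht)).ne e.2
  have h2 := h.sep s hs t ht hst fun e => ((h.bot_le hr).trans_lt hrs).ne e.1.symm
  convert U.inf_mem _ h1 _ h2 using 1
  refine VSep.ext ?_ ?_
  · show arcIn P₀ s s = arcIn P₀ r s ∩ arcIn P₀ s t
    refine subset_antisymm (Set.subset_inter (arcIn_mono P₀ hrs.le le_rfl)
      (arcIn_mono P₀ le_rfl hst.le)) ?_
    rintro x ⟨hx1, hx2⟩
    rw [h.arcIn_self hs]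
    have h3 : x ∈ pt X P₀ s ∪ pt X P₀ t ∪ X := by
      rw [← h.inter hs ht hst.le]
      exact ⟨hx2, arcIn_subset_arcOut P₀ (Or.inl le_rfl) hx1⟩
    have h4 : x ∈ pt X P₀ r ∪ pt X P₀ s ∪ X := by
      rw [← h.inter hr hs hrs.le]
      exact ⟨hx1, arcIn_subset_arcOut P₀ (Or.inr le_rfl) hx2⟩
    have h5 : x ∈ pt X P₀ r → x ∉ pt X P₀ t := fun h' => Set.disjoint_left.1 hd h'
    simp only [Set.mem_union] at *
    tauto
  · show arcOut P₀ s s = arcOut P₀ r s ∪ arcOut P₀ s t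
    rw [h.arcOut_self hs]
    refine (Set.eq_univ_of_univ_subset ?_).symm
    rw [← h.union hs ht hst.le]
    exact Set.union_subset_union_left _ (arcIn_subset_arcOut P₀ (Or.inr le_rfl))

theorem LinSys.arcSep_self {V : Type u} {U : SepUniverse V} {k : ℕ} {X P₀ : Set V}
    {D : Set (VSep V)} (h : LinSys U k X P₀ D) {v₂ v₃ v₄ : VSep V} (hv : Spread X P₀ v₂ v₃ v₄)
    (h2 : v₂ ∈ D) (h3 : v₃ ∈ D) (h4 : v₄ ∈ D) {s : VSep V} (hs : s ∈ D) :
    arcSep P₀ s s ∈ U.seps := by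
  obtain ⟨n2, n3, n4⟩ := hv.ne_top
  obtain ⟨b2, b3, b4⟩ := hv.ne_bot
  -- At the base point the two arcs are the one from the bottom to `v₂` and the one from `v₄` to the
  -- top.
  have hbot : arcSep P₀ (botSep X) (botSep X) ∈ U.seps := by
    have h5 := h.sep _ h.bot_mem _ h2 ((h.bot_le h2).lt_of_ne b2.symm) fun e => n2 e.2
    have h6 := h.sep _ h4 _ h.top_mem ((h.le_top h4).lt_of_ne n4) fun e => b4 e.1
    have h24 : v₂ < v₄ := hv.lt23.trans hv.lt34
    convert U.inf_mem _ h5 _ h6 using 1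
    have e1 : ∀ x ∈ P₀, x ∉ v₂.left := fun x hx => (notMem_of_disjoint_pt h.disj hv.d02 hx).1
    have hi := h.inter h2 h4 h24.le
    have key : ∀ x, x ∈ v₂.left → x ∈ v₄.right → x ∈ X := by
      intro x hx hx'
      by_contra hX
      by_cases hx0 : x ∈ P₀
      · exact e1 x hx0 hx
      have h7 : x ∈ pt X P₀ v₄ := ⟨Or.inl ⟨h24.le.1 hx, hx'⟩, hX⟩
      have h8 : x ∈ pt X P₀ v₂ := ⟨Or.inl ⟨hx, h24.le.2 hx'⟩, hX⟩
      exact Set.disjoint_left.1 hv.d24 h8 h7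
    have l2 := h.left _ h2
    have r4 := h.right _ h4
    have hcov := h.cover _ h2
    have h9 : v₄.right ⊆ v₂.right := h24.le.2
    refine VSep.ext ?_ ?_
    · show arcIn P₀ _ _ = arcIn P₀ _ _ ∩ arcIn P₀ _ _
      rw [IsCutChain.arcIn_bot, IsCutChain.arcIn_bot]
      ext x
      have := key x
      have := @l2 x
      have := @r4 x
      simp only [botSep, topSep, arcIn, Set.mem_union, Set.mem_inter_iff, Set.mem_univ]
      grind
    · show arcOut P₀ _ _ = arcOut P₀ _ _ ∪ arcOut P₀ _ _
      rw [h.arcOut_self h.bot_mem, IsCutChain.arcOut_bot (h.right _ h2)]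
      refine (Set.eq_univ_of_univ_subset ?_).symm
      rw [← hcov]
      have h10 := h24.le.1
      intro x
      have := @h10 x
      simp only [arcOut, topSep, Set.mem_union]
      grind
  by_cases hb : s = botSep X
  · rwa [hb]
  by_cases ht : s = topSep X
  · rw [ht]
    convert hbot using 1
    refine VSep.ext ?_ ?_
    · show arcIn P₀ _ _ = arcIn P₀ _ _
      rw [h.arcIn_self h.bot_mem, h.arcIn_self h.top_mem, h.pt_bot, h.pt_top]
    · show arcOut P₀ _ _ = arcOut P₀ _ _
      rw [h.arcOut_self h.bot_mem, h.arcOut_self h.top_mem]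
  rcases h.lt_or_le hs h3 with hlt | hle
  · exact h.arcSep_self_of_between h.bot_mem hs h3 ((h.bot_le hs).lt_of_ne (Ne.symm hb)) hlt
      (by rw [h.pt_bot]; exact hv.d03)
  · exact h.arcSep_self_of_between h2 hs h.top_mem (hv.lt23.trans_le hle) ((h.le_top hs).lt_of_ne ht)
      (by rw [h.pt_top]; exact hv.d02.symm)

/-! ### Admissible pairs and Zorn's lemma -/

/-- The separations that occur at least twice in a family. -/
def doubles {S K : Type u} [LinearOrder K] (e : K → S) : Set S :=
  {s | ∃ v w, v < w ∧ e v = s ∧ e w = s}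

namespace LinModel

variable {V K : Type u} [LinearOrder K] {U : SepUniverse V} {k : ℕ} {X P₀ : Set V} {e : K → VSep V}

/-- By monotonicity the pair is constant between `v` and `w`. Each subinterval contains a jump, but
`star` allows only one jump with this pair. -/
theorem exists_jump_of_eq (h : LinModel U k X P₀ e) {v w : K} (hvw : v < w) (he : e v = e w) :
    v ⋖ w := by
  have hsq : ∀ a, v ≤ a → a ≤ w → e a = e v := fun a h1 h2 =>
    le_antisymm (he ▸ h.mono h2) (h.mono h1)
  obtain ⟨p, s, h1, hps, h2⟩ := h.exists_covBy v w hvw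
  have huniq : ∀ q t, v ≤ q → q ⋖ t → t ≤ w → q = p := fun q t h3 hqt h4 =>
    h.star q t p s hqt hps ((hsq q h3 (hqt.1.le.trans h4)).trans (hsq t (h3.trans hqt.1.le) h4).symm)
      ((hsq p h1 (hps.1.le.trans h2)).trans (hsq s (h1.trans hps.1.le) h2).symm)
      (by rw [hsq q h3 (hqt.1.le.trans h4), hsq p h1 (hps.1.le.trans h2)])
  have e1 : v = p := by
    rcases h1.eq_or_lt with e1 | hlt
    · exact e1
    obtain ⟨q, t, h3, hqt, h4⟩ := h.exists_covBy v p hlt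
    have := huniq q t h3 hqt (h4.trans (hps.1.le.trans h2))
    rw [this] at hqt
    exact absurd hqt.1 h4.not_gt
  have e2 : s = w := by
    rcases h2.eq_or_lt with e2 | hlt
    · exact e2
    obtain ⟨q, t, h3, hqt, h4⟩ := h.exists_covBy s w hlt
    have := huniq q t ((h1.trans hps.1.le).trans h3) hqt h4
    rw [this] at h3
    exact absurd hps.1 h3.not_gt
  rwa [e1, ← e2]

theorem exists_jump_of_mem_doubles (h : LinModel U k X P₀ e) {τ : VSep V} (hτ : τ ∈ doubles e) :
    ∃ p s, p ⋖ s ∧ e p = τ ∧ e s = τ := by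
  obtain ⟨v, w, hvw, rfl, h2⟩ := hτ
  exact ⟨v, w, h.exists_jump_of_eq hvw h2.symm, rfl, h2⟩

end LinModel

/-- A chain of cut points and a set of its members to be doubled that may serve to refine the line
`e₁`. -/
structure IsAdmissible {V K₁ : Type u} [LinearOrder K₁] (U : SepUniverse V) (k : ℕ) (X P₀ : Set V)
    (e₁ : K₁ → VSep V) (D D₂ : Set (VSep V)) : Prop where
  sys : LinSys U k X P₀ D
  range_subset : Set.range e₁ ⊆ D
  doubles_subset : doubles e₁ ⊆ D₂
  subset : D₂ ⊆ D
  star : ∀ s ∈ D₂, ∀ t ∈ D₂, pt X P₀ s = pt X P₀ t → s = t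
  between : ∀ s ∈ D, s ∈ Set.range e₁ ∨ ∃ p q, p ⋖ q ∧ e₁ p ≤ s ∧ s ≤ e₁ q
  doubles_between : ∀ s ∈ D₂, ∃ p q, p ⋖ q ∧ e₁ p ≤ s ∧ s ≤ e₁ q

/-- This starts Zorn's lemma. It also describes a further extension by its own chain in the proof of
maximality. -/
theorem LinModel.isAdmissible {V K : Type u} [LinearOrder K] {U : SepUniverse V} {k : ℕ}
    {X P₀ : Set V} {e : K → VSep V} (h : LinModel U k X P₀ e) :
    IsAdmissible U k X P₀ e (Set.range e) (doubles e) where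
  sys := h.sys
  range_subset := subset_rfl
  doubles_subset := subset_rfl
  subset := by rintro _ ⟨v, -, -, rfl, -⟩; exact ⟨v, rfl⟩
  star s hs t ht hst := by
    obtain ⟨p, q, hpq, rfl, e1⟩ := h.exists_jump_of_mem_doubles hs
    obtain ⟨p', q', hpq', rfl, e2⟩ := h.exists_jump_of_mem_doubles ht
    exact congrArg e (h.star p q p' q' hpq hpq' e1.symm e2.symm hst)
  between s hs := Or.inl hs
  doubles_between s hs := by
    obtain ⟨p, q, hpq, e1, e2⟩ := h.exists_jump_of_mem_doubles hs
    exact ⟨p, q, hpq, e1.le, e2.ge⟩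

namespace IsAdmissible

variable {V K₁ : Type u} [LinearOrder K₁] {U : SepUniverse V} {k : ℕ} {X P₀ : Set V}
  {e₁ : K₁ → VSep V} {D D₂ : Set (VSep V)}

/-- Every admissible pair lies below a maximal admissible pair. -/
theorem exists_maximal (h : IsAdmissible U k X P₀ e₁ D D₂) : ∃ E E₂, IsAdmissible U k X P₀ e₁ E E₂ ∧
    ∀ F F₂, IsAdmissible U k X P₀ e₁ F F₂ → E ⊆ F → E₂ ⊆ F₂ → F = E ∧ F₂ = E₂ := by
  obtain ⟨⟨E, E₂⟩, -, hE, hmax⟩ := zorn_le_nonempty₀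
    {p : Set (VSep V) × Set (VSep V) | IsAdmissible U k X P₀ e₁ p.1 p.2} (fun c hc hchain y hy => by
      have hdir : ∀ {p q : Set (VSep V) × Set (VSep V)}, p ∈ c → q ∈ c → ∃ r ∈ c, p ≤ r ∧ q ≤ r := by
        intro p q hp hq
        rcases hchain.total hp hq with h' | h'
        exacts [⟨q, hq, h', le_rfl⟩, ⟨p, hp, le_rfl, h'⟩]
      have m1 : ∀ {s}, s ∈ ⋃ p ∈ c, p.1 ↔ ∃ p ∈ c, s ∈ p.1 := by simp
      have m2 : ∀ {s}, s ∈ ⋃ p ∈ c, p.2 ↔ ∃ p ∈ c, s ∈ p.2 := by simp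
      have two1 : ∀ {s t}, s ∈ ⋃ p ∈ c, p.1 → t ∈ ⋃ p ∈ c, p.1 → ∃ p ∈ c, s ∈ p.1 ∧ t ∈ p.1 := by
        intro s t hs ht
        obtain ⟨p, hp, hs⟩ := m1.1 hs
        obtain ⟨q, hq, ht⟩ := m1.1 ht
        obtain ⟨r, hr, h1, h2⟩ := hdir hp hq
        exact ⟨r, hr, h1.1 hs, h2.1 ht⟩
      have two2 : ∀ {s t}, s ∈ ⋃ p ∈ c, p.2 → t ∈ ⋃ p ∈ c, p.2 → ∃ p ∈ c, s ∈ p.2 ∧ t ∈ p.2 := by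
        intro s t hs ht
        obtain ⟨p, hp, hs⟩ := m2.1 hs
        obtain ⟨q, hq, ht⟩ := m2.1 ht
        obtain ⟨r, hr, h1, h2⟩ := hdir hp hq
        exact ⟨r, hr, h1.2 hs, h2.2 ht⟩
      refine ⟨(⋃ p ∈ c, p.1, ⋃ p ∈ c, p.2), ?_, fun z hz => ⟨fun s hs => m1.2 ⟨z, hz, hs⟩,
        fun s hs => m2.2 ⟨z, hz, hs⟩⟩⟩
      exact
      { sys :=
        { disj := (hc hy).sys.disj
          chain := fun s hs t ht => by
            obtain ⟨p, hp, h1, h2⟩ := two1 hs ht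
            exact (hc hp).sys.chain s h1 t h2
          bot_mem := m1.2 ⟨y, hy, (hc hy).sys.bot_mem⟩
          top_mem := m1.2 ⟨y, hy, (hc hy).sys.top_mem⟩
          left := fun s hs => by
            obtain ⟨p, hp, h1⟩ := m1.1 hs
            exact (hc hp).sys.left s h1
          right := fun s hs => by
            obtain ⟨p, hp, h1⟩ := m1.1 hs
            exact (hc hp).sys.right s h1
          cover := fun s hs => by
            obtain ⟨p, hp, h1⟩ := m1.1 hs
            exact (hc hp).sys.cover s h1
          card := fun s hs => by
            obtain ⟨p, hp, h1⟩ := m1.1 hs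
            exact (hc hp).sys.card s h1
          sep := fun s hs t ht => by
            obtain ⟨p, hp, h1, h2⟩ := two1 hs ht
            exact (hc hp).sys.sep s h1 t h2 }
        range_subset := fun s hs => m1.2 ⟨y, hy, (hc hy).range_subset hs⟩
        doubles_subset := fun s hs => m2.2 ⟨y, hy, (hc hy).doubles_subset hs⟩
        subset := fun s hs => by
          obtain ⟨p, hp, h1⟩ := m2.1 hs
          exact m1.2 ⟨p, hp, (hc hp).subset h1⟩
        star := fun s hs t ht => by
          obtain ⟨p, hp, h1, h2⟩ := two2 hs ht
          exact (hc hp).star s h1 t h2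
        between := fun s hs => by
          obtain ⟨p, hp, h1⟩ := m1.1 hs
          exact (hc hp).between s h1
        doubles_between := fun s hs => by
          obtain ⟨p, hp, h1⟩ := m2.1 hs
          exact (hc hp).doubles_between s h1 }) (D, D₂) h
  refine ⟨E, E₂, hE, fun F F₂ hF h1 h2 => ?_⟩
  have := hmax (y := (F, F₂)) hF ⟨h1, h2⟩
  exact ⟨subset_antisymm this.1 h1, subset_antisymm this.2 h2⟩

end IsAdmissible

/-! ### Consequences of maximality: limits, located vertices, suprema -/

open VSep

namespace IsAdmissible

variable {V K₁ : Type u} [LinearOrder K₁] {U : SepUniverse V} {k : ℕ} {X P₀ : Set V}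
  {e₁ : K₁ → VSep V} {D D₂ : Set (VSep V)}

theorem mem_of_linSys (hA : IsAdmissible U k X P₀ e₁ D D₂)
    (hmax : ∀ F F₂, IsAdmissible U k X P₀ e₁ F F₂ → D ⊆ F → D₂ ⊆ F₂ → F = D ∧ F₂ = D₂) {c : VSep V}
    (hc : LinSys U k X P₀ (insert c D)) (hb : ∃ p q, p ⋖ q ∧ e₁ p ≤ c ∧ c ≤ e₁ q) : c ∈ D := by
  have h1 : IsAdmissible U k X P₀ e₁ (insert c D) D₂ :=
    { hA with
      sys := hc
      range_subset := hA.range_subset.trans (Set.subset_insert _ _)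
      subset := hA.subset.trans (Set.subset_insert _ _)
      between := by
        rintro s (rfl | hs)
        · exact Or.inr hb
        · exact hA.between s hs }
  rw [← (hmax _ _ h1 (Set.subset_insert _ _) subset_rfl).1]
  exact Set.mem_insert _ _

/-- Inside a jump of the coarser line, maximality leaves a member undoubled only if another doubled
member has the same vertex set. -/
theorem mem_doubles_of_star (hA : IsAdmissible U k X P₀ e₁ D D₂)
    (hmax : ∀ F F₂, IsAdmissible U k X P₀ e₁ F F₂ → D ⊆ F → D₂ ⊆ F₂ → F = D ∧ F₂ = D₂) {c : VSep V}
    (hc : c ∈ D) (hb : ∃ p q, p ⋖ q ∧ e₁ p ≤ c ∧ c ≤ e₁ q)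
    (hstar : ∀ t ∈ D₂, pt X P₀ t = pt X P₀ c → t = c) : c ∈ D₂ := by
  have h1 : IsAdmissible U k X P₀ e₁ D (insert c D₂) :=
    { hA with
      doubles_subset := hA.doubles_subset.trans (Set.subset_insert _ _)
      subset := Set.insert_subset hc hA.subset
      star := by
        rintro s (rfl | hs) t (rfl | ht) hst
        · rfl
        · exact (hstar t ht hst.symm).symm
        · exact hstar s hs hst
        · exact hA.star s hs t ht hst
      doubles_between := by
        rintro s (rfl | hs)
        · exact hb
        · exact hA.doubles_between s hs }
  rw [← (hmax _ _ h1 subset_rfl (Set.subset_insert _ _)).2]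
  exact Set.mem_insert _ _

/-- In a maximal chain, a cut inside a jump of the coarser line is filled from both sides. -/
theorem exists_limits (hA : IsAdmissible U k X P₀ e₁ D D₂)
    (hmax : ∀ F F₂, IsAdmissible U k X P₀ e₁ F F₂ → D ⊆ F → D₂ ⊆ F₂ → F = D ∧ F₂ = D₂)
    (hU : U.LimitClosed) {v₂ v₃ v₄ : VSep V} (hv : Spread X P₀ v₂ v₃ v₄) (h2 : v₂ ∈ Set.range e₁)
    (h3 : v₃ ∈ Set.range e₁) (h4 : v₄ ∈ Set.range e₁)
    (hQ : DistinguishesProfiles U k P₀ (Set.range e₁)) {L R : Set (VSep V)}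
    (hLR : ∀ s ∈ D, s ∈ L ∨ s ∈ R) (hL : L ⊆ D) (hR : R ⊆ D) (hlt : ∀ l ∈ L, ∀ r ∈ R, l < r)
    (hbot : botSep X ∈ L) (htop : topSep X ∈ R) {p q : K₁} (hpq : p ⋖ q) (hp : e₁ p ∈ L)
    (hq : e₁ q ∈ R) :
    (∃ c ∈ D, (∀ l ∈ L, l ≤ c) ∧ (∀ r ∈ R, c ≤ r) ∧ c.right = ⋂ l ∈ L, l.right) ∧
      ∃ c ∈ D, (∀ l ∈ L, l ≤ c) ∧ (∀ r ∈ R, c ≤ r) ∧ c.left = ⋂ r ∈ R, r.left := by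
  have hQ' := hQ.mono hA.range_subset
  constructor
  · obtain ⟨c, hc, hc1, hc2, hc3⟩ := hA.sys.exists_limit hU hv (hA.range_subset h2)
      (hA.range_subset h3) (hA.range_subset h4) hQ' hLR hL hR hlt hbot htop
    exact ⟨c, hA.mem_of_linSys hmax hc ⟨p, q, hpq, hc1 _ hp, hc2 _ hq⟩, hc1, hc2, hc3⟩
  · obtain ⟨c, hc, hc1, hc2, hc3⟩ := hA.sys.exists_limit_above hU hv (hA.range_subset h2)
      (hA.range_subset h3) (hA.range_subset h4) hQ' hLR hL hR hlt hbot htop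
    exact ⟨c, hA.mem_of_linSys hmax hc ⟨p, q, hpq, hc1 _ hp, hc2 _ hq⟩, hc1, hc2, hc3⟩

/-- In a maximal chain, a vertex that lies in no cut point lies in a jump. -/
theorem exists_jump_of_forall_notMem (hA : IsAdmissible U k X P₀ e₁ D D₂)
    (hmax : ∀ F F₂, IsAdmissible U k X P₀ e₁ F F₂ → D ⊆ F → D₂ ⊆ F₂ → F = D ∧ F₂ = D₂)
    (h₁ : LinModel U k X P₀ e₁)
    (hU : U.LimitClosed) {v₂ v₃ v₄ : VSep V} (hv : Spread X P₀ v₂ v₃ v₄) (h2 : v₂ ∈ Set.range e₁)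
    (h3 : v₃ ∈ Set.range e₁) (h4 : v₄ ∈ Set.range e₁)
    (hQ : DistinguishesProfiles U k P₀ (Set.range e₁)) {x : V} (hx : x ∉ X)
    (hD : ∀ s ∈ D, x ∉ pt X P₀ s) :
    ∃ c ∈ D, ∃ c' ∈ D, c < c' ∧ (∀ r ∈ D, c < r → ¬ r < c') ∧ x ∈ arcIn P₀ c c' := by
  have hx0 : x ∉ P₀ := fun h => hD _ hA.sys.bot_mem (by rw [hA.sys.pt_bot]; exact h)
  have hside : ∀ s ∈ D, (x ∈ s.left ↔ x ∉ s.right) := by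
    intro s hs
    have h5 : x ∈ s.left ∪ s.right ∪ P₀ := hA.sys.cover s hs ▸ Set.mem_univ x
    have h6 := hD s hs
    simp only [pt, arcIn, Set.mem_sdiff, Set.mem_union, Set.mem_inter_iff] at h5 h6
    tauto
  -- The vertex cuts the chain, since it lies in exactly one side of each member.
  have hLR : ∀ s ∈ D, s ∈ {s ∈ D | x ∉ s.left} ∨ s ∈ {s ∈ D | x ∉ s.right} := by
    intro s hs
    by_cases hxs : x ∈ s.left
    · exact Or.inr ⟨hs, (hside s hs).1 hxs⟩
    · exact Or.inl ⟨hs, hxs⟩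
  have hlt : ∀ l ∈ {s ∈ D | x ∉ s.left}, ∀ r ∈ {s ∈ D | x ∉ s.right}, l < r := by
    intro l hl r hr
    refine (hA.sys.lt_or_le hl.1 hr.1).resolve_right fun hle => hl.2 ?_
    exact hle.1 ((hside r hr.1).2 hr.2)
  rcases h₁.loc x hx with ⟨a, ha⟩ | ⟨p, q, hpq, hxpq⟩
  · exact absurd ha (hD _ (hA.range_subset ⟨a, rfl⟩))
  have hxpq' : x ∈ (e₁ q).left ∧ x ∈ (e₁ p).right := hxpq.resolve_right fun h => hx0 h.1
  have hpD : e₁ p ∈ D := hA.range_subset ⟨p, rfl⟩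
  have hqD : e₁ q ∈ D := hA.range_subset ⟨q, rfl⟩
  obtain ⟨⟨c, hc, hc1, hc2, hc3⟩, c', hc', hc1', hc2', hc3'⟩ :=
    hA.exists_limits hmax hU hv h2 h3 h4 hQ hLR (fun s hs => hs.1) (fun s hs => hs.1) hlt
      ⟨hA.sys.bot_mem, hx⟩ ⟨hA.sys.top_mem, hx⟩ hpq
      ⟨hpD, fun h => (hside _ hpD).1 h hxpq'.2⟩ ⟨hqD, (hside _ hqD).1 hxpq'.1⟩
  -- The formulas for the limits matter here: the limit from below still has `x` on its right, the
  -- limit from above has `x` on its left. They are thus distinct and bound a jump.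
  have hxc : x ∈ c.right := by
    rw [hc3]
    simp only [Set.mem_iInter]
    intro l hl
    by_contra h
    exact hl.2 ((hside l hl.1).2 h)
  have hxc' : x ∈ c'.left := by
    rw [hc3']
    simp only [Set.mem_iInter]
    intro r hr
    exact (hside r hr.1).2 hr.2
  have hcL : c ∈ {s ∈ D | x ∉ s.left} := ⟨hc, fun h => (hside c hc).1 h hxc⟩
  have hcR : c' ∈ {s ∈ D | x ∉ s.right} := ⟨hc', (hside c' hc').1 hxc'⟩
  refine ⟨c, hc, c', hc', hlt _ hcL _ hcR, fun r hr hcr hrc => ?_, Or.inl ⟨hxc', hxc⟩⟩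
  rcases hLR r hr with h | h
  · exact (hc1 r h).not_gt hcr
  · exact (hc2' r h).not_gt hrc

/-- A maximal chain is complete. -/
theorem exists_isLUB (hA : IsAdmissible U k X P₀ e₁ D D₂)
    (hmax : ∀ F F₂, IsAdmissible U k X P₀ e₁ F F₂ → D ⊆ F → D₂ ⊆ F₂ → F = D ∧ F₂ = D₂)
    (h₁ : LinModel U k X P₀ e₁)
    (hU : U.LimitClosed) {v₂ v₃ v₄ : VSep V} (hv : Spread X P₀ v₂ v₃ v₄) (h2 : v₂ ∈ Set.range e₁)
    (h3 : v₃ ∈ Set.range e₁) (h4 : v₄ ∈ Set.range e₁)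
    (hQ : DistinguishesProfiles U k P₀ (Set.range e₁)) {S : Set (VSep V)} (hS : S ⊆ D) :
    ∃ a ∈ D, (∀ s ∈ S, s ≤ a) ∧ ∀ u ∈ D, (∀ s ∈ S, s ≤ u) → a ≤ u := by
  rcases S.eq_empty_or_nonempty with rfl | ⟨s₀, hs₀⟩
  · exact ⟨_, hA.sys.bot_mem, fun s hs => hs.elim, fun u hu _ => hA.sys.bot_le hu⟩
  by_cases hM : ∃ s ∈ S, ∀ t ∈ S, t ≤ s
  · obtain ⟨s, hs, hst⟩ := hM
    exact ⟨s, hS hs, hst, fun u _ hu => hu s hs⟩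
  have hM' : ∀ u ∈ {τ ∈ D | ∃ s ∈ S, τ ≤ s}, ¬ ∀ s ∈ S, s ≤ u := by
    rintro u ⟨hu, s, hs, hus⟩ hub
    exact hM ⟨s, hs, fun t ht => (hub t ht).trans hus⟩
  have hLR : ∀ s ∈ D, s ∈ {τ ∈ D | ∃ s ∈ S, τ ≤ s} ∨ s ∈ {τ ∈ D | ∀ s ∈ S, s < τ} := by
    intro τ hτ
    by_cases h : ∃ s ∈ S, τ ≤ s
    · exact Or.inl ⟨hτ, h⟩
    · push Not at h
      exact Or.inr ⟨hτ, fun s hs => (hA.sys.lt_or_le (hS hs) hτ).resolve_right (h s hs)⟩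
  have hlt : ∀ l ∈ {τ ∈ D | ∃ s ∈ S, τ ≤ s}, ∀ r ∈ {τ ∈ D | ∀ s ∈ S, s < τ}, l < r := by
    rintro l ⟨hl, s, hs, hls⟩ r hr
    exact hls.trans_lt (hr.2 s hs)
  have hSL : ∀ s ∈ S, s ∈ {τ ∈ D | ∃ s ∈ S, τ ≤ s} := fun s hs => ⟨hS hs, s, hs, le_rfl⟩
  have hub : ∀ u ∈ D, (∀ s ∈ S, s ≤ u) → u ∈ {τ ∈ D | ∀ s ∈ S, s < τ} := fun u hu h =>
    (hLR u hu).resolve_left fun h' => hM' u h' h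
  have hrange : ∀ a, e₁ a ∈ D := fun a => hA.range_subset ⟨a, rfl⟩
  -- If the cut falls into a jump of the coarser line, its limit belongs to the maximal chain.
  -- Otherwise the supremum taken in the coarser line serves, because new members occur only in its
  -- jumps.
  by_cases hcross : ∃ p q, p ⋖ q ∧ e₁ p ∈ {τ ∈ D | ∃ s ∈ S, τ ≤ s} ∧
      e₁ q ∈ {τ ∈ D | ∀ s ∈ S, s < τ}
  · obtain ⟨p, q, hpq, hp, hq⟩ := hcross
    obtain ⟨⟨c, hc, hc1, hc2, -⟩, -⟩ :=
      hA.exists_limits hmax hU hv h2 h3 h4 hQ hLR (fun s hs => hs.1) (fun s hs => hs.1) hlt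
        ⟨hA.sys.bot_mem, s₀, hs₀, hA.sys.bot_le (hS hs₀)⟩
        (hub _ hA.sys.top_mem fun s hs => hA.sys.le_top (hS hs)) hpq hp hq
    exact ⟨c, hc, fun s hs => hc1 s (hSL s hs), fun u hu hu' => hc2 u (hub u hu hu')⟩
  push Not at hcross
  have hcross' : ∀ p q, p ⋖ q → e₁ p ∈ {τ ∈ D | ∃ s ∈ S, τ ≤ s} →
      e₁ q ∈ {τ ∈ D | ∃ s ∈ S, τ ≤ s} := fun p q hpq hp =>
    (hLR _ (hrange q)).resolve_right (hcross p q hpq hp)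
  obtain ⟨a, ha⟩ := h₁.exists_isLUB {κ | e₁ κ ∈ {τ ∈ D | ∃ s ∈ S, τ ≤ s}}
  rcases hLR _ (hrange a) with haL | haR
  · refine absurd (fun s hs => ?_) (hM' _ haL)
    rcases hA.between s (hS hs) with ⟨κ, rfl⟩ | ⟨p, q, hpq, h5, h6⟩
    · exact h₁.mono (ha.1 (hSL _ hs))
    · have hpL : e₁ p ∈ {τ ∈ D | ∃ s ∈ S, τ ≤ s} := ⟨hrange p, s, hs, h5⟩
      exact h6.trans (h₁.mono (ha.1 (hcross' p q hpq hpL)))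
  · refine ⟨_, hrange a, fun s hs => (haR.2 s hs).le, fun u hu hu' => ?_⟩
    have huR := hub u hu hu'
    refine (hA.sys.lt_or_le hu (hrange a)).resolve_left fun hua => ?_
    rcases hA.between u hu with ⟨κ, rfl⟩ | ⟨p, q, hpq, h5, h6⟩
    · have hκa : κ < a := not_le.1 fun h => hua.not_ge (h₁.mono h)
      refine hκa.not_ge (ha.2 fun κ' hκ' => not_lt.1 fun h => ?_)
      exact (hlt _ hκ' _ huR).not_ge (h₁.mono h.le)
    · have hqR : e₁ q ∈ {τ ∈ D | ∀ s ∈ S, s < τ} :=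
        ⟨hrange q, fun s hs => (huR.2 s hs).trans_le h6⟩
      have hpR : e₁ p ∈ {τ ∈ D | ∀ s ∈ S, s < τ} :=
        (hLR _ (hrange p)).resolve_left fun h => (hlt _ (hcross' p q hpq h) _ hqR).ne rfl
      have hap : a ≤ p := ha.2 fun κ' hκ' => not_lt.1 fun h =>
        (hlt _ hκ' _ hpR).not_ge (h₁.mono h.le)
      exact hua.not_ge ((h₁.mono hap).trans h5)

end IsAdmissible

/-! ### Jumps and doubled members in a maximal chain -/

open VSep

/-- A separation between `s` and `t` is determined by its intersection with a set that contains
`arcIn P₀ s t \ X` and `P₀`. -/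
theorem IsCutChain.finite_between {V : Type u} {X P₀ N : Set V} {D : Set (VSep V)}
    (h : IsCutChain X P₀ D) {s t : VSep V} (hs : s ∈ D) (ht : t ∈ D) (hN : N.Finite)
    (h0 : P₀ ⊆ N) (hst : arcIn P₀ s t \ X ⊆ N) : {r ∈ D | s ≤ r ∧ r ≤ t}.Finite := by
  -- Outside `N`, the sides of an intermediate member are already fixed by `s` and `t`, so only
  -- finitely many choices remain.
  have key : ∀ r ∈ {r ∈ D | s ≤ r ∧ r ≤ t}, r.left = s.left ∪ (r.left ∩ N) ∧
      r.right = t.right ∪ (r.right ∩ N) := by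
    rintro r ⟨hr, hsr, hrt⟩
    constructor
    · refine subset_antisymm (fun x hx => ?_) (Set.union_subset hsr.1 Set.inter_subset_left)
      by_cases hxs : x ∈ s.left
      · exact Or.inl hxs
      refine Or.inr ⟨hx, ?_⟩
      have h1 : x ∈ s.left ∪ s.right ∪ P₀ := h.cover s hs ▸ Set.mem_univ x
      rcases h1 with (h1 | h1) | h1
      · exact absurd h1 hxs
      · exact hst ⟨Or.inl ⟨hrt.1 hx, h1⟩, fun hX => hxs (h.left s hs hX)⟩
      · exact h0 h1
    · refine subset_antisymm (fun x hx => ?_) (Set.union_subset hrt.2 Set.inter_subset_left)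
      by_cases hxt : x ∈ t.right
      · exact Or.inl hxt
      refine Or.inr ⟨hx, ?_⟩
      have h1 : x ∈ t.left ∪ t.right ∪ P₀ := h.cover t ht ▸ Set.mem_univ x
      rcases h1 with (h1 | h1) | h1
      · exact hst ⟨Or.inl ⟨h1, hsr.2 hx⟩, fun hX => hxt (h.right t ht hX)⟩
      · exact absurd h1 hxt
      · exact h0 h1
  refine Set.Finite.of_injOn (f := fun r : VSep V => (r.left ∩ N, r.right ∩ N))
    (t := (𝒫 N) ×ˢ (𝒫 N)) (fun r _ => ⟨Set.inter_subset_right, Set.inter_subset_right⟩) ?_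
    (hN.powerset.prod hN.powerset)
  intro r hr r' hr' hrr
  simp only [Prod.mk.injEq] at hrr
  refine VSep.ext ?_ ?_
  · rw [(key r hr).1, (key r' hr').1, hrr.1]
  · rw [(key r hr).2, (key r' hr').2, hrr.2]

theorem LinSys.finite_pt {V : Type u} {U : SepUniverse V} {k : ℕ} {X P₀ : Set V} {D : Set (VSep V)}
    (h : LinSys U k X P₀ D) {s : VSep V} (hs : s ∈ D) : (pt X P₀ s).Finite := by
  obtain ⟨m, -, hm⟩ := h.exists_card
  refine Set.encard_ne_top_iff.1 ?_
  rw [(hm s).1 (h.card s hs)]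
  exact ENat.natCast_ne_top m

namespace IsAdmissible

variable {V K₁ : Type u} [LinearOrder K₁] {U : SepUniverse V} {k : ℕ} {X P₀ : Set V}
  {e₁ : K₁ → VSep V} {D D₂ : Set (VSep V)}

/-- Maximality speaks only about single jumps of the coarser line, so two members within one such
jump are wanted. If two pairs of `e₁` lie strictly between, so does a jump of `e₁`, whose ends
differ as no doubled member is there. Otherwise one moves above the last pair of `e₁`. -/
theorem exists_pair_of_dense (hA : IsAdmissible U k X P₀ e₁ D D₂) (h₁ : LinModel U k X P₀ e₁)
    {σ τ : VSep V} (hσ : σ ∈ D) (hτ : τ ∈ D) (hlt : τ < σ)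
    (hno1 : ∀ c ∈ D, ∀ c' ∈ D, τ ≤ c → c < c' → c' ≤ σ → ∃ r ∈ D, c < r ∧ r < c')
    (hno2 : ∀ r ∈ D₂, τ < r → ¬ r < σ) : ∃ ρ₁ ∈ D, ∃ ρ₂ ∈ D, τ < ρ₁ ∧ ρ₁ < ρ₂ ∧ ρ₂ < σ ∧
      ∃ p q, p ⋖ q ∧ e₁ p ≤ ρ₁ ∧ ρ₂ ≤ e₁ q := by
  have hrange : ∀ a, e₁ a ∈ D := fun a => hA.range_subset ⟨a, rfl⟩
  have key : ∀ τ' ∈ D, τ ≤ τ' → τ' < σ → (∀ a, τ' < e₁ a → ¬ e₁ a < σ) →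
      ∃ ρ₁ ∈ D, ∃ ρ₂ ∈ D, τ < ρ₁ ∧ ρ₁ < ρ₂ ∧ ρ₂ < σ ∧ ∃ p q, p ⋖ q ∧ e₁ p ≤ ρ₁ ∧ ρ₂ ≤ e₁ q := by
    intro τ' hτ' h1 h2 h3
    obtain ⟨ρ₁, hρ₁, h4, h5⟩ := hno1 τ' hτ' σ hσ h1 h2 le_rfl
    obtain ⟨ρ₂, hρ₂, h6, h7⟩ := hno1 ρ₁ hρ₁ σ hσ (h1.trans h4.le) h5 le_rfl
    refine ⟨ρ₁, hρ₁, ρ₂, hρ₂, h1.trans_lt h4, h6, h7, ?_⟩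
    rcases hA.between ρ₁ hρ₁ with ⟨a, rfl⟩ | ⟨p, q, hpq, h8, h9⟩
    · exact absurd h5 (h3 a h4)
    · refine ⟨p, q, hpq, h8, (hA.sys.lt_or_le (hrange q) hρ₂).resolve_left fun h10 => ?_⟩
      exact h3 q (h4.trans_le h9) (h10.trans h7)
  by_cases ha : ∃ a, τ < e₁ a ∧ e₁ a < σ
  · obtain ⟨a, ha1, ha2⟩ := ha
    by_cases hb : ∃ b, e₁ a < e₁ b ∧ e₁ b < σ
    · obtain ⟨b, hb1, hb2⟩ := hb
      have hab : a < b := not_le.1 fun h => hb1.not_ge (h₁.mono h)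
      obtain ⟨p, q, h1, hpq, h2⟩ := h₁.exists_covBy a b hab
      have h3 := ha1.trans_le (h₁.mono h1)
      have h4 := (h₁.mono h2).trans_lt hb2
      refine ⟨_, hrange p, _, hrange q, h3, (h₁.mono hpq.1.le).lt_of_ne fun e => ?_, h4, p, q, hpq,
        le_rfl, le_rfl⟩
      exact hno2 _ (hA.doubles_subset ⟨p, q, hpq.1, e, rfl⟩) (e ▸ h3) h4
    · push Not at hb
      exact key _ (hrange a) ha1.le ha2 hb
  · push Not at ha
    exact key τ hτ le_rfl hlt ha

/-- Between any two members of a maximal chain there is a jump or a doubled member. -/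
theorem exists_jump_or_double (hA : IsAdmissible U k X P₀ e₁ D D₂)
    (hmax : ∀ F F₂, IsAdmissible U k X P₀ e₁ F F₂ → D ⊆ F → D₂ ⊆ F₂ → F = D ∧ F₂ = D₂)
    (h₁ : LinModel U k X P₀ e₁)
    (hU : U.LimitClosed) {v₂ v₃ v₄ : VSep V} (hv : Spread X P₀ v₂ v₃ v₄) (h2 : v₂ ∈ Set.range e₁)
    (h3 : v₃ ∈ Set.range e₁) (h4 : v₄ ∈ Set.range e₁)
    (hQ : DistinguishesProfiles U k P₀ (Set.range e₁)) {σ τ : VSep V} (hσ : σ ∈ D) (hτ : τ ∈ D)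
    (hlt : τ < σ) :
    (∃ c ∈ D, ∃ c' ∈ D, τ ≤ c ∧ c < c' ∧ c' ≤ σ ∧ ∀ r ∈ D, c < r → ¬ r < c') ∨
      ∃ r ∈ D₂, τ < r ∧ r < σ := by
  by_contra! hcon
  obtain ⟨hno1, hno2⟩ := hcon
  obtain ⟨ρ₁, hρ₁, ρ₂, hρ₂, h5, h6, h7, p, q, hpq, hp, hq⟩ :=
    hA.exists_pair_of_dense h₁ hσ hτ hlt hno1 fun r hr h h' => hno2 r hr h h'
  have hin := hA.sys.inter hρ₁ hρ₂ h6.le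
  have hmem : ∀ {y}, y ∉ X → y ∈ arcIn P₀ ρ₁ ρ₂ → y ∈ arcOut P₀ ρ₁ ρ₂ →
      y ∈ pt X P₀ ρ₁ ∪ pt X P₀ ρ₂ := by
    intro y hX hy hy'
    exact ((hin ▸ ⟨hy, hy'⟩ : y ∈ pt X P₀ ρ₁ ∪ pt X P₀ ρ₂ ∪ X)).resolve_right hX
  -- By maximality `v` cannot be doubled, so a doubled `t` has the same vertex set. As `t` lies
  -- outside the interval, these vertices are in the separator of `ρ₁` and `ρ₂`.
  have hpt : ∀ v ∈ D, ρ₁ ≤ v → v ≤ ρ₂ → pt X P₀ v ⊆ pt X P₀ ρ₁ ∪ pt X P₀ ρ₂ := by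
    intro v hvD h8 h9 y hy
    have hvt : ¬ ∀ t ∈ D₂, pt X P₀ t = pt X P₀ v → t = v := fun hstar =>
      hno2 v (hA.mem_doubles_of_star hmax hvD ⟨p, q, hpq, hp.trans h8, h9.trans hq⟩ hstar)
        (h5.trans_le h8) (h9.trans_lt h7)
    push Not at hvt
    obtain ⟨t, ht, htv, -⟩ := hvt
    have htD := hA.subset ht
    refine hmem hy.2 (arcIn_mono P₀ h8 h9 hy.1) ?_
    rw [← htv] at hy
    refine arcIn_subset_arcOut P₀ ?_ hy.1
    rcases hA.sys.lt_or_le hτ htD with h10 | h10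
    · exact Or.inr (h7.le.trans ((hA.sys.lt_or_le htD hσ).resolve_left (hno2 t ht h10)))
    · exact Or.inl (h10.trans h5.le)
  -- A vertex of the arc outside `X` lies in a cut point or in a jump, and there is no jump in the
  -- interval. In all cases it belongs to the finite separator, so finitely many members fit in
  -- between.
  have hfin : {r ∈ D | ρ₁ ≤ r ∧ r ≤ ρ₂}.Finite := by
    refine hA.sys.finite_between (N := pt X P₀ ρ₁ ∪ pt X P₀ ρ₂ ∪ P₀) hρ₁ hρ₂ ?_
      Set.subset_union_right ?_
    · exact ((hA.sys.finite_pt hρ₁).union (hA.sys.finite_pt hρ₂)).union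
        (hA.sys.pt_bot ▸ hA.sys.finite_pt hA.sys.bot_mem)
    · rintro y ⟨hy, hX⟩
      by_cases hyD : ∃ s ∈ D, y ∈ pt X P₀ s
      · obtain ⟨s, hs, hys⟩ := hyD
        refine Or.inl ?_
        rcases hA.sys.lt_or_le hs hρ₁ with h8 | h8
        · exact hmem hX hy (arcIn_subset_arcOut P₀ (Or.inl h8.le) hys.1)
        rcases hA.sys.lt_or_le hρ₂ hs with h9 | h9
        · exact hmem hX hy (arcIn_subset_arcOut P₀ (Or.inr h9.le) hys.1)
        · exact hpt s hs h8 h9 hys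
      · push Not at hyD
        obtain ⟨c, hc, c', hc', hcc, hno, hyc⟩ :=
          hA.exists_jump_of_forall_notMem hmax h₁ hU hv h2 h3 h4 hQ hX hyD
        refine Or.inl (hmem hX hy (arcIn_subset_arcOut P₀ ?_ hyc))
        rcases hA.sys.lt_or_le hρ₁ hc' with h8 | h8
        · refine Or.inr ((hA.sys.lt_or_le hc hρ₂).resolve_left fun h9 => ?_)
          have h10 : ρ₁ ≤ c := (hA.sys.lt_or_le hc hρ₁).resolve_left fun h => hno _ hρ₁ h h8
          have h11 : c' ≤ ρ₂ := (hA.sys.lt_or_le hρ₂ hc').resolve_left fun h => hno _ hρ₂ h9 h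
          obtain ⟨r, hr, h12, h13⟩ := hno1 c hc c' hc' (h5.le.trans h10) hcc (h11.trans h7.le)
          exact hno r hr h12 h13
        · exact Or.inl h8
  have hfin' : {r ∈ D | ρ₁ < r ∧ r ≤ ρ₂}.Finite :=
    hfin.subset fun r hr => ⟨hr.1, hr.2.1.le, hr.2.2⟩
  -- The least member above `ρ₁` forms a jump with it, which was excluded.
  obtain ⟨m, hm⟩ := hfin'.exists_minimal ⟨ρ₂, hρ₂, h6, le_rfl⟩
  obtain ⟨r, hr, h8, h9⟩ := hno1 ρ₁ hρ₁ m hm.prop.1 h5.le hm.prop.2.1 (hm.prop.2.2.trans h7.le)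
  exact h9.not_ge (hm.le_of_le ⟨hr, h8, h9.le.trans hm.prop.2.2⟩ h9.le)

/-- A maximal chain with doubled members is the line of a pseudoflower. -/
theorem linModel (hA : IsAdmissible U k X P₀ e₁ D D₂)
    (hmax : ∀ F F₂, IsAdmissible U k X P₀ e₁ F F₂ → D ⊆ F → D₂ ⊆ F₂ → F = D ∧ F₂ = D₂)
    (h₁ : LinModel U k X P₀ e₁)
    (hU : U.LimitClosed) {v₂ v₃ v₄ : VSep V} (hv : Spread X P₀ v₂ v₃ v₄) (h2 : v₂ ∈ Set.range e₁)
    (h3 : v₃ ∈ Set.range e₁) (h4 : v₄ ∈ Set.range e₁)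
    (hQ : DistinguishesProfiles U k P₀ (Set.range e₁)) :
    LinModel U k X P₀ (DoubledChain.sep : DoubledChain hA.sys.chain D₂ → VSep V) where
  mono := DoubledChain.sep_mono
  exists_bot := ⟨.lo D₂ _ hA.sys.bot_mem, fun c => DoubledChain.lo_le _ (hA.sys.bot_le c.sep_mem), rfl⟩
  exists_top := ⟨.hi D₂ _ hA.sys.top_mem, fun c => DoubledChain.le_hi _ (hA.sys.le_top c.sep_mem), rfl⟩
  sys := by rw [DoubledChain.range_sep]; exact hA.sys
  sep a b hab _ := by
    have hself : ∀ {s}, s ∈ D → arcSep P₀ s s ∈ U.seps := fun hs => hA.sys.arcSep_self hv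
      (hA.range_subset h2) (hA.range_subset h3) (hA.range_subset h4) hs
    rcases (DoubledChain.sep_mono hab.le).eq_or_lt with e | hlt
    · rw [← e]
      exact hself a.sep_mem
    -- The pair of bottom and top, left out in `LinSys.sep`, can occur when an end is doubled. Its
    -- arc is the inverse of the degenerate arc at the base point.
    · by_cases hbt : a.sep = botSep X ∧ b.sep = topSep X
      · rw [hbt.1, hbt.2, hA.sys.arcSep_top hA.sys.bot_mem]
        exact U.inv_mem _ (hself hA.sys.bot_mem)
      · exact hA.sys.sep _ a.sep_mem _ b.sep_mem hlt hbt
  exists_isLUB S := by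
    obtain ⟨a, ha, ha1, ha2⟩ := hA.exists_isLUB hmax h₁ hU hv h2 h3 h4 hQ
      (S := DoubledChain.sep '' S) (by rintro _ ⟨x, -, rfl⟩; exact x.sep_mem)
    -- The supremum of the pairs is taken in its first copy unless the second copy is itself in `S`.
    by_cases hS : ∃ x ∈ S, x.sep = a ∧ x.flag = true
    · obtain ⟨x, hx, hxa, hxf⟩ := hS
      refine ⟨x, fun y hy => ?_, fun u hu => hu hx⟩
      have h5 : y.sep ≤ x.sep := hxa ▸ ha1 _ ⟨y, hy, rfl⟩
      refine not_lt.1 fun hlt => ?_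
      rcases DoubledChain.lt_iff.1 hlt with h6 | ⟨-, h6, -⟩
      · exact h6.not_ge h5
      · rw [hxf] at h6
        exact Bool.false_ne_true h6.symm
    · refine ⟨.lo D₂ _ ha, fun y hy => ?_, fun u hu => ?_⟩
      · have h5 : y.sep ≤ a := ha1 _ ⟨y, hy, rfl⟩
        refine not_lt.1 fun hlt => ?_
        rcases DoubledChain.lt_iff.1 hlt with h6 | ⟨h6, -, h7⟩
        · exact h6.not_ge h5
        · exact hS ⟨y, hy, h6.symm, h7⟩
      · refine DoubledChain.lo_le _ (ha2 _ u.sep_mem ?_)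
        rintro _ ⟨x, hx, rfl⟩
        exact DoubledChain.sep_mono (hu hx)
  exists_covBy a b hab := by
    rcases (DoubledChain.sep_mono hab.le).eq_or_lt with e | hlt
    · have hcov : a ⋖ b := by
        refine ⟨hab, fun x h5 h6 => ?_⟩
        rcases DoubledChain.lt_iff.1 h5 with h7 | ⟨-, -, h7⟩
        · exact (h7.trans_le (DoubledChain.sep_mono h6.le)).ne e
        · rcases DoubledChain.lt_iff.1 h6 with h8 | ⟨-, h8, -⟩
          · exact ((DoubledChain.sep_mono h5.le).trans_lt h8).ne e
          · rw [h7] at h8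
            exact Bool.false_ne_true h8.symm
      exact ⟨a, b, le_rfl, hcov, le_rfl⟩
    · rcases hA.exists_jump_or_double hmax h₁ hU hv h2 h3 h4 hQ b.sep_mem a.sep_mem hlt with
        ⟨c, hc, c', hc', h5, h6, h7, hno⟩ | ⟨r, hr, h5, h6⟩
      · exact ⟨_, _, DoubledChain.le_hi hc h5, DoubledChain.hi_covBy_lo hc hc' h6 hno,
          DoubledChain.lo_le hc' h7⟩
      · have h7 := DoubledChain.lo_covBy_hi (h := hA.sys.chain) (hA.subset hr) hr
        exact ⟨_, _, (DoubledChain.lt_of_sep_lt h5).le, h7,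
          (DoubledChain.lt_of_sep_lt (x := .hi D₂ _ (hA.subset hr)) h6).le⟩
  loc x hx := by
    by_cases hD : ∃ s ∈ D, x ∈ pt X P₀ s
    · obtain ⟨s, hs, hxs⟩ := hD
      exact Or.inl ⟨.lo D₂ _ hs, hxs⟩
    · push Not at hD
      obtain ⟨c, hc, c', hc', hcc, hno, hxc⟩ :=
        hA.exists_jump_of_forall_notMem hmax h₁ hU hv h2 h3 h4 hQ hx hD
      exact Or.inr ⟨_, _, DoubledChain.hi_covBy_lo hc hc' hcc hno, hxc⟩
  star p s p' s' hps hps' he he' hpt := by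
    have key : ∀ {a b : DoubledChain hA.sys.chain D₂}, a ⋖ b → a.sep = b.sep →
        a.sep ∈ D₂ ∧ a.flag = false := by
      intro a b hab e
      rcases DoubledChain.lt_iff.1 hab.1 with h5 | ⟨-, h5, h6⟩
      · exact absurd e h5.ne
      · exact ⟨e ▸ DoubledChain.sep_mem_of_flag h6, h5⟩
    obtain ⟨h5, h6⟩ := key hps he
    obtain ⟨h7, h8⟩ := key hps' he'
    exact DoubledChain.ext (hA.star _ h5 _ h7 hpt) (h6.trans h8.symm)
  mid := by
    have h5 := hA.range_subset h3
    refine ⟨.lo D₂ _ h5, ⟨.lo D₂ _ hA.sys.bot_mem, DoubledChain.lt_of_sep_lt ?_⟩,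
      ⟨.lo D₂ _ hA.sys.top_mem, DoubledChain.lt_of_sep_lt ?_⟩, hv.d03⟩
    · exact (hA.sys.bot_le h5).lt_of_ne hv.ne_bot.2.1.symm
    · exact (hA.sys.le_top h5).lt_of_ne hv.ne_top.2.1

end IsAdmissible

/-! ### Embedding the coarser line into the doubled chain -/

open VSep

namespace IsAdmissible

variable {V K₁ : Type u} [LinearOrder K₁] {U : SepUniverse V} {k : ℕ} {X P₀ : Set V}
  {e₁ : K₁ → VSep V} {D D₂ : Set (VSep V)}

/-- An element of the coarser line is mapped to the second copy of its separation if this is needed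
for the new copy to lie in a jump. -/
noncomputable def embed (hA : IsAdmissible U k X P₀ e₁ D D₂) (v : K₁) :
    DoubledChain hA.sys.chain D₂ :=
  open Classical in
  ⟨(e₁ v, decide (e₁ v ∈ D₂ ∧ ((∃ v' < v, e₁ v' = e₁ v) ∨ ¬ ∃ s, v ⋖ s))), hA.range_subset ⟨v, rfl⟩,
    fun h => (of_decide_eq_true h).1⟩

theorem flag_embed (hA : IsAdmissible U k X P₀ e₁ D D₂) {v : K₁} :
    (hA.embed v).flag = true ↔ e₁ v ∈ D₂ ∧ ((∃ v' < v, e₁ v' = e₁ v) ∨ ¬ ∃ s, v ⋖ s) := by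
  classical
  exact decide_eq_true_iff

theorem flag_embed_of_eq (hA : IsAdmissible U k X P₀ e₁ D D₂) (h₁ : LinModel U k X P₀ e₁) {v w : K₁}
    (hvw : v < w) (he : e₁ v = e₁ w) : (hA.embed v).flag = false ∧ (hA.embed w).flag = true := by
  have h1 := h₁.exists_jump_of_eq hvw he
  constructor
  · refine Bool.eq_false_iff.2 fun h => ?_
    obtain ⟨-, ⟨v', hv', he'⟩ | h2⟩ := hA.flag_embed.1 h
    · have h3 := h₁.exists_jump_of_eq hv' he'
      exact hv'.ne (h₁.star v' v v w h3 h1 he' he (by rw [he']))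
    · exact h2 ⟨w, h1⟩
  · exact hA.flag_embed.2 ⟨hA.doubles_subset ⟨v, w, hvw, he, rfl⟩, Or.inl ⟨v, hvw, he⟩⟩

/-- An admissible chain refines the line `e₁`. -/
theorem isRefinement (hA : IsAdmissible U k X P₀ e₁ D D₂) (h₁ : LinModel U k X P₀ e₁) :
    IsRefinement e₁ (DoubledChain.sep : DoubledChain hA.sys.chain D₂ → VSep V) hA.embed where
  comp _ := rfl
  strictMono v w hvw := by
    rcases (h₁.mono hvw.le).eq_or_lt with he | hlt
    · exact DoubledChain.lt_iff.2 (Or.inr ⟨he, hA.flag_embed_of_eq h₁ hvw he⟩)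
    · exact DoubledChain.lt_of_sep_lt hlt
  cover κ := by
    by_cases hr : ∃ v, e₁ v = κ.sep
    swap
    · rcases hA.between _ κ.sep_mem with ⟨v, hv⟩ | ⟨p, q, hpq, h1, h2⟩
      · exact absurd ⟨v, hv⟩ hr
      · exact Or.inr ⟨p, q, hpq, DoubledChain.lt_of_sep_lt (h1.lt_of_ne fun h => hr ⟨p, h⟩),
          DoubledChain.lt_of_sep_lt (h2.lt_of_ne fun h => hr ⟨q, h.symm⟩)⟩
    by_cases hf : ∃ v, e₁ v = κ.sep ∧ (hA.embed v).flag = κ.flag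
    · obtain ⟨v, h1, h2⟩ := hf
      exact Or.inl ⟨v, DoubledChain.ext h1 h2⟩
    right
    push Not at hf
    -- Two elements with the same pair would occupy both copies, and `κ` would be one of them.
    have huniq : ∀ {v w}, v < w → e₁ v = κ.sep → e₁ w ≠ κ.sep := by
      intro v w hvw hv hw
      have h1 := hA.flag_embed_of_eq h₁ hvw (hv.trans hw.symm)
      have h2 := hf v hv
      have h3 := hf w hw
      rw [h1.1] at h2
      rw [h1.2] at h3
      cases h : κ.flag
      · exact h2 h.symm
      · exact h3 h.symm
    obtain ⟨v, hv⟩ := hr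
    have hvf := hf v hv
    -- The only element with this pair occupies the other copy. If `κ` is the first copy, `v` moved
    -- to the second for lack of a successor, and `κ` lies in the jump below `v`. If `κ` is the
    -- second copy, it lies in the jump above `v`.
    cases hκ : κ.flag
    · rw [hκ] at hvf
      have hvt := Bool.eq_true_of_not_eq_false hvf
      obtain ⟨h1, ⟨v', hv', he'⟩ | h2⟩ := hA.flag_embed.1 hvt
      · exact absurd hv (huniq hv' (he'.trans hv))
      · obtain ⟨p, q, hpq, h3, h4⟩ := hA.doubles_between _ h1
        have hpv : p ≤ v := not_lt.1 fun h =>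
          huniq h hv (h3.antisymm (h₁.mono h.le) |>.trans hv)
        have hvq : v ≤ q := not_lt.1 fun h =>
          huniq h ((h₁.mono h.le).antisymm h4 |>.trans hv) hv
        have hpv' : p < v := hpv.lt_of_ne fun h => h2 ⟨q, h ▸ hpq⟩
        have hq : q = v := (hvq.lt_or_eq.resolve_left fun h => hpq.2 hpv' h).symm
        subst hq
        refine ⟨p, q, hpq, DoubledChain.lt_of_sep_lt ?_, DoubledChain.lt_iff.2 (Or.inr ⟨hv.symm, hκ, hvt⟩)⟩
        show e₁ p < κ.sep
        rw [← hv]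
        exact h3.lt_of_ne fun h => huniq hpv' (h.trans hv) hv
    · rw [hκ] at hvf
      have hvt := Bool.eq_false_iff.2 hvf
      have h1 : e₁ v ∈ D₂ := hv ▸ DoubledChain.sep_mem_of_flag hκ
      have h2 : ∃ s, v ⋖ s := by
        by_contra h
        exact hvf (hA.flag_embed.2 ⟨h1, Or.inr h⟩)
      obtain ⟨t, ht⟩ := h2
      refine ⟨v, t, ht, DoubledChain.lt_iff.2 (Or.inr ⟨hv, hvt, hκ⟩), DoubledChain.lt_of_sep_lt ?_⟩
      show κ.sep < e₁ t
      rw [← hv]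
      exact (h₁.mono ht.1.le).lt_of_ne fun h => huniq ht.1 hv (h.symm.trans hv)

end IsAdmissible

open VSep

/-! ### From maximal chains to maximal pseudoflowers -/

theorem JumpLine.isRefinement_cut {S K : Type u} [LinearOrder K] {e : K → S}
    {e₂ : {x // x ∉ JumpLine.petals K} → S}
    (he : ∀ κ, e₂ ⟨JumpLine.cut κ, JumpLine.cut_notMem κ⟩ = e κ) :
    IsRefinement e e₂ fun κ => ⟨JumpLine.cut κ, JumpLine.cut_notMem κ⟩ where
  strictMono _ _ h := JumpLine.cut_lt_cut.2 h
  comp := he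
  cover := by
    rintro ⟨x, hx⟩
    obtain ⟨κ, rfl⟩ := JumpLine.exists_eq_cut hx
    exact Or.inl ⟨κ, rfl⟩

namespace LinModel

variable {V K : Type u} [LinearOrder K] {U : SepUniverse V} {k : ℕ} {X P₀ : Set V} {e : K → VSep V}

/-- Decoding a family into a line and encoding it again returns the same pairs, provided `d` is
disjoint from the base point; so a limit of encoded data can be compared with a given pseudoflower.
-/
theorem lineSep_cut (h : LinModel U k X P₀ e) [BoundedOrder K] {d : K}
    (hd : Disjoint P₀ (pt X P₀ (e d))) (κ : K) :
    lineSep X (JumpLine.family X P₀ e) (JumpLine.cut d) (JumpLine.cut κ) = e κ := by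
  obtain ⟨e0, e1⟩ := h.bot_or_top
  have h0 : JumpLine.family X P₀ e ⊥ = P₀ := by
    rw [← JumpLine.cut_bot, JumpLine.family_cut, e0, h.sys.pt_bot]
  have hl : lineIn X (JumpLine.family X P₀ e) ⊥ (JumpLine.cut κ) = (e κ).left ∪ P₀ := by
    rw [← JumpLine.cut_bot, h.lineIn_cut bot_le, e0]
    ext x
    simp only [arcIn, botSep, Set.mem_union, Set.mem_inter_iff, Set.mem_univ]
    tauto
  have hr : lineIn X (JumpLine.family X P₀ e) (JumpLine.cut κ) ⊤ = (e κ).right ∪ P₀ := by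
    rw [← JumpLine.cut_top, h.lineIn_cut le_top, e1]
    ext x
    simp only [arcIn, topSep, Set.mem_union, Set.mem_inter_iff, Set.mem_univ]
    tauto
  have hdn : ∀ {x}, x ∈ P₀ → x ∉ (e d).left ∧ x ∉ (e d).right := fun hx =>
    notMem_of_disjoint_pt h.sys.disj hd hx
  have hX : ∀ {x}, x ∈ P₀ → x ∉ X := fun hx => Set.disjoint_left.1 h.sys.disj hx
  have hpt : ∀ {x}, x ∈ P₀ → (x ∈ pt X P₀ (e κ) ↔ x ∈ (e κ).left ∨ x ∈ (e κ).right) := by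
    intro x hx
    have := hX hx
    simp only [pt, arcIn, Set.mem_sdiff, Set.mem_union, Set.mem_inter_iff]
    tauto
  have hlt : ∀ {x}, x ∈ P₀ → d ≤ κ → x ∉ (e κ).right := fun hx hdκ hx' =>
    (hdn hx).2 ((h.mono hdκ).2 hx')
  have hgt : ∀ {x}, x ∈ P₀ → κ ≤ d → x ∉ (e κ).left := fun hx hdκ hx' =>
    (hdn hx).1 ((h.mono hdκ).1 hx')
  refine VSep.ext ?_ ?_
  · ext x
    have h3 := fun hx => hpt (x := x) hx
    have h4 := fun hx => hlt (x := x) hx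
    have h5 := fun hx => hgt (x := x) hx
    have h6 := le_total d κ
    have h7 := lt_iff_not_ge (a := d) (b := κ)
    simp only [lineSep, hl, h0, JumpLine.family_cut, JumpLine.cut_lt_cut, Set.mem_union,
      Set.mem_sdiff, Set.mem_ofPred_eq]
    grind
  · ext x
    have h3 := fun hx => hpt (x := x) hx
    have h4 := fun hx => hlt (x := x) hx
    have h5 := fun hx => hgt (x := x) hx
    have h6 := le_total d κ
    have h7 := lt_iff_not_ge (a := κ) (b := d)
    simp only [lineSep, hr, h0, JumpLine.family_cut, JumpLine.cut_lt_cut, Set.mem_union,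
      Set.mem_sdiff, Set.mem_ofPred_eq]
    grind

/-- The cut points of a pseudoflower, seen from the cut point `b`, form a line. -/
theorem _root_.Pseudoflower.linModel {Φ : Pseudoflower U k} {b d : Φ.C} (hb : b ∉ Φ.I) (hd : d ∉ Φ.I)
    (hdb : d ≠ b) (hdis : Disjoint (Φ.P b) (Φ.P d)) :
    LinModel U k Φ.X (Φ.P b) fun v : {x // x ∉ Line.image b Φ.I} =>
      lineSep Φ.X (Line.family b Φ.P) (Line.of b d) v :=
  (Φ.linFlower hb).linModel (fun h => hd (Line.of_mem_image.1 h)) (Line.of_injective.ne hdb)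
    (Line.of_ne_top d) hdis

/-- A line that refines the line of a pseudoflower gives an extension of this pseudoflower. -/
theorem extendedBy_of_isRefinement {Φ : Pseudoflower U k} {b d : Φ.C} (hb : b ∉ Φ.I) (hd : d ∉ Φ.I)
    (hdb : d ≠ b) (hdis : Disjoint (Φ.P b) (Φ.P d)) (h : LinModel U k Φ.X (Φ.P b) e) [BoundedOrder K]
    {g : {x // x ∉ Line.image b Φ.I} → K}
    (hg : IsRefinement (fun v : {x // x ∉ Line.image b Φ.I} =>
      lineSep Φ.X (Line.family b Φ.P) (Line.of b d) v) e g) :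
    Φ.ExtendedBy h.linFlower.toPseudoflower := by
  have hd' : Line.of b d ∉ Line.image b Φ.I := fun h => hd (Line.of_mem_image.1 h)
  have hd0 : Line.of b d ≠ ⊥ := Line.of_injective.ne hdb
  have hd1 := Line.of_ne_top (b := b) d
  have hl := Φ.linFlower hb
  obtain ⟨δ, -, -, hδ⟩ := h.mid
  refine Φ.extendedBy_of_isRefinement hb h.linFlower (hg.trans (JumpLine.isRefinement_cut
    (e₂ := fun x => lineSep Φ.X (JumpLine.family Φ.X (Φ.P b) e) (JumpLine.cut δ) x)
    (h.lineSep_cut hδ))) (fun v w hvw => ?_) fun v w hvw => ?_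
  · refine (hl.arcIn_lineSep hd' hd0 hd1 hdis v.2 w.2 hvw).symm.trans ?_
    refine Eq.trans ?_ (h.lineIn_cut (hg.strictMono.monotone hvw)).symm
    rw [hg.comp, hg.comp]
    rfl
  · refine (hl.arcOut_lineSep (d := Line.of b d)).symm.trans ?_
    refine Eq.trans ?_ (h.lineOut_cut (hg.strictMono.monotone hvw.le)).symm
    rw [hg.comp, hg.comp]
    rfl

end LinModel

namespace IsAdmissible

variable {V K₁ : Type u} [LinearOrder K₁] {U : SepUniverse V} {k : ℕ} {X P₀ : Set V}
  {e₁ : K₁ → VSep V} {D D₂ : Set (VSep V)}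

/-- The pairs of a line finer than `e₁`, together with its doubled ones, form an admissible pair
over `e₁`, since a refinement changes only jumps. Maximality leaves nothing to add. -/
theorem eq_of_isRefinement
    (hmax : ∀ F F₂, IsAdmissible U k X P₀ e₁ F F₂ → D ⊆ F → D₂ ⊆ F₂ → F = D ∧ F₂ = D₂)
    {K' : Type u} [LinearOrder K'] {e' : K' → VSep V}
    (hm : LinModel U k X P₀ e') {g : K₁ → K'} (hg : IsRefinement e₁ e' g) (hD : D ⊆ Set.range e')
    (hD₂ : D₂ ⊆ doubles e') : Set.range e' = D ∧ doubles e' = D₂ := by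
  have hA' := hm.isAdmissible
  refine hmax _ _ ⟨hA'.sys, ?_, ?_, hA'.subset, hA'.star, ?_, ?_⟩ hD hD₂
  · rintro _ ⟨v, rfl⟩
    exact ⟨g v, hg.comp v⟩
  · rintro _ ⟨v, w, hvw, rfl, he⟩
    exact ⟨g v, g w, hg.strictMono hvw, hg.comp v, (hg.comp w).trans he⟩
  · rintro _ ⟨c, rfl⟩
    rcases hg.cover c with ⟨v, rfl⟩ | ⟨p, q, hpq, h1, h2⟩
    · exact Or.inl ⟨v, (hg.comp v).symm⟩
    · exact Or.inr ⟨p, q, hpq, hg.comp p ▸ hm.mono h1.le, hg.comp q ▸ hm.mono h2.le⟩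
  · intro s hs
    obtain ⟨c, c', hcc, rfl, he⟩ := hm.exists_jump_of_mem_doubles hs
    obtain ⟨p, q, hpq, h1, h2⟩ := hg.exists_covBy hcc
    exact ⟨p, q, hpq, hg.comp p ▸ hm.mono h1, hg.comp q ▸ hm.mono (hcc.1.le.trans h2)⟩

/-- The pseudoflower of a maximal chain is maximal. -/
theorem isMaximal (hA : IsAdmissible U k X P₀ e₁ D D₂)
    (hmax : ∀ F F₂, IsAdmissible U k X P₀ e₁ F F₂ → D ⊆ F → D₂ ⊆ F₂ → F = D ∧ F₂ = D₂)
    (h₁ : LinModel U k X P₀ e₁) [BoundedOrder (DoubledChain hA.sys.chain D₂)]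
    (hK : LinModel U k X P₀ (DoubledChain.sep : DoubledChain hA.sys.chain D₂ → VSep V)) :
    hK.linFlower.toPseudoflower.IsMaximal := by
  intro Ψ hΨ
  obtain ⟨δ, ⟨c, hc⟩, ⟨c', hc'⟩, hδ⟩ := hK.mid
  obtain ⟨e0, e1⟩ := hK.bot_or_top
  have hP0 : JumpLine.family X P₀ (DoubledChain.sep : DoubledChain hA.sys.chain D₂ → VSep V) ⊥ = P₀ := by
    rw [← JumpLine.cut_bot, JumpLine.family_cut, e0, hK.sys.pt_bot]
  obtain ⟨hX, b, hb, hPb, d, hd, hdb, hPd, g, hg⟩ := hK.linFlower.exists_refinement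
    (d := JumpLine.cut δ) (JumpLine.cut_notMem δ)
    (by rw [← JumpLine.cut_bot]; exact JumpLine.cut_injective.ne (bot_le.trans_lt hc).ne')
    (by rw [← JumpLine.cut_top]; exact JumpLine.cut_injective.ne (hc'.trans_le le_top).ne) hΨ
  rw [hP0] at hPb
  rw [JumpLine.family_cut] at hPd
  have hcut := (JumpLine.isRefinement_cut
    (e₂ := fun x : {x // x ∉ JumpLine.petals (DoubledChain hA.sys.chain D₂)} =>
      lineSep X (JumpLine.family X P₀ DoubledChain.sep) (JumpLine.cut δ) x)
    (hK.lineSep_cut hδ)).trans hg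
  subst hX hPb
  rw [← hPd] at hδ
  have hm := Ψ.linModel hb hd hdb hδ
  obtain ⟨hD, hD₂⟩ := eq_of_isRefinement hmax hm ((hA.isRefinement h₁).trans hcut)
    (fun s hs => ⟨_, hcut.comp (.lo D₂ _ hs)⟩)
    fun s hs => ⟨_, _, hcut.strictMono (DoubledChain.lo_covBy_hi (hA.subset hs) hs).1,
      hcut.comp _, hcut.comp _⟩
  -- The line of `Ψ` has the same pairs and doubles as the maximal chain. Read as an admissible pair
  -- over the line of `Ψ`, they yield a refinement in the other direction.
  have hA' := hm.isAdmissible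
  rw [hD, hD₂] at hA'
  exact hK.extendedBy_of_isRefinement hb hd hdb hδ (hA'.isRefinement hm)

end IsAdmissible

/-- A pseudoflower whose line has a spread and distinguishes profiles extends to a maximal
pseudoflower. -/
theorem Pseudoflower.exists_isMaximal {V : Type u} {U : SepUniverse V} {k : ℕ} (hU : U.LimitClosed)
    {Φ : Pseudoflower U k} {b d : Φ.C} (hb : b ∉ Φ.I) (hd : d ∉ Φ.I)
    (hdb : d ≠ b) (hdis : Disjoint (Φ.P b) (Φ.P d)) {v₂ v₃ v₄ : VSep V}
    (hv : Spread Φ.X (Φ.P b) v₂ v₃ v₄)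
    (h2 : v₂ ∈ Set.range fun v : {x // x ∉ Line.image b Φ.I} =>
      lineSep Φ.X (Line.family b Φ.P) (Line.of b d) v)
    (h3 : v₃ ∈ Set.range fun v : {x // x ∉ Line.image b Φ.I} =>
      lineSep Φ.X (Line.family b Φ.P) (Line.of b d) v)
    (h4 : v₄ ∈ Set.range fun v : {x // x ∉ Line.image b Φ.I} =>
      lineSep Φ.X (Line.family b Φ.P) (Line.of b d) v)
    (hQ : DistinguishesProfiles U k (Φ.P b) (Set.range fun v : {x // x ∉ Line.image b Φ.I} =>
      lineSep Φ.X (Line.family b Φ.P) (Line.of b d) v)) :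
    ∃ Ψ : Pseudoflower U k, Φ.ExtendedBy Ψ ∧ Ψ.IsMaximal := by
  have h₁ := Φ.linModel hb hd hdb hdis
  obtain ⟨D, D₂, hA, hmax⟩ := h₁.isAdmissible.exists_maximal
  have hK := hA.linModel hmax h₁ hU hv h2 h3 h4 hQ
  obtain ⟨a, ha, -⟩ := hK.exists_bot
  obtain ⟨c, hc, -⟩ := hK.exists_top
  let _ : BoundedOrder (DoubledChain hA.sys.chain D₂) :=
    { bot := a, bot_le := ha, top := c, le_top := hc }
  exact ⟨hK.linFlower.toPseudoflower,
    hK.extendedBy_of_isRefinement hb hd hdb hdis (hA.isRefinement h₁), hA.isMaximal hmax h₁ hK⟩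

open VSep

/-! ### Four cut points in cyclic order -/

namespace Pseudoflower

variable {V : Type u} {U : SepUniverse V} {k : ℕ} {Φ Ψ : Pseudoflower U k}

/-- The order is `|P v ∪ P w| + |X|`, and it equals `k = 2|P v| + |X| = 2|P w| + |X|` only if the
intersection is empty. -/
theorem IsFlower.disjoint (h : Φ.IsFlower) {v w : Φ.C} (hv : v ∉ Φ.I) (hw : w ∉ Φ.I) (hvw : v ≠ w) :
    Disjoint (Φ.P v) (Φ.P w) := by
  have h1 := (h v hv w hw hvw).1
  have h2 := Φ.card_cutpoint v hv
  have h3 := Φ.card_cutpoint w hw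
  have hX : ∀ z, Disjoint (Φ.P z) Φ.X := fun z =>
    Set.disjoint_right.2 fun x hx => Φ.mem_X_iff.1 hx z
  have h4 : (Φ.P v ∪ Φ.P w).encard + Φ.X.encard = k := by
    rw [← Set.encard_union_eq (Set.disjoint_union_left.2 ⟨hX v, hX w⟩), ← Φ.separator v hv w hw hvw]
    exact h1
  have h5 := Set.encard_union_add_encard_inter (Φ.P v) (Φ.P w)
  have hfin : ∀ {a b : ℕ∞}, a + b = k → a ≠ ⊤ ∧ b ≠ ⊤ := by
    intro a b hab
    exact ⟨fun e => ENat.natCast_ne_top k (by rw [← hab, e, top_add]),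
      fun e => ENat.natCast_ne_top k (by rw [← hab, e, add_top])⟩
  have hfin2 : ∀ {a b : ℕ∞}, 2 * a + b = k → a ≠ ⊤ := by
    rintro a b hab rfl
    exact (hfin hab).1 (ENat.mul_top (by norm_num))
  obtain ⟨x, hx⟩ := ENat.ne_top_iff_exists.1 (hfin h2).2
  obtain ⟨p, hp⟩ := ENat.ne_top_iff_exists.1 (hfin2 h2)
  obtain ⟨q, hq⟩ := ENat.ne_top_iff_exists.1 (hfin2 h3)
  obtain ⟨r, hr⟩ := ENat.ne_top_iff_exists.1 (hfin h4).1
  rw [← hp, ← hq, ← hr] at h5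
  obtain ⟨t, ht⟩ := ENat.ne_top_iff_exists.1 (fun e => by
    rw [e, add_top] at h5
    exact ENat.natCast_ne_top (p + q) (by push_cast; exact h5.symm) :
    (Φ.P v ∩ Φ.P w).encard ≠ ⊤)
  rw [← hp, ← hx] at h2
  rw [← hq, ← hx] at h3
  rw [← hr, ← hx] at h4
  rw [← ht] at h5
  norm_cast at h2 h3 h4 h5
  rw [Set.disjoint_iff_inter_eq_empty, ← Set.encard_eq_zero, ← ht]
  norm_cast
  omega

theorem IsFlower.intervalSet_ne_univ (h : Φ.IsFlower) {v w : Φ.C} (hv : v ∉ Φ.I) (hw : w ∉ Φ.I)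
    (hvw : v ≠ w) : Φ.intervalSet v w ≠ Set.univ := by
  obtain ⟨-, -, x, -, hx⟩ := h v hv w hw hvw
  exact fun e => hx (e ▸ Set.mem_univ x)

theorem exists_notMem (Φ : Pseudoflower U k) : ∃ b, b ∉ Φ.I := by
  obtain ⟨i, hi, j, hj, hij⟩ := Φ.nontrivial
  obtain ⟨p, ⟨hp, -⟩, -⟩ := Φ.completion {i} ⟨Set.singleton_subset_iff.2 hi, by
    rintro _ rfl _ rfl
    rw [closedArc_self]
    exact Or.inl Set.inter_subset_left⟩ ⟨i, rfl⟩ fun e => hij (by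
      have : j ∈ ({i} : Set Φ.C) := e ▸ hj
      exact this.symm)
  exact ⟨p.1, hp⟩

/-- Seen from `b`, the four petals are linearly ordered, and each of the three gaps between
consecutive ones contains a cut point; `b` is the fourth. -/
theorem exists_four_cuts (Φ : Pseudoflower U k) (h4 : Φ.I.encard = 4) : ∃ w : Fin 4 → Φ.C,
    (∀ i, w i ∉ Φ.I) ∧ sbtw (w 0) (w 1) (w 2) ∧ sbtw (w 0) (w 2) (w 3) := by
  obtain ⟨b, hb⟩ := Φ.exists_notMem
  have hl := Line.isLineCompletion Φ.completion hb Φ.nontrivial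
  have hcard : (Line.image b Φ.I).encard = 4 := by
    rw [← h4]
    exact Line.of_injective.encard_image _
  have hfin : (Line.image b Φ.I).Finite := Set.finite_of_encard_eq_coe hcard
  have hc : hfin.toFinset.card = 4 := by
    rw [hfin.encard_eq_coe_toFinset_card] at hcard
    exact_mod_cast hcard
  let f := hfin.toFinset.orderEmbOfFin hc
  have hf : ∀ i, f i ∈ Line.image b Φ.I := fun i =>
    hfin.mem_toFinset.1 (Finset.orderEmbOfFin_mem _ hc i)
  have hcut : ∀ i j : Fin 4, i < j → ∃ c : Φ.C, c ∉ Φ.I ∧ f i < Line.of b c ∧ Line.of b c < f j := by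
    intro i j hij
    obtain ⟨s, hs, h1, h2⟩ := hl.exists_cut_between (f.lt_iff_lt.2 hij)
    replace h1 := h1.lt_of_ne fun e => hs (e ▸ hf i)
    replace h2 := h2.lt_of_ne fun e => hs (e ▸ hf j)
    obtain ⟨c, rfl⟩ := (Line.eq_top_or s).resolve_left fun e => by
      subst e; exact not_top_lt h2
    exact ⟨c, fun hc => hs (Line.of_mem_image.2 hc), h1, h2⟩
  obtain ⟨w₁, hw₁, h1, h2⟩ := hcut 0 1 (by decide)
  obtain ⟨w₂, hw₂, h3, h4⟩ := hcut 1 2 (by decide)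
  obtain ⟨w₃, hw₃, h5, -⟩ := hcut 2 3 (by decide)
  have hlt : ∀ {x y}, x ≠ b → Line.of b x < Line.of b y → sbtw b x y := fun hx h =>
    (Line.of_lt_of.1 h).2.resolve_left hx
  have hne : ∀ {x : Φ.C} {i : Fin 4}, f i < Line.of b x → x ≠ b := by
    rintro x i h rfl
    exact not_lt_bot h
  exact ⟨![b, w₁, w₂, w₃], fun i => by fin_cases i <;> assumption, hlt (hne h1) (h2.trans h3),
    hlt (hne h3) (h4.trans h5)⟩

/-- Four cut points of a flower with four petals remain cut points of every extension. -/
theorem ExtendedBy.exists_four_cuts (h : Φ.ExtendedBy Ψ) (hΦ : Φ.IsFlower) (h4 : Φ.I.encard = 4) :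
    ∃ w : Fin 4 → Ψ.C, (∀ i, w i ∉ Ψ.I) ∧ sbtw (w 0) (w 1) (w 2) ∧ sbtw (w 0) (w 2) (w 3) ∧
      ∀ i j, w i ≠ w j → Disjoint (Ψ.P (w i)) (Ψ.P (w j)) ∧
        Ψ.intervalSet (w i) (w j) ≠ Set.univ := by
  obtain ⟨w, hw, h1, h2⟩ := Φ.exists_four_cuts h4
  obtain ⟨F, G, hF, -, hG⟩ := h.exists_section
  have hFG : ∀ i, F (G (w i)) = w i := fun i => (hG _ (hw i)).2.1
  refine ⟨fun i => G (w i), fun i => (hG _ (hw i)).1, hF _ _ _ (by rwa [hFG, hFG, hFG]),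
    hF _ _ _ (by rwa [hFG, hFG, hFG]), fun i j hij => ?_⟩
  have hij' : w i ≠ w j := fun e => hij (congrArg G e)
  obtain ⟨-, -, -, e1, e2⟩ := hG _ (hw i)
  obtain ⟨-, -, -, e3, -⟩ := hG _ (hw j)
  rw [e1, e3, ← e2 _ (hw j)]
  exact ⟨hΦ.disjoint (hw i) (hw j) hij', hΦ.intervalSet_ne_univ (hw i) (hw j) hij'⟩

/-- The line at a cut point with three further cut points that are pairwise disjoint is spread. -/
theorem spread {b v₂ v₃ v₄ : Φ.C} (hb : b ∉ Φ.I) (h2 : v₂ ∉ Φ.I) (h3 : v₃ ∉ Φ.I) (h4 : v₄ ∉ Φ.I)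
    (hs3 : sbtw b v₂ v₃) (hs4 : sbtw b v₃ v₄)
    (hdis : ∀ v ∈ ({b, v₂, v₃, v₄} : Set Φ.C), ∀ w ∈ ({b, v₂, v₃, v₄} : Set Φ.C), v ≠ w →
      Disjoint (Φ.P v) (Φ.P w) ∧ Φ.intervalSet v w ≠ Set.univ) :
    Spread Φ.X (Φ.P b) (lineSep Φ.X (Line.family b Φ.P) (Line.of b v₃) (Line.of b v₂))
      (lineSep Φ.X (Line.family b Φ.P) (Line.of b v₃) (Line.of b v₃))
      (lineSep Φ.X (Line.family b Φ.P) (Line.of b v₃) (Line.of b v₄)) := by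
  have m1 : b ∈ ({b, v₂, v₃, v₄} : Set Φ.C) := by simp
  have m2 : v₂ ∈ ({b, v₂, v₃, v₄} : Set Φ.C) := by simp
  have m3 : v₃ ∈ ({b, v₂, v₃, v₄} : Set Φ.C) := by simp
  have m4 : v₄ ∈ ({b, v₂, v₃, v₄} : Set Φ.C) := by simp
  have n2 := ne_left_of_sbtw hs3
  have n3 := ne_left_of_sbtw hs4
  have n4 := ne_ends_of_sbtw hs4
  have hl := Φ.linFlower hb
  have hmem : ∀ {v}, v ∉ Φ.I → Line.of b v ∉ Line.image b Φ.I := fun hv h =>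
    hv (Line.of_mem_image.1 h)
  have hd0 : Line.of b v₃ ≠ ⊥ := Line.of_injective.ne n3.symm
  have hd1 := Line.of_ne_top (b := b) v₃
  have d3 := (hdis b m1 v₃ m3 n3).1
  have hlt : ∀ {v w}, sbtw b v w → Line.of b v < Line.of b w := fun h =>
    Line.of_lt_of.2 ⟨ne_right_of_sbtw h, Or.inr h⟩
  have hpt : ∀ {v}, v ∉ Φ.I → pt Φ.X (Φ.P b)
      (lineSep Φ.X (Line.family b Φ.P) (Line.of b v₃) (Line.of b v)) = Φ.P v := fun hv =>
    hl.pt_lineSep (d := Line.of b v₃) d3 (hmem hv)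
  have hleft : ∀ {v}, v ∉ Φ.I →
      (lineSep Φ.X (Line.family b Φ.P) (Line.of b v₃) (Line.of b v)).left ∪ Φ.P b =
        Φ.intervalSet b v := by
    intro v hv
    rw [Φ.intervalSet_of_le (b := b) (v := b) bot_le, ← IsCutChain.arcIn_bot (X := Φ.X),
      ← hl.lineSep_bot hd0]
    exact hl.arcIn_lineSep (hmem h3) hd0 hd1 d3 hl.bot_notMem (hmem hv) bot_le
  have hright : ∀ {v}, v ∉ Φ.I → v ≠ b →
      (lineSep Φ.X (Line.family b Φ.P) (Line.of b v₃) (Line.of b v)).right ∪ Φ.P b =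
        Φ.intervalSet v b := by
    intro v hv hvb
    rw [Φ.intervalSet_base_right hvb]
    refine Eq.trans ?_ (hl.arcIn_lineSep (hmem h3) hd0 hd1 d3 (hmem hv) hl.top_notMem le_top)
    rw [hl.lineSep_top hd1]
    ext x
    simp only [arcIn, topSep, Set.mem_union, Set.mem_inter_iff, Set.mem_univ, true_and, true_or,
      and_true]
    rfl
  have hin : ∀ {v w}, v ∉ Φ.I → w ∉ Φ.I → Line.of b v < Line.of b w →
      arcIn (Φ.P b) (lineSep Φ.X (Line.family b Φ.P) (Line.of b v₃) (Line.of b v))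
        (lineSep Φ.X (Line.family b Φ.P) (Line.of b v₃) (Line.of b w)) = Φ.intervalSet v w := by
    intro v w hv hw hvw
    rw [Φ.intervalSet_of_le hvw.le]
    exact hl.arcIn_lineSep (hmem h3) hd0 hd1 d3 (hmem hv) (hmem hw) hvw.le
  have hout : ∀ {v w}, Line.of b v < Line.of b w →
      arcOut (Φ.P b) (lineSep Φ.X (Line.family b Φ.P) (Line.of b v₃) (Line.of b v))
        (lineSep Φ.X (Line.family b Φ.P) (Line.of b v₃) (Line.of b w)) = Φ.intervalSet w v := by
    intro v w hvw
    rw [Φ.intervalSet_of_lt hvw]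
    exact hl.arcOut_lineSep
  have l23 := hlt hs3
  have l34 := hlt hs4
  have n23 := ne_right_of_sbtw hs3
  have n34 := ne_right_of_sbtw hs4
  have n24 : v₂ ≠ v₄ := fun e => (l23.trans l34).ne (by rw [e])
  -- Different cut points may have equal pairs. Equal pairs would make the complementary arc
  -- everything, which is excluded here.
  have hsep : ∀ {v w}, v ∉ Φ.I → w ∉ Φ.I → Line.of b v < Line.of b w → v ≠ b →
      Φ.intervalSet w v ≠ Set.univ →
      lineSep Φ.X (Line.family b Φ.P) (Line.of b v₃) (Line.of b v) <
        lineSep Φ.X (Line.family b Φ.P) (Line.of b v₃) (Line.of b w) := by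
    intro v w hv hw hvw hvb hne
    refine (hl.lineSep_mono (hmem h3) hd0 hd1 d3 (hmem hv) (hmem hw) hvw.le).lt_of_ne fun e => hne ?_
    rw [← hout hvw, ← e]
    exact (hl.linModel (hmem h3) hd0 hd1 d3).sys.cover _ ⟨⟨_, hmem hv⟩, rfl⟩
  exact
  { lt23 := hsep h2 h3 l23 n2.symm (hdis _ m3 _ m2 n23.symm).2
    lt34 := hsep h3 h4 l34 n3.symm (hdis _ m4 _ m3 n34.symm).2
    d02 := by rw [hpt h2]; exact (hdis _ m1 _ m2 n2).1
    d03 := by rw [hpt h3]; exact d3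
    d04 := by rw [hpt h4]; exact (hdis _ m1 _ m4 n4).1
    d23 := by rw [hpt h2, hpt h3]; exact (hdis _ m2 _ m3 n23).1
    d24 := by rw [hpt h2, hpt h4]; exact (hdis _ m2 _ m4 n24).1
    d34 := by rw [hpt h3, hpt h4]; exact (hdis _ m3 _ m4 n34).1
    l2 := by rw [hleft h2]; exact (hdis _ m1 _ m2 n2).2
    r2 := by rw [hright h2 n2.symm]; exact (hdis _ m2 _ m1 n2.symm).2
    l3 := by rw [hleft h3]; exact (hdis _ m1 _ m3 n3).2
    r3 := by rw [hright h3 n3.symm]; exact (hdis _ m3 _ m1 n3.symm).2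
    l4 := by rw [hleft h4]; exact (hdis _ m1 _ m4 n4).2
    r4 := by rw [hright h4 n4.symm]; exact (hdis _ m4 _ m1 n4.symm).2
    i23 := by rw [hin h2 h3 l23]; exact (hdis _ m2 _ m3 n23).2
    o23 := by rw [hout l23]; exact (hdis _ m3 _ m2 n23.symm).2
    i24 := by rw [hin h2 h4 (l23.trans l34)]; exact (hdis _ m2 _ m4 n24).2
    o24 := by rw [hout (l23.trans l34)]; exact (hdis _ m4 _ m2 n24.symm).2
    i34 := by rw [hin h3 h4 l34]; exact (hdis _ m3 _ m4 n34).2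
    o34 := by rw [hout l34]; exact (hdis _ m4 _ m3 n34.symm).2 }

theorem distinguishesProfiles {b d : Φ.C} (hb : b ∉ Φ.I) (hd : d ∉ Φ.I) (hdb : d ≠ b)
    (hdis : Disjoint (Φ.P b) (Φ.P d)) {Q : Fin 3 → Set (VSep V)}
    (hQ : ∀ a, U.IsProfile (k + 1) (Q a))
    (hlow : ∀ a b, Q a ∩ U.sys k = Q b ∩ U.sys k)
    (hdist : ∀ a b, a ≠ b → Φ.Distinguishes (Q a) (Q b)) :
    DistinguishesProfiles U k (Φ.P b) (Set.range fun v : {x // x ∉ Line.image b Φ.I} =>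
      lineSep Φ.X (Line.family b Φ.P) (Line.of b d) v) := by
  refine ⟨Q, hQ, hlow, fun i j hij => ?_⟩
  obtain ⟨_, ⟨v, hv, w, hw, hvw, rfl⟩, h1, h2⟩ := hdist i j hij
  have hl := Φ.linFlower hb
  have hmem : ∀ {v}, v ∉ Φ.I → Line.of b v ∉ Line.image b Φ.I := fun hv h =>
    hv (Line.of_mem_image.1 h)
  have hd0 : Line.of b d ≠ ⊥ := Line.of_injective.ne hdb
  have hd1 := Line.of_ne_top (b := b) d
  have key : ∀ {v w}, v ∉ Φ.I → w ∉ Φ.I → Line.of b v < Line.of b w →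
      arcSep (Φ.P b) (lineSep Φ.X (Line.family b Φ.P) (Line.of b d) (Line.of b v))
        (lineSep Φ.X (Line.family b Φ.P) (Line.of b d) (Line.of b w)) = Φ.S v w := by
    intro v w hv hw hvw
    refine (hl.arcSep_lineSep (hmem hd) hd0 hd1 hdis (hmem hv) (hmem hw) hvw.le).trans ?_
    rw [← Φ.intervalSet_of_le hvw.le, ← Φ.intervalSet_of_lt hvw]
    rfl
  have hmono : ∀ {v w}, v ∉ Φ.I → w ∉ Φ.I → Line.of b v < Line.of b w →
      lineSep Φ.X (Line.family b Φ.P) (Line.of b d) (Line.of b v) ≤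
        lineSep Φ.X (Line.family b Φ.P) (Line.of b d) (Line.of b w) := fun hv hw hvw =>
    hl.lineSep_mono (hmem hd) hd0 hd1 hdis (hmem hv) (hmem hw) hvw.le
  rcases lt_or_gt_of_ne (Line.of_injective.ne hvw : Line.of b v ≠ Line.of b w) with hlt | hlt
  · refine ⟨_, ⟨⟨_, hmem hv⟩, rfl⟩, _, ⟨⟨_, hmem hw⟩, rfl⟩, hmono hv hw hlt, Or.inl ?_⟩
    rw [key hv hw hlt]
    exact ⟨h1, h2⟩
  · refine ⟨_, ⟨⟨_, hmem hw⟩, rfl⟩, _, ⟨⟨_, hmem hv⟩, rfl⟩, hmono hw hv hlt, Or.inr ?_⟩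
    rw [key hw hv hlt]
    exact ⟨h1, h2⟩

end Pseudoflower

theorem mainTheorem3 {V : Type u} (U : SepUniverse V) (hU : U.LimitClosed) (k : ℕ)
    (Φ : Pseudoflower U k)
    (Q : Fin 3 → Set (VSep V))
    (hQ : ∀ a, U.IsProfile (k + 1) (Q a))
    (hlow : ∀ a b, Q a ∩ U.sys k = Q b ∩ U.sys k)
    (hdist : ∀ a b, a ≠ b → Φ.Distinguishes (Q a) (Q b))
    (hflower : ∃ Φ₀ : Pseudoflower U k, Φ₀.IsFlower ∧ Φ₀.I.encard = 4 ∧ Φ₀.ExtendedBy Φ) :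
    ∃ Ψ : Pseudoflower U k, Ψ.IsMaximal ∧ Φ.ExtendedBy Ψ := by
  obtain ⟨Φ₀, hΦ₀, hI, hext⟩ := hflower
  obtain ⟨w, hw, h1, h2, h3⟩ := hext.exists_four_cuts hΦ₀ hI
  have hd := ne_left_of_sbtw h2
  have hdis := (h3 _ _ hd).1
  have hmem : ∀ i, Line.of (w 0) (w i) ∉ Line.image (w 0) Φ.I := fun i h =>
    hw i (Line.of_mem_image.1 h)
  -- The base point is `w 0`; the opposite cut point `w 2` distributes its vertices, and the other
  -- three points form the spread.
  obtain ⟨Ψ, hΨ, hmax⟩ := Pseudoflower.exists_isMaximal hU (hw 0) (hw 2) hd.symm hdis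
    (Pseudoflower.spread (hw 0) (hw 1) (hw 2) (hw 3) h1 h2 (by
      rintro _ (rfl | rfl | rfl | rfl) _ (rfl | rfl | rfl | rfl) h <;> exact h3 _ _ h))
    ⟨⟨_, hmem 1⟩, rfl⟩ ⟨⟨_, hmem 2⟩, rfl⟩ ⟨⟨_, hmem 3⟩, rfl⟩
    (Pseudoflower.distinguishesProfiles (hw 0) (hw 2) hd.symm hdis hQ hlow hdist)
  exact ⟨Ψ, hmax, hΨ⟩
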